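/- Let $a(n,t)>0$, $b(n,t)\in\mathbb R$, $(n,t)\in\mathbb Z\times\mathbb R$, be a solution of the Toda lattice $$\dot b(n,t)=2\big(a(n,t)^2-a(n-1,t)^2\big),\qquad \dot a(n,t)=a(n,t)\big(b(n+1,t)-b(n,t)\big),$$ bounded in $n\in\mathbb Z$ locally uniformly in $t$, such that for one $t_0\in\mathbb R$ one has $\sum_n|n|^l\big(|a(n,t_0)-\tfrac12|+|b(n,t_0)|\big)<\infty$ for every integer $l\ge 0$. Let $H(t)$ be the Jacobi operator $(H(t)f)(n)=a(n,t)f(n+1)+a(n-1,t)f(n-1)+b(n,t)f(n)$ in $\ell^2(\mathbb Z)$. For $0<|z|\le 1$ let $\psi_\pm(z,\cdot,t)$ be the Jost solutions, i.e. the solutions of the difference equation $H(t)\psi_\pm=\tfrac12(z+z^{-1})\psi_\pm$ with $\lim_{n\to\pm\infty}z^{\mp n}\psi_\pm(z,n,t)=1$. The transmission coefficient $T(z)$ and the right reflection coefficient $R(z,t)$ of $H(t)$ are the continuous functions on $|z|=1$ with $$T(z)\psi_-(z,n,t)=\overline{\psi_+(z,n,t)}+R(z,t)\psi_+(z,n,t),\qquad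 |z|=1,\ n\in\mathbb Z;$$ $T$ is extended meromorphically to $|z|<1$, continuously up to the boundary. Put $R(z)=R(z,0)$. Let $\zeta_k$ run through the points of $(-1,0)\cup(0,1)$ for which $\tfrac12(\zeta_k+\zeta_k^{-1})$ is an eigenvalue of $H(0)$, and let $\gamma_k=\big(\sum_n|\psi_+(\zeta_k,n,0)|^2\big)^{-1}$. Write $t\Phi(z)=t(z-z^{-1})+2n\log z$ (so $\Phi(z)=z-z^{-1}+2\tfrac nt\log z$ for $t\neq0$). For $n\in\mathbb Z$, $t\in\mathbb R$ define the row vector $$m(z)=m(z,n,t)=\begin{cases}\big(T(z)\psi_-(z,n,t)z^n,\ \ \psi_+(z,n,t)z^{-n}\big),&|z|<1,\\ \big(\psi_+(z^{-1},n,t)z^n,\ \ T(z^{-1})\psi_-(z^{-1},n,t)z^{-n}\big),&|z|>1,\end{cases}$$ where $m(0)$ is understood as $\lim_{z\to0}m(z)$. Then there are only finitely many $\zeta_k$, $\gamma_k>0$ for all $k$, and for all $n\in\mathbb Z$, $t\in\mathbb R$ the function $m$ is meromorphic away from the unit circle, holomorphic except for at most simple poles at the points $\zeta_k$, $\zeta_k^{-1}$,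 and satisfies: 1. (Jump condition) For $|z|=1$ the limits $m_\pm(z)=\lim_{w\to z,\ |w|^{\pm1}<1}m(w)$ exist, are continuous in $z$, and $$m_+(z)=m_-(z)\begin{pmatrix}1-|R(z)|^2&-\overline{R(z)}e^{-t\Phi(z)}\\ R(z)e^{t\Phi(z)}&1\end{pmatrix}.$$ 2. (Pole conditions) $$\operatorname{Res}_{\zeta_k}m(z)=\lim_{z\to\zeta_k}m(z)\begin{pmatrix}0&0\\-\zeta_k\gamma_ke^{t\Phi(\zeta_k)}&0\end{pmatrix},\qquad \operatorname{Res}_{\zeta_k^{-1}}m(z)=\lim_{z\to\zeta_k^{-1}}m(z)\begin{pmatrix}0&\zeta_k^{-1}\gamma_ke^{t\Phi(\zeta_k)}\\0&0\end{pmatrix}.$$ 3. (Symmetry) $m(z^{-1})=m(z)\begin{pmatrix}0&1\\1&0\end{pmatrix}$ for $|z|\ne1$, where for $z=0$ the left side is $\lim_{z\to\infty}m(z)$. 4. (Normalization) $m(0)=(m_1\ \ m_2)$ with real $m_1,m_2$, $m_1m_2=1$ and $m_1>0$. -/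

import Mathlib

open Filter Topology
open scoped Matrix

namespace TodaRHP

/-- The Jacobi difference expression `(H f)(n) = a(n) f(n+1) + a(n-1) f(n-1) + b(n) f(n)`. -/
def jacobi (a b : ℤ → ℝ) (f : ℤ → ℂ) (n : ℤ) : ℂ :=
  (a n : ℂ) * f (n + 1) + (a (n - 1) : ℂ) * f (n - 1) + (b n : ℂ) * f n

/-- Solutions of the Toda lattice in Flaschka variables. As usual, `a > 0` and the solution is
bounded in `n`, locally uniformly in time, so that each `H(t)` is a bounded Jacobi operator
and `t ↦ (a(t), b(t))` is a continuous curve in `ℓ^∞`. -/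
structure IsTodaSolution (a b : ℤ → ℝ → ℝ) : Prop where
  a_pos : ∀ n t, 0 < a n t
  deriv_b : ∀ n t, HasDerivAt (b n) (2 * (a n t ^ 2 - a (n - 1) t ^ 2)) t
  deriv_a : ∀ n t, HasDerivAt (a n) (a n t * (b (n + 1) t - b n t)) t
  locallyBounded : ∀ τ : ℝ, ∃ C : ℝ, ∀ t : ℝ, |t| ≤ τ → ∀ n, |a n t| ≤ C ∧ |b n t| ≤ C

/-- All polynomial moments of `(a - 1/2, b)` are finite. -/
def HasDecay (a b : ℤ → ℝ) : Prop :=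
  ∀ l : ℕ, Summable fun n : ℤ => |(n : ℝ)| ^ l * (|a n - 1 / 2| + |b n|)

/-- `f` is the right Jost solution at the point `z`, `0 < |z| ≤ 1`. (For decaying coefficients
there is exactly one such `f`.) -/
def IsJostPlus (a b : ℤ → ℝ) (z : ℂ) (f : ℤ → ℂ) : Prop :=
  (∀ n, jacobi a b f n = (z + z⁻¹) / 2 * f n) ∧
    Tendsto (fun n : ℤ => z ^ (-n) * f n) atTop (𝓝 1)

/-- `f` is the left Jost solution at the point `z`, `0 < |z| ≤ 1`. -/
def IsJostMinus (a b : ℤ → ℝ) (z : ℂ) (f : ℤ → ℂ) : Prop :=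
  (∀ n, jacobi a b f n = (z + z⁻¹) / 2 * f n) ∧
    Tendsto (fun n : ℤ => z ^ n * f n) atBot (𝓝 1)

/-- The right Jost solution `ψ₊(z, ·)`. -/
noncomputable def jostPlus (a b : ℤ → ℝ) (z : ℂ) : ℤ → ℂ :=
  Classical.epsilon (IsJostPlus a b z)

/-- The left Jost solution `ψ₋(z, ·)`. -/
noncomputable def jostMinus (a b : ℤ → ℝ) (z : ℂ) : ℤ → ℂ :=
  Classical.epsilon (IsJostMinus a b z)

/-- `T` and `R` are the transmission coefficient and the right reflection coefficient: they are
continuous on the unit circle and satisfy the scattering relation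
`T ψ₋ = conj ψ₊ + R ψ₊` there, and `T` on the open unit disc is the meromorphic extension
of its boundary values. The normal form fixes the values of `T` at removable
singularities to be the limits. Only the values of `T` on the closed disc and of `R` on the
circle matter, and these are uniquely determined. -/
structure IsScatteringPair (a b : ℤ → ℝ) (T R : ℂ → ℂ) : Prop where
  meromorphic : MeromorphicNFOn T (Metric.ball 0 1)
  boundary : ∃ r : ℝ, r < 1 ∧ ContinuousOn T {z | r < ‖z‖ ∧ ‖z‖ ≤ 1}
  continuous_reflection : ContinuousOn R (Metric.sphere 0 1)
  relation : ∀ z : ℂ, ‖z‖ = 1 → ∀ n,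
    T z * jostMinus a b z n = (starRingEnd ℂ) (jostPlus a b z n) + R z * jostPlus a b z n

/-- The transmission coefficient together with the right reflection coefficient. -/
noncomputable def scatteringPair (a b : ℤ → ℝ) : (ℂ → ℂ) × (ℂ → ℂ) :=
  Classical.epsilon fun p => IsScatteringPair a b p.1 p.2

/-- The transmission coefficient `T(z)`, `|z| ≤ 1`. -/
noncomputable def transmission (a b : ℤ → ℝ) : ℂ → ℂ := (scatteringPair a b).1

/-- The right reflection coefficient `R₊(z)`, `|z| = 1`. -/
noncomputable def reflection (a b : ℤ → ℝ) : ℂ → ℂ := (scatteringPair a b).2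

/-- `lam` is an eigenvalue of the Jacobi operator in `ℓ²(ℤ)`. -/
def IsEigenvalue (a b : ℤ → ℝ) (lam : ℝ) : Prop :=
  ∃ f : ℤ → ℂ, f ≠ 0 ∧ Memℓp f 2 ∧ ∀ n, jacobi a b f n = (lam : ℂ) * f n

/-- The points `ζ ∈ (-1,0) ∪ (0,1)` for which `(ζ + ζ⁻¹) / 2` is an eigenvalue. -/
def discreteData (a b : ℤ → ℝ) : Set ℝ :=
  {ζ | ζ ≠ 0 ∧ |ζ| < 1 ∧ IsEigenvalue a b ((ζ + ζ⁻¹) / 2)}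

/-- The right norming constant `γ₊` at `ζ`, with `γ₊⁻¹ = ∑ₙ |ψ₊(ζ, n)|²`. -/
noncomputable def normingConstant (a b : ℤ → ℝ) (ζ : ℝ) : ℝ :=
  (∑' n : ℤ, ‖jostPlus a b (ζ : ℂ) n‖ ^ 2)⁻¹

/-- The phase `Φ(z) = z - z⁻¹ + 2 (n/t) log z`. -/
noncomputable def phase (n : ℤ) (t : ℝ) (z : ℂ) : ℂ :=
  z - z⁻¹ + 2 * ((n : ℂ) / (t : ℂ)) * Complex.log z

/-- The product `t Φ(z) = t (z - z⁻¹) + 2 n log z`, written so that it makes sense for `t = 0`. -/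
noncomputable def timesPhase (n : ℤ) (t : ℝ) (z : ℂ) : ℂ :=
  (t : ℂ) * (z - z⁻¹) + 2 * (n : ℂ) * Complex.log z

theorem timesPhase_eq (n : ℤ) (t : ℝ) (z : ℂ) (ht : t ≠ 0) :
    timesPhase n t z = (t : ℂ) * phase n t z := by
  have h : (t : ℂ) ≠ 0 := by exact_mod_cast ht
  unfold timesPhase phase
  field_simp

/-- The formula for the row vector `m(z, n)` for `z ≠ 0` off the unit circle. -/
noncomputable def rhpVectorAux (a b : ℤ → ℝ) (n : ℤ) (z : ℂ) : Fin 2 → ℂ :=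
  if ‖z‖ < 1 then
    ![transmission a b z * jostMinus a b z n * z ^ n, jostPlus a b z n * z ^ (-n)]
  else
    ![jostPlus a b z⁻¹ n * z ^ n, transmission a b z⁻¹ * jostMinus a b z⁻¹ n * z ^ (-n)]

open Classical in
/-- The row vector `m(z, n)` off the unit circle. At `z = 0`, where the Jost solutions are not
defined, its value is the limit as `z → 0`. -/
noncomputable def rhpVector (a b : ℤ → ℝ) (n : ℤ) (z : ℂ) : Fin 2 → ℂ :=
  if z = 0 then limUnder (𝓝[≠] (0 : ℂ)) (rhpVectorAux a b n) else rhpVectorAux a b n z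

/-- The jump matrix `v(z)`, for a reflection coefficient `R`. -/
noncomputable def jumpMatrix (R : ℂ → ℂ) (n : ℤ) (t : ℝ) (z : ℂ) : Matrix (Fin 2) (Fin 2) ℂ :=
  !![1 - (‖R z‖ : ℂ) ^ 2, -(starRingEnd ℂ) (R z) * Complex.exp (-timesPhase n t z);
     R z * Complex.exp (timesPhase n t z), 1]

/-- The vector valued function `m` has residue `ρ` at an (at most) simple pole `w`. -/
def HasSimpleResidue (m : ℂ → Fin 2 → ℂ) (w : ℂ) (ρ : Fin 2 → ℂ) : Prop :=
  (∀ i, MeromorphicAt (fun z => m z i) w ∧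
    ((-1 : ℤ) : WithTop ℤ) ≤ meromorphicOrderAt (fun z => m z i) w) ∧
    Tendsto (fun z => (z - w) • m z) (𝓝[≠] w) (𝓝 ρ)

end TodaRHP

/-!
The argument runs through direct scattering theory at a fixed time and then follows the scattering
data along the flow.

*Jost functions.* The right Jost solution is `zⁿ` times a power series in `z` whose coefficients
are given by sums over the half line (`jostCoeff`). The moment condition makes their first moment
finite, so the series, `jostFun`, is complex differentiable on the closed disc, boundary included
(`HasDecay.differentiableOn_jostFun`). Reflecting the lattice gives the left Jost solution
(`jostFunLeft`). A Wronskian argument at infinity shows uniqueness, so that these are the Jost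
solutions of the statement (`HasDecay.jostPlus_apply`, `HasDecay.jostMinus_apply`).

*The Jost determinant* `D(z) = -2 z W(ψ₋, ψ₊)` is differentiable on the closed disc. On the circle
`|1 - z²| ≤ |D(z)|` (`HasDecay.norm_one_sub_sq_le`), hence zeros there can only occur at `±1` and
are simple. Its zeros in the open disc are exactly the points `ζ` with `(ζ + ζ⁻¹) / 2` an eigenvalue
(`HasDecay.jostDet_eq_zero_iff`), are finite in number (`HasDecay.finite_zeros`), and are simple
with `D'(ζ) = (ζ - ζ⁻¹) c / γ` where `ψ₋ = c ψ₊` (`HasDecay.tendsto_jostDet_div`).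
The transmission coefficient is therefore `T = (1 - z²) / D`, extended continuously to the circle
(`transFun`). Scattering pairs exist and are unique (`HasDecay.isScatteringPair`,
`IsScatteringPair.unique`); uniqueness inside the disc is the maximum principle on an annulus
followed by the identity theorem.

*Time evolution.* Finite speed of propagation carries the decay from one time to all times
(`IsTodaSolution.hasDecay`). By the Lax structure a solution of `H(0) f = l f` extends to a family
of solutions of `H(t) φ = l φ` obeying a linear evolution equation (`IsTodaSolution.exists_flow`),
and Gronwall's inequality gives its asymptotics at `±∞` (`IsFlow.tendsto`). So the flow maps
`ψ₊(0)` to `exp (t (z - z⁻¹) / 2) ψ₊(t)` and `ψ₋(0)` to `exp (-t (z - z⁻¹) / 2) ψ₋(t)`. Linear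
relations between the Jost solutions are preserved by the flow, whence `T` is constant,
`R(t) = R exp (t (z - z⁻¹))` (`IsTodaSolution.isScatteringPair`), and `c(t) = c exp (t (ζ - ζ⁻¹))`
(`IsTodaSolution.jostMinus_eq_mul`).

*The vector.* In the disc it equals `(T jostFunLeft, jostFun)`, and outside it is obtained by
`z ↦ z⁻¹` and exchange of the components, so symmetry is immediate. The scattering relation and
its conjugate are the two components of the jump condition (`IsScatteringPair.jump`), the residue
of `T` and the evolution of `c` give the pole conditions
(`IsTodaSolution.tendsto_sub_smul_rhpDisc`), and the values at the origin are reciprocal because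
`T(0) = 1 / D(0)` and `D(0) = jostFunLeft(0) jostFun(0)` (`HasDecay.rhpDisc_zero`).
-/

namespace TodaRHP

/-! ### Tail sums and decay of the coefficients -/

/-- The sum `∑ f m` over all `m ≥ n`. -/
noncomputable def tailSum (f : ℤ → ℝ) (n : ℤ) : ℝ := ∑' i : ℕ, f (n + i)

/-- `f` is summable towards `+∞`. -/
def TailSummable (f : ℤ → ℝ) : Prop := ∀ n : ℤ, Summable fun i : ℕ => f (n + i)

theorem tailSum_eq_add {f : ℤ → ℝ} (h : TailSummable f) (n : ℤ) :
    tailSum f n = f n + tailSum f (n + 1) := by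
  have := (h n).tsum_eq_zero_add
  simp only [tailSum, this, Nat.cast_zero, add_zero]
  congr 1
  refine tsum_congr fun i => ?_
  congr 1; push_cast; ring

theorem tailSum_nonneg {f : ℤ → ℝ} (h : ∀ n, 0 ≤ f n) (n : ℤ) : 0 ≤ tailSum f n :=
  tsum_nonneg fun _ => h _

theorem tailSum_antitone {f : ℤ → ℝ} (hs : TailSummable f) (h : ∀ n, 0 ≤ f n) :
    Antitone (tailSum f) := by
  refine antitone_int_of_succ_le fun n => ?_
  rw [tailSum_eq_add hs n]
  linarith [h n]

/-- Half of the decay exponent survives in the tail sums, since `(p + 1) (i + 1) ≤ (p + i + 1)²`. -/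
theorem tailSum_le_of_le {f : ℤ → ℝ} {N : ℤ} {K : ℝ}
    (h : ∀ p : ℕ, |f (N + p)| ≤ K / ((p : ℝ) + 1) ^ 6) :
    ∃ K', ∀ p : ℕ, tailSum (fun m => |f m|) (N + p) ≤ K' / ((p : ℝ) + 1) ^ 3 := by
  have hK : 0 ≤ K := by
    have := h 0
    simp only [Nat.cast_zero, add_zero, zero_add, one_pow, div_one] at this
    exact (abs_nonneg _).trans this
  have hs : Summable fun i : ℕ => 1 / ((i : ℝ) + 1) ^ 3 := by
    have := (summable_nat_add_iff 1).2 (Real.summable_one_div_nat_pow.2 (by norm_num : 1 < 3))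
    simpa using this
  refine ⟨K * ∑' i : ℕ, 1 / ((i : ℝ) + 1) ^ 3, fun p => ?_⟩
  have hb : ∀ i : ℕ, |f (N + p + i)| ≤ K / ((p : ℝ) + 1) ^ 3 * (1 / ((i : ℝ) + 1) ^ 3) := by
    intro i
    have h1 := h (p + i)
    push_cast at h1
    rw [← add_assoc] at h1
    refine h1.trans ?_
    rw [div_mul_div_comm, mul_one]
    gcongr
    rw [← mul_pow, show (6 : ℕ) = 2 * 3 from rfl, pow_mul]
    gcongr
    have : (0 : ℝ) ≤ p := by positivity
    have : (0 : ℝ) ≤ i := by positivity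
    nlinarith
  have hs' := hs.mul_left (K / ((p : ℝ) + 1) ^ 3)
  calc tailSum (fun m => |f m|) (N + p)
      ≤ ∑' i : ℕ, K / ((p : ℝ) + 1) ^ 3 * (1 / ((i : ℝ) + 1) ^ 3) :=
        (Summable.of_nonneg_of_le (fun _ => abs_nonneg _) hb hs').tsum_le_tsum hb hs'
    _ = _ := by rw [tsum_mul_left]; ring

theorem tailSummable_of_le {f : ℤ → ℝ} {k : ℕ} (hk : 1 < k)
    (h : ∀ N : ℤ, ∃ K : ℝ, ∀ p : ℕ, |f (N + p)| ≤ K / ((p : ℝ) + 1) ^ k) : TailSummable f := by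
  intro N
  obtain ⟨K, hK⟩ := h N
  have hs : Summable fun i : ℕ => K * (1 / ((i : ℝ) + 1) ^ k) := by
    have := (summable_nat_add_iff 1).2 (Real.summable_one_div_nat_pow.2 hk)
    exact Summable.mul_left K (by simpa using this)
  refine Summable.of_norm_bounded hs fun i => ?_
  have := hK i
  rwa [mul_one_div]

/-- Finite moments give pointwise bounds of every polynomial order on each half line. -/
theorem HasDecay.exists_le {a b : ℤ → ℝ} (h : HasDecay a b) (N : ℤ) :
    ∃ K : ℝ, ∀ p : ℕ, |a (N + p) - 1 / 2| + |b (N + p)| ≤ K / ((p : ℝ) + 1) ^ 6 := by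
  set s : ℤ → ℝ := fun n => |a n - 1 / 2| + |b n| with hs
  have hs0 : ∀ n, 0 ≤ s n := fun n => by positivity
  have hle : ∀ l : ℕ, ∀ n : ℤ, |(n : ℝ)| ^ l * s n ≤ ∑' n : ℤ, |(n : ℝ)| ^ l * s n := fun l n =>
    (h l).le_tsum n fun m _ => mul_nonneg (by positivity) (hs0 m)
  set L : ℝ := |(N : ℝ)| + 1
  refine ⟨32 * (L ^ 6 * (∑' n : ℤ, |(n : ℝ)| ^ 0 * s n) + ∑' n : ℤ, |(n : ℝ)| ^ 6 * s n),
    fun p => ?_⟩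
  rw [le_div_iff₀ (by positivity)]
  set m : ℤ := N + p with hm
  have hp : (p : ℝ) + 1 ≤ L + |(m : ℝ)| := by
    have h1 : (p : ℝ) = m - N := by rw [hm]; push_cast; ring
    rw [h1]
    have := le_abs_self (m : ℝ)
    have := neg_abs_le (N : ℝ)
    simp only [L]; linarith
  have h6 : ((p : ℝ) + 1) ^ 6 ≤ 32 * (L ^ 6 + |(m : ℝ)| ^ 6) := by
    refine (pow_le_pow_left₀ (by positivity) hp 6).trans ?_
    have := add_pow_le (show 0 ≤ L by positivity) (abs_nonneg (m : ℝ)) 6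
    norm_num at this ⊢
    exact this
  have hA := hle 0 m
  have hB := hle 6 m
  rw [pow_zero, one_mul] at hA
  calc s m * ((p : ℝ) + 1) ^ 6 ≤ s m * (32 * (L ^ 6 + |(m : ℝ)| ^ 6)) := by
        gcongr
    _ = 32 * (L ^ 6 * s m + |(m : ℝ)| ^ 6 * s m) := by ring
    _ ≤ _ := by gcongr

/-- The size of the perturbation of the free operator at site `n`. -/
noncomputable def perturbation (a b : ℤ → ℝ) (n : ℤ) : ℝ := |1 - 4 * a n ^ 2| + 2 * |b n|

theorem perturbation_nonneg (a b : ℤ → ℝ) (n : ℤ) : 0 ≤ perturbation a b n := by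
  unfold perturbation; positivity

theorem HasDecay.exists_perturbation_le {a b : ℤ → ℝ} (h : HasDecay a b) (N : ℤ) :
    ∃ K : ℝ, ∀ p : ℕ, |perturbation a b (N + p)| ≤ K / ((p : ℝ) + 1) ^ 6 := by
  obtain ⟨K, hK⟩ := h.exists_le N
  have hK0 : 0 ≤ K := by
    have := hK 0
    simp only [Nat.cast_zero, add_zero, zero_add, one_pow, div_one] at this
    exact le_trans (by positivity) this
  refine ⟨(4 * K + 4) * K, fun p => ?_⟩
  rw [abs_of_nonneg (perturbation_nonneg _ _ _)]
  have h1 := hK p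
  set x := a (N + p) - 1 / 2 with hx
  have hx1 : |x| ≤ K := by
    have : K / ((p : ℝ) + 1) ^ 6 ≤ K := by
      apply div_le_self hK0
      exact one_le_pow₀ (by linarith [(Nat.cast_nonneg p : (0 : ℝ) ≤ p)])
    linarith [abs_nonneg (b (N + p))]
  have h2 : |1 - 4 * a (N + p) ^ 2| ≤ (4 * K + 4) * |x| := by
    have : 1 - 4 * a (N + p) ^ 2 = -(4 * x) * (1 + x) := by rw [hx]; ring
    rw [this, abs_mul, abs_neg, abs_mul]
    have h3 : |1 + x| ≤ 1 + |x| := by simpa using abs_add_le 1 x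
    have : |(4 : ℝ)| = 4 := by norm_num
    rw [this]
    nlinarith [abs_nonneg x]
  calc perturbation a b (N + p) ≤ (4 * K + 4) * (|x| + |b (N + p)|) := by
        unfold perturbation
        nlinarith [abs_nonneg (b (N + p))]
    _ ≤ (4 * K + 4) * (K / ((p : ℝ) + 1) ^ 6) := by gcongr
    _ = _ := by ring

theorem HasDecay.tailSummable_perturbation {a b : ℤ → ℝ} (h : HasDecay a b) :
    TailSummable (perturbation a b) :=
  tailSummable_of_le (by norm_num) h.exists_perturbation_le

theorem HasDecay.exists_tailSum_le {a b : ℤ → ℝ} (h : HasDecay a b) (N : ℤ) :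
    ∃ K : ℝ, ∀ p : ℕ, tailSum (perturbation a b) (N + p) ≤ K / ((p : ℝ) + 1) ^ 3 := by
  obtain ⟨K, hK⟩ := h.exists_perturbation_le N
  obtain ⟨K', hK'⟩ := tailSum_le_of_le hK
  refine ⟨K', fun p => ?_⟩
  simpa only [abs_of_nonneg (perturbation_nonneg _ _ _)] using hK' p

/-- Two-fold tail sums of the perturbation exist, so that the kernel bound `abs_jostCoeff_succ_le`
applies. -/
theorem HasDecay.tailSummable_tailSum {a b : ℤ → ℝ} (h : HasDecay a b) :
    TailSummable (tailSum (perturbation a b)) := by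
  refine tailSummable_of_le (k := 3) (by norm_num) fun N => ?_
  obtain ⟨K, hK⟩ := h.exists_tailSum_le N
  refine ⟨K, fun p => ?_⟩
  rw [abs_of_nonneg (tailSum_nonneg (perturbation_nonneg a b) _)]
  exact hK p

/-! ### The coefficients of the right Jost solution -/

/-- The Taylor coefficients in `z` of the right Jost solution, up to normalisation: the solution is
`zⁿ A(n) ∑ⱼ kⱼ(n) zʲ`. The Jost condition at `+∞` and the difference equation determine them
recursively through sums over the half line. -/
noncomputable def jostCoeff (a b : ℤ → ℝ) : ℕ → ℤ → ℝ
  | 0, _ => 1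
  | 1, n => ∑' i : ℕ, -(2 * b (n + 1 + i))
  | (j + 2), n => (if j = 0 then 0 else jostCoeff a b j (n + 1)) +
      ∑' i : ℕ, ((1 - 4 * a (n + 1 + i) ^ 2) * jostCoeff a b j (n + 1 + i + 1) -
        2 * b (n + 1 + i) * jostCoeff a b (j + 1) (n + 1 + i))

section coeff

variable {a b : ℤ → ℝ}

theorem abs_source_le {n : ℤ} {B x y : ℝ} (hx : |x| ≤ B) (hy : |y| ≤ B) :
    |(1 - 4 * a n ^ 2) * x - 2 * b n * y| ≤ perturbation a b n * B := by
  have h1 : |(1 - 4 * a n ^ 2) * x| ≤ |1 - 4 * a n ^ 2| * B := by rw [abs_mul]; gcongr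
  have h2 : |2 * b n * y| ≤ 2 * |b n| * B := by
    rw [abs_mul, abs_mul, abs_of_pos (two_pos : (0 : ℝ) < 2)]; gcongr
  calc _ ≤ _ := abs_sub _ _
    _ ≤ _ := add_le_add h1 h2
    _ = _ := by unfold perturbation; ring

theorem abs_tsum_source_le (hs : TailSummable (perturbation a b)) {n : ℤ} {B : ℝ} {x y : ℕ → ℝ}
    (hx : ∀ i, |x i| ≤ B) (hy : ∀ i, |y i| ≤ B) :
    |∑' i : ℕ, ((1 - 4 * a (n + i) ^ 2) * x i - 2 * b (n + i) * y i)| ≤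
      tailSum (perturbation a b) n * B := by
  rw [← Real.norm_eq_abs]
  exact tsum_of_norm_bounded ((hs n).hasSum.mul_right B) fun i => abs_source_le (hx i) (hy i)

theorem summable_source (hs : TailSummable (perturbation a b)) {n : ℤ} {B : ℝ} {x y : ℕ → ℝ}
    (hx : ∀ i, |x i| ≤ B) (hy : ∀ i, |y i| ≤ B) :
    Summable fun i : ℕ => (1 - 4 * a (n + i) ^ 2) * x i - 2 * b (n + i) * y i :=
  Summable.of_norm_bounded ((hs n).mul_right B) fun i => abs_source_le (hx i) (hy i)

/-- The classical bound on the kernel of the transformation operator: strong induction on `j`, where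
the factor `exp` absorbs one factor `1 + C (n + 1)` per step, `C` being the tail sum. -/
theorem abs_jostCoeff_succ_le (hs : TailSummable (perturbation a b))
    (hs' : TailSummable (tailSum (perturbation a b))) (j : ℕ) (n : ℤ) :
    |jostCoeff a b (j + 1) n| ≤ Real.exp (tailSum (tailSum (perturbation a b)) (n + 1)) *
      tailSum (perturbation a b) (n + ((j + 1) / 2 : ℕ)) := by
  set C := tailSum (perturbation a b) with hC
  set E : ℤ → ℝ := fun n => Real.exp (tailSum C (n + 1)) with hE
  have hC0 : ∀ n, 0 ≤ C n := tailSum_nonneg (perturbation_nonneg a b)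
  have hCanti : Antitone C := tailSum_antitone hs (perturbation_nonneg a b)
  have hE1 : ∀ n, 1 ≤ E n := fun n => Real.one_le_exp (tailSum_nonneg hC0 _)
  have hEanti : Antitone E := fun m n hmn =>
    Real.exp_le_exp.2 (tailSum_antitone hs' hC0 (by linarith))
  have hEstep : ∀ n, (1 + C (n + 1)) * E (n + 1) ≤ E n := by
    intro n
    have h1 : E n = Real.exp (C (n + 1)) * E (n + 1) := by
      simp only [hE]
      rw [tailSum_eq_add hs' (n + 1), Real.exp_add]
    rw [h1]
    gcongr
    linarith [Real.add_one_le_exp (C (n + 1))]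
  change _ ≤ E n * _
  induction j using Nat.strong_induction_on generalizing n with
  | _ j ih =>
    have hE0 : ∀ n, 0 ≤ E n := fun n => zero_le_one.trans (hE1 n)
    match j, ih with
    | 0, _ =>
      have := abs_tsum_source_le hs (n := n + 1) (B := 1) (x := fun _ => 0) (y := fun _ => 1)
        (by simp) (by simp)
      simp only [mul_zero, zero_sub, mul_one] at this
      simp only [jostCoeff, zero_add, Nat.reduceDiv, Nat.cast_zero, add_zero]
      refine this.trans ((hCanti (by linarith)).trans ?_)
      exact le_mul_of_one_le_left (hC0 n) (hE1 n)
    | 1, ih =>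
      simp only [jostCoeff, ↓reduceIte, zero_add, Nat.reduceAdd, Nat.reduceDiv, Nat.cast_one]
      have h1 : 1 ≤ E n := hE1 n
      have h2 : E (n + 1) * C (n + 1) ≤ E n := by nlinarith [hEstep n, hE0 (n + 1)]
      rw [mul_comm (E n)]
      refine abs_tsum_source_le hs (fun i => by simpa using h1) fun i => ?_
      have := ih 0 (by norm_num) (n + 1 + i)
      simp only [zero_add, Nat.reduceDiv, Nat.cast_zero, add_zero] at this
      refine (this.trans ?_).trans h2
      have hi : n + 1 ≤ n + 1 + (i : ℤ) := by linarith [Int.natCast_nonneg i]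
      exact mul_le_mul (hEanti hi) (hCanti hi) (hC0 _) (hE0 _)
    | j + 2, ih =>
      have hdiv : (((j + 2 + 1) / 2 : ℕ) : ℤ) = ((j + 1) / 2 : ℕ) + 1 := by
        have : (j + 2 + 1) / 2 = (j + 1) / 2 + 1 := by omega
        rw [this]; push_cast; ring
      have hdiv' : (((j + 1) / 2 : ℕ) : ℤ) ≤ ((j + 1 + 1) / 2 : ℕ) := by
        exact_mod_cast Nat.div_le_div_right (by omega)
      rw [hdiv]
      set q : ℤ := (((j + 1) / 2 : ℕ) : ℤ) with hq
      set B := E (n + 1) * C (n + (q + 1)) with hB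
      have key : |∑' i : ℕ, ((1 - 4 * a (n + 1 + i) ^ 2) * jostCoeff a b (j + 1) (n + 1 + i + 1) -
          2 * b (n + 1 + i) * jostCoeff a b (j + 1 + 1) (n + 1 + i))| ≤ C (n + 1) * B := by
        refine abs_tsum_source_le hs (fun i => ?_) fun i => ?_
        · refine (ih j (by omega) _).trans ?_
          exact mul_le_mul (hEanti (by linarith [Int.natCast_nonneg i]))
            (hCanti (by linarith [Int.natCast_nonneg i])) (hC0 _) (hE0 _)
        · refine (ih (j + 1) (by omega) _).trans ?_
          exact mul_le_mul (hEanti (by linarith [Int.natCast_nonneg i]))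
            (hCanti (by linarith [Int.natCast_nonneg i])) (hC0 _) (hE0 _)
      have h3 : |jostCoeff a b (j + 1) (n + 1)| ≤ B := by
        refine (ih j (by omega) _).trans (le_of_eq ?_)
        rw [hB]; congr 2; ring
      rw [show j + 2 + 1 = (j + 1) + 2 from rfl, jostCoeff, if_neg (by omega)]
      calc _ ≤ _ := abs_add_le _ _
        _ ≤ B + C (n + 1) * B := add_le_add h3 key
        _ = (1 + C (n + 1)) * E (n + 1) * C (n + (q + 1)) := by rw [hB]; ring
        _ ≤ _ := by gcongr; exacts [hC0 _, hEstep n]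

/-- The coefficients are dominated, uniformly on half lines, by a sequence with a finite first
moment. -/
theorem HasDecay.exists_jostCoeff_le (h : HasDecay a b) (N : ℤ) :
    ∃ K : ℝ, 0 ≤ K ∧ ∀ (p j : ℕ),
      |jostCoeff a b (j + 1) (N + p)| ≤ K / (((p + (j + 1) / 2 : ℕ) : ℝ) + 1) ^ 3 := by
  have hs := h.tailSummable_perturbation
  have hs' := h.tailSummable_tailSum
  obtain ⟨K, hK⟩ := h.exists_tailSum_le N
  have hC0 := tailSum_nonneg (perturbation_nonneg a b)
  have hK0 : 0 ≤ K := by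
    have := (hC0 _).trans (hK 0)
    simpa using this
  set E := Real.exp (tailSum (tailSum (perturbation a b)) (N + 1))
  refine ⟨E * K, by positivity, fun p j => (abs_jostCoeff_succ_le hs hs' j _).trans ?_⟩
  rw [mul_div_assoc]
  have h1 := hK (p + (j + 1) / 2)
  rw [Nat.cast_add, ← add_assoc] at h1
  refine mul_le_mul (Real.exp_le_exp.2 (tailSum_antitone hs' hC0 ?_)) h1 (hC0 _)
    (Real.exp_pos _).le
  linarith [Int.natCast_nonneg p]

theorem HasDecay.exists_jostCoeff_bound (h : HasDecay a b) (N : ℤ) (j : ℕ) :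
    ∃ B : ℝ, ∀ p : ℕ, |jostCoeff a b j (N + p)| ≤ B := by
  cases j with
  | zero => exact ⟨1, fun p => by simp [jostCoeff]⟩
  | succ j =>
    obtain ⟨K, hK0, hK⟩ := h.exists_jostCoeff_le N
    refine ⟨K, fun p => (hK p j).trans (div_le_self hK0 ?_)⟩
    exact one_le_pow₀ (by linarith [(Nat.cast_nonneg (p + (j + 1) / 2) : (0 : ℝ) ≤ _)])

theorem HasDecay.summable_source (h : HasDecay a b) (j : ℕ) (n : ℤ) :
    Summable fun i : ℕ => (1 - 4 * a (n + i) ^ 2) * jostCoeff a b j (n + i + 1) -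
        2 * b (n + i) * jostCoeff a b (j + 1) (n + i) := by
  obtain ⟨B, hB⟩ := h.exists_jostCoeff_bound n j
  obtain ⟨B', hB'⟩ := h.exists_jostCoeff_bound n (j + 1)
  refine TodaRHP.summable_source (B := max B B') h.tailSummable_perturbation
    (fun i => ?_) fun i => (hB' i).trans (le_max_right _ _)
  have := hB (i + 1)
  push_cast at this
  rw [← add_assoc] at this
  exact this.trans (le_max_left _ _)

theorem HasDecay.jostCoeff_one_sub (h : HasDecay a b) (n : ℤ) :
    jostCoeff a b 1 (n - 1) = jostCoeff a b 1 n - 2 * b n := by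
  have hs : TailSummable fun n => -(2 * b n) := fun n => by
    refine Summable.of_norm_bounded (h.tailSummable_perturbation n) fun i => ?_
    rw [norm_neg, norm_mul, Real.norm_eq_abs, Real.norm_eq_abs, abs_of_pos two_pos]
    unfold perturbation
    linarith [abs_nonneg (1 - 4 * a (n + i) ^ 2)]
  have := tailSum_eq_add hs n
  simp only [jostCoeff, sub_add_cancel]
  simp only [tailSum] at this
  linarith

/-- The recursion as a difference equation in `n`, without sums. -/
theorem HasDecay.jostCoeff_add_two_sub (h : HasDecay a b) (j : ℕ) (n : ℤ) :
    jostCoeff a b (j + 2) (n - 1) = jostCoeff a b (j + 2) n + jostCoeff a b j n -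
      4 * a n ^ 2 * jostCoeff a b j (n + 1) - 2 * b n * jostCoeff a b (j + 1) n := by
  have := tailSum_eq_add (f := fun n => (1 - 4 * a n ^ 2) * jostCoeff a b j (n + 1) -
        2 * b n * jostCoeff a b (j + 1) n) (h.summable_source j) n
  simp only [tailSum] at this
  simp only [jostCoeff, sub_add_cancel]
  rw [this]
  split_ifs with hj
  · subst hj; simp only [jostCoeff]; ring
  · ring

end coeff

/-! ### The right Jost solution on the closed unit disc -/

/-- A power series whose coefficients have a finite first moment is complex differentiable on the
closed unit disc, boundary points included. -/
theorem differentiableOn_tsum_pow {c : ℕ → ℂ} (hc : Summable fun j : ℕ => ((j : ℝ) + 1) * ‖c j‖) :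
    DifferentiableOn ℂ (fun z => ∑' j, c j * z ^ j) (Metric.closedBall 0 1) := by
  have hc0 : Summable fun j => ‖c j‖ := Summable.of_nonneg_of_le (fun _ => norm_nonneg _)
    (fun j => le_mul_of_one_le_left (norm_nonneg _) (by simp)) hc
  have hs : ∀ z : ℂ, ‖z‖ ≤ 1 → Summable fun j => c j * z ^ j := fun z hz =>
    Summable.of_norm_bounded hc0 fun j => by
      rw [norm_mul, norm_pow]
      exact mul_le_of_le_one_right (norm_nonneg _) (pow_le_one₀ (norm_nonneg _) hz)
  intro z₀ hz₀
  rw [mem_closedBall_zero_iff] at hz₀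
  -- the difference quotient is again an absolutely convergent series on the closed disc
  set g : ℂ → ℂ := fun z => ∑' j, c j * ∑ i ∈ Finset.range j, z ^ i * z₀ ^ (j - 1 - i)
  have hterm : ∀ (j : ℕ) (z : ℂ), ‖z‖ ≤ 1 →
      ‖c j * ∑ i ∈ Finset.range j, z ^ i * z₀ ^ (j - 1 - i)‖ ≤ ((j : ℝ) + 1) * ‖c j‖ := by
    intro j z hz
    rw [norm_mul, mul_comm]
    gcongr
    refine (norm_sum_le_of_le _ (f := fun i => z ^ i * z₀ ^ (j - 1 - i)) (n := fun _ => 1)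
      fun i _ => ?_).trans (by simp)
    rw [norm_mul, norm_pow, norm_pow]
    exact mul_le_one₀ (pow_le_one₀ (norm_nonneg _) hz) (by positivity)
      (pow_le_one₀ (norm_nonneg _) hz₀)
  have hg : ContinuousOn g (Metric.closedBall 0 1) :=
    continuousOn_tsum (fun j => by fun_prop) hc fun j z hz =>
      hterm j z (mem_closedBall_zero_iff.1 hz)
  have hfg : ∀ z : ℂ, ‖z‖ ≤ 1 →
      (∑' j, c j * z ^ j) - ∑' j, c j * z₀ ^ j = (z - z₀) * g z := by
    intro z hz
    rw [← (hs z hz).tsum_sub (hs z₀ hz₀), ← tsum_mul_left]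
    refine tsum_congr fun j => ?_
    rw [← mul_sub, ← (Commute.all z z₀).geom_sum₂_mul]
    ring
  have : HasDerivWithinAt (fun z => ∑' j, c j * z ^ j) (g z₀) (Metric.closedBall 0 1) z₀ := by
    rw [hasDerivWithinAt_iff_tendsto_slope]
    have h1 := (hg z₀ (mem_closedBall_zero_iff.2 hz₀)).mono_left
      (nhdsWithin_mono z₀ (Set.sdiff_subset : Metric.closedBall (0 : ℂ) 1 \ {z₀} ⊆ _))
    refine h1.congr' ?_
    filter_upwards [self_mem_nhdsWithin] with z hz
    have hne : z - z₀ ≠ 0 := sub_ne_zero.2 hz.2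
    rw [slope_def_field, hfg z (mem_closedBall_zero_iff.1 hz.1)]
    field_simp
  exact this.differentiableWithinAt

theorem tendsto_tailSum (f : ℤ → ℝ) : Tendsto (tailSum f) atTop (𝓝 0) := by
  have h1 := tendsto_sum_nat_add fun i : ℕ => f (0 + i)
  have h2 : Tendsto (fun p : ℕ => tailSum f p) atTop (𝓝 0) := by
    refine h1.congr fun p => tsum_congr fun i => ?_
    congr 1; push_cast; ring
  have h3 : Tendsto (fun n : ℤ => tailSum f n.toNat) atTop (𝓝 0) :=
    h2.comp (tendsto_atTop_atTop.2 fun p => ⟨p, fun m hm => by omega⟩)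
  refine h3.congr' ?_
  filter_upwards [eventually_ge_atTop 0] with n hn
  rw [Int.toNat_of_nonneg hn]

/-- The normalisation `A(n) = ∏_{m ≥ n} (2 a(m))⁻¹` of the right Jost solution. -/
noncomputable def jostNorm (a : ℤ → ℝ) (n : ℤ) : ℝ :=
  Real.exp (-tailSum (fun m => Real.log (2 * a m)) n)

/-- The right Jost solution divided by `zⁿ`, as a function of `z` in the closed unit disc. -/
noncomputable def jostFun (a b : ℤ → ℝ) (n : ℤ) (z : ℂ) : ℂ :=
  jostNorm a n * ∑' j : ℕ, (jostCoeff a b j n : ℂ) * z ^ j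

theorem jostNorm_pos (a : ℤ → ℝ) (n : ℤ) : 0 < jostNorm a n := Real.exp_pos _

section jostFun

variable {a b : ℤ → ℝ}

theorem HasDecay.tailSummable_log (h : HasDecay a b) :
    TailSummable fun m => Real.log (2 * a m) := by
  intro N
  obtain ⟨K, hK⟩ := h.exists_le N
  have hs : Summable fun p : ℕ => 2 * K * (1 / ((p : ℝ) + 1) ^ 6) := by
    have := (summable_nat_add_iff 1).2 (Real.summable_one_div_nat_pow.2 (by norm_num : 1 < 6))
    exact Summable.mul_left _ (by simpa using this)
  have h1 : Summable fun p : ℕ => 2 * a (N + p) - 1 := by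
    refine Summable.of_norm_bounded hs fun p => ?_
    rw [mul_one_div, mul_div_assoc]
    have : 2 * a (N + p) - 1 = 2 * (a (N + p) - 1 / 2) := by ring
    rw [this, norm_mul, Real.norm_eq_abs, Real.norm_eq_abs, abs_of_pos two_pos]
    have := hK p
    have := abs_nonneg (b (N + p))
    linarith
  simpa using Real.summable_log_one_add_of_summable h1

theorem HasDecay.jostNorm_add_one (h : HasDecay a b) (ha : ∀ n, 0 < a n) (n : ℤ) :
    jostNorm a (n + 1) = 2 * a n * jostNorm a n := by
  have h1 := tailSum_eq_add h.tailSummable_log n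
  have h2 : Real.exp (Real.log (2 * a n)) = 2 * a n := Real.exp_log (by linarith [ha n])
  rw [jostNorm, jostNorm, h1, ← h2, ← Real.exp_add]
  simp

theorem tendsto_jostNorm (a : ℤ → ℝ) : Tendsto (jostNorm a) atTop (𝓝 1) := by
  have := (tendsto_tailSum fun m => Real.log (2 * a m)).neg.rexp
  rw [neg_zero, Real.exp_zero] at this
  exact this

/-- The coefficient bound split in two ways between decay in the index `j`, for a finite first
moment, and decay in the site `p`, for the limit at `+∞`. -/
theorem HasDecay.exists_jostCoeff_le' (h : HasDecay a b) (N : ℤ) :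
    ∃ K : ℝ, 0 ≤ K ∧ ∀ (p j : ℕ),
      ((j : ℝ) + 1) * |jostCoeff a b (j + 1) (N + p)| ≤ K * (1 / ((j : ℝ) + 1) ^ 2) ∧
      |jostCoeff a b (j + 1) (N + p)| ≤ K / ((p : ℝ) + 1) * (1 / ((j : ℝ) + 1) ^ 2) := by
  obtain ⟨K, hK0, hK⟩ := h.exists_jostCoeff_le N
  refine ⟨8 * K, by positivity, fun p j => ?_⟩
  have h1 := hK p j
  push_cast at h1
  set q : ℝ := (((j + 1) / 2 : ℕ) : ℝ) with hq
  have hq2 : (j : ℝ) + 1 ≤ 2 * (q + 1) := by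
    have : j + 1 ≤ 2 * ((j + 1) / 2 + 1) := by omega
    rw [hq]; exact_mod_cast this
  have hq0 : 0 ≤ q := Nat.cast_nonneg _
  have hp0 : (0 : ℝ) ≤ p := Nat.cast_nonneg _
  have hj0 : (0 : ℝ) ≤ j := Nat.cast_nonneg _
  have h3 : ((j : ℝ) + 1) ^ 3 ≤ 8 * (p + q + 1) ^ 3 := by
    have : ((j : ℝ) + 1) ^ 3 ≤ (2 * (p + q + 1)) ^ 3 := by gcongr; linarith
    linarith [this, mul_pow 2 (p + q + 1) 3]
  have h4 : ((p : ℝ) + 1) * ((j : ℝ) + 1) ^ 2 ≤ 8 * (p + q + 1) ^ 3 := by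
    have h5 : ((j : ℝ) + 1) ^ 2 ≤ (2 * (p + q + 1)) ^ 2 := by gcongr; linarith
    calc ((p : ℝ) + 1) * ((j : ℝ) + 1) ^ 2 ≤ (p + q + 1) * (2 * (p + q + 1)) ^ 2 := by
          gcongr; linarith
      _ ≤ 8 * (p + q + 1) ^ 3 := by
          have : 0 ≤ (p + q + 1) ^ 3 := by positivity
          nlinarith
  have hP : 0 < (p + q + 1) ^ 3 := by positivity
  constructor
  · rw [mul_comm]
    calc _ ≤ K / (p + q + 1) ^ 3 * ((j : ℝ) + 1) := by gcongr
      _ ≤ _ := by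
        rw [mul_one_div, div_mul_eq_mul_div, div_le_div_iff₀ hP (by positivity)]
        nlinarith
  · refine h1.trans ?_
    rw [div_mul_div_comm, mul_one, div_le_div_iff₀ hP (by positivity)]
    nlinarith

theorem summable_one_div_add_one_sq : Summable fun j : ℕ => 1 / ((j : ℝ) + 1) ^ 2 := by
  have := (summable_nat_add_iff 1).2 (Real.summable_one_div_nat_pow.2 (by norm_num : 1 < 2))
  simpa using this

theorem HasDecay.summable_jostCoeff (h : HasDecay a b) (n : ℤ) :
    Summable fun j : ℕ => ((j : ℝ) + 1) * ‖(jostCoeff a b j n : ℂ)‖ := by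
  obtain ⟨K, -, hK⟩ := h.exists_jostCoeff_le' n
  rw [← summable_nat_add_iff 1]
  refine Summable.of_nonneg_of_le (fun _ => by positivity) (fun j => ?_)
    (summable_one_div_add_one_sq.mul_left (2 * K))
  have h1 := (hK 0 j).1
  rw [Nat.cast_zero, add_zero] at h1
  rw [Complex.norm_real, Real.norm_eq_abs]
  push_cast
  have : 0 ≤ |jostCoeff a b (j + 1) n| := abs_nonneg _
  have : (0 : ℝ) ≤ j := Nat.cast_nonneg _
  nlinarith

theorem HasDecay.summable_jostCoeff_mul_pow (h : HasDecay a b) (n : ℤ) {z : ℂ} (hz : ‖z‖ ≤ 1) :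
    Summable fun j : ℕ => (jostCoeff a b j n : ℂ) * z ^ j := by
  refine Summable.of_norm_bounded (h.summable_jostCoeff n) fun j => ?_
  rw [norm_mul, norm_pow, mul_comm]
  gcongr
  exact (pow_le_one₀ (norm_nonneg _) hz).trans (by simp)

/-- The right Jost function is complex differentiable up to the unit circle. -/
theorem HasDecay.differentiableOn_jostFun (h : HasDecay a b) (n : ℤ) :
    DifferentiableOn ℂ (jostFun a b n) (Metric.closedBall 0 1) :=
  (differentiableOn_tsum_pow (h.summable_jostCoeff n)).const_mul _

theorem jostFun_conj (n : ℤ) (z : ℂ) :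
    jostFun a b n ((starRingEnd ℂ) z) = (starRingEnd ℂ) (jostFun a b n z) := by
  simp [jostFun, Complex.conj_tsum]

theorem jostFun_zero (n : ℤ) : jostFun a b n 0 = jostNorm a n := by
  rw [jostFun, tsum_eq_single 0 fun j hj => by simp [hj]]
  simp [jostCoeff]

/-- The difference equation, divided by `z^(n-1)`. -/
theorem HasDecay.jostFun_rec (h : HasDecay a b) (ha : ∀ n, 0 < a n) (n : ℤ) {z : ℂ}
    (hz : ‖z‖ ≤ 1) :
    (a (n - 1) : ℂ) * jostFun a b (n - 1) z + a n * z ^ 2 * jostFun a b (n + 1) z +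
      b n * z * jostFun a b n z = (1 + z ^ 2) / 2 * jostFun a b n z := by
  set F : ℤ → ℂ := fun n => ∑' j : ℕ, (jostCoeff a b j n : ℂ) * z ^ j with hF
  have hs := fun n => h.summable_jostCoeff_mul_pow n hz
  have hs1 := fun n => (summable_nat_add_iff 1).2 (hs n)
  have hs2 := fun n => (summable_nat_add_iff 2).2 (hs n)
  have e1 : ∀ n, F n = 1 + ∑' j : ℕ, (jostCoeff a b (j + 1) n : ℂ) * z ^ (j + 1) := by
    intro n
    simp only [hF]
    rw [(hs n).tsum_eq_zero_add]
    simp [jostCoeff]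
  have e2 : ∀ n, F n = 1 + jostCoeff a b 1 n * z +
      ∑' j : ℕ, (jostCoeff a b (j + 2) n : ℂ) * z ^ (j + 2) := by
    intro n
    rw [e1, (hs1 n).tsum_eq_zero_add]
    simp only [zero_add, pow_one, add_assoc, Nat.reduceAdd]
  have key : F (n - 1) = F n + z ^ 2 * F n - 4 * a n ^ 2 * z ^ 2 * F (n + 1) -
      2 * b n * z * F n := by
    have h1 : 2 * b n * z * F n = 2 * b n * z +
        ∑' j : ℕ, 2 * b n * z * ((jostCoeff a b (j + 1) n : ℂ) * z ^ (j + 1)) := by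
      rw [tsum_mul_left, e1 n]; ring
    have h2 : z ^ 2 * F n = ∑' j : ℕ, z ^ 2 * ((jostCoeff a b j n : ℂ) * z ^ j) := by
      rw [tsum_mul_left]
    have h3 : 4 * a n ^ 2 * z ^ 2 * F (n + 1) =
        ∑' j : ℕ, 4 * a n ^ 2 * z ^ 2 * ((jostCoeff a b j (n + 1) : ℂ) * z ^ j) := by
      rw [tsum_mul_left]
    have h4 : ∑' j : ℕ, (jostCoeff a b (j + 2) (n - 1) : ℂ) * z ^ (j + 2) =
        (∑' j : ℕ, (jostCoeff a b (j + 2) n : ℂ) * z ^ (j + 2)) +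
        (∑' j : ℕ, z ^ 2 * ((jostCoeff a b j n : ℂ) * z ^ j)) -
        (∑' j : ℕ, 4 * a n ^ 2 * z ^ 2 * ((jostCoeff a b j (n + 1) : ℂ) * z ^ j)) -
        ∑' j : ℕ, 2 * b n * z * ((jostCoeff a b (j + 1) n : ℂ) * z ^ (j + 1)) := by
      rw [← (hs2 n).tsum_add ((hs n).mul_left _), ← Summable.tsum_sub
        ((hs2 n).add ((hs n).mul_left _)) ((hs (n + 1)).mul_left _), ← Summable.tsum_sub
        (((hs2 n).add ((hs n).mul_left _)).sub ((hs (n + 1)).mul_left _)) ((hs1 n).mul_left _)]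
      refine tsum_congr fun j => ?_
      rw [h.jostCoeff_add_two_sub]
      push_cast
      ring
    rw [h1, h2, h3, e2 (n - 1), h4, h.jostCoeff_one_sub, e2 n]
    push_cast
    ring
  have hA : (jostNorm a n : ℂ) = 2 * a (n - 1) * jostNorm a (n - 1) := by
    have := h.jostNorm_add_one ha (n - 1)
    rw [sub_add_cancel] at this
    rw [this]; push_cast; ring
  have hA' : (jostNorm a (n + 1) : ℂ) = 2 * a n * jostNorm a n := by
    rw [h.jostNorm_add_one ha]; push_cast; ring
  change (a (n - 1) : ℂ) * (jostNorm a (n - 1) * F (n - 1)) +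
    a n * z ^ 2 * (jostNorm a (n + 1) * F (n + 1)) + b n * z * (jostNorm a n * F n) =
    (1 + z ^ 2) / 2 * (jostNorm a n * F n)
  rw [key, hA', hA]
  ring

/-- The right Jost function tends to `1` at `+∞`, uniformly on the closed unit disc. -/
theorem HasDecay.exists_jostFun_bound (h : HasDecay a b) :
    ∃ ε : ℤ → ℝ, Tendsto ε atTop (𝓝 0) ∧
      ∀ n : ℤ, 0 ≤ n → ∀ z : ℂ, ‖z‖ ≤ 1 → ‖jostFun a b n z - 1‖ ≤ ε n := by
  obtain ⟨K, hK0, hK⟩ := h.exists_jostCoeff_le' 0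
  set S := ∑' j : ℕ, 1 / ((j : ℝ) + 1) ^ 2
  refine ⟨fun n => jostNorm a n * (K / ((n : ℝ) + 1) * S) + |jostNorm a n - 1|, ?_, ?_⟩
  · have h1 : Tendsto (fun n : ℤ => K / ((n : ℝ) + 1)) atTop (𝓝 0) :=
      Tendsto.const_div_atTop (tendsto_atTop_add_const_right _ _ tendsto_intCast_atTop_atTop) _
    have h2 := ((tendsto_jostNorm a).mul (h1.mul_const S)).add
      (((tendsto_jostNorm a).sub_const 1).abs)
    simpa using h2
  · intro n hn z hz
    obtain ⟨p, rfl⟩ := Int.eq_ofNat_of_zero_le hn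
    have h1 : ‖∑' j : ℕ, (jostCoeff a b (j + 1) p : ℂ) * z ^ (j + 1)‖ ≤ K / ((p : ℝ) + 1) * S := by
      refine tsum_of_norm_bounded (summable_one_div_add_one_sq.hasSum.mul_left _) fun j => ?_
      rw [norm_mul, norm_pow, Complex.norm_real, Real.norm_eq_abs]
      have := (hK p j).2
      rw [zero_add] at this
      exact (mul_le_of_le_one_right (abs_nonneg _) (pow_le_one₀ (norm_nonneg _) hz)).trans this
    have h2 : jostFun a b p z - 1 = jostNorm a p *
        (∑' j : ℕ, (jostCoeff a b (j + 1) p : ℂ) * z ^ (j + 1)) + (jostNorm a p - 1 : ℝ) := by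
      rw [jostFun, (h.summable_jostCoeff_mul_pow p hz).tsum_eq_zero_add]
      simp [jostCoeff]
      ring
    rw [h2]
    refine (norm_add_le _ _).trans (add_le_add ?_ ?_)
    · rw [norm_mul, Complex.norm_real, Real.norm_eq_abs, abs_of_pos (jostNorm_pos a p)]
      have := (jostNorm_pos a p).le
      gcongr
      exact_mod_cast h1
    · rw [Complex.norm_real, Real.norm_eq_abs]

end jostFun

/-! ### Solutions of the difference equation -/

/-- The Wronskian of two sequences with respect to the Jacobi expression. -/
noncomputable def wronskian (a : ℤ → ℝ) (f g : ℤ → ℂ) (n : ℤ) : ℂ :=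
  a n * (f n * g (n + 1) - f (n + 1) * g n)

section solutions

variable {a b : ℤ → ℝ} {l l' : ℂ} {f g : ℤ → ℂ}

/-- Green's formula in differential form. -/
theorem wronskian_sub (hf : ∀ n, jacobi a b f n = l * f n) (hg : ∀ n, jacobi a b g n = l' * g n)
    (n : ℤ) : wronskian a f g n - wronskian a f g (n - 1) = (l' - l) * (f n * g n) := by
  have h1 := hf n
  have h2 := hg n
  simp only [jacobi] at h1 h2
  simp only [wronskian, sub_add_cancel]
  linear_combination f n * h2 - g n * h1

theorem wronskian_eq (hf : ∀ n, jacobi a b f n = l * f n) (hg : ∀ n, jacobi a b g n = l * g n)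
    (n m : ℤ) : wronskian a f g n = wronskian a f g m := by
  have key : ∀ n, wronskian a f g n = wronskian a f g 0 := by
    intro n
    induction n with
    | zero => rfl
    | succ k ih =>
      have := wronskian_sub hf hg (k + 1)
      rw [sub_self, zero_mul, add_sub_cancel_right, sub_eq_zero] at this
      rw [this, ih]
    | pred k ih =>
      have := wronskian_sub hf hg (-k)
      rw [sub_self, zero_mul, sub_eq_zero] at this
      rw [← this, ih]
  rw [key n, key m]

/-- A solution that vanishes at two neighbouring sites vanishes. -/
theorem eq_zero_of_eq_zero (ha : ∀ n, 0 < a n) (hf : ∀ n, jacobi a b f n = l * f n) {n : ℤ}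
    (h0 : f n = 0) (h1 : f (n + 1) = 0) : f = 0 := by
  have key : ∀ m : ℤ, f (n + m) = 0 ∧ f (n + m + 1) = 0 := by
    intro m
    induction m with
    | zero => simpa using ⟨h0, h1⟩
    | succ k ih =>
      refine ⟨by rw [← add_assoc]; exact ih.2, ?_⟩
      have := hf (n + k + 1)
      simp only [jacobi, add_sub_cancel_right, ih.1, ih.2, mul_zero, add_zero] at this
      rw [← add_assoc]
      exact (mul_eq_zero.1 this).resolve_left (by exact_mod_cast (ha _).ne')
    | pred k ih =>
      have h2 : n + (-(k : ℤ) - 1) + 1 = n + -k := by ring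
      refine ⟨?_, by rw [h2]; exact ih.1⟩
      have := hf (n + -k)
      simp only [jacobi, ih.1, ih.2, mul_zero, add_zero, zero_add] at this
      rw [show n + (-(k : ℤ) - 1) = n + -k - 1 by ring]
      exact (mul_eq_zero.1 this).resolve_left (by exact_mod_cast (ha _).ne')
  funext m
  have := (key (m - n)).1
  rwa [add_sub_cancel] at this

theorem exists_eq_mul_of_wronskian_eq_zero (ha : ∀ n, 0 < a n)
    (hf : ∀ n, jacobi a b f n = l * f n) (hg : ∀ n, jacobi a b g n = l * g n) (hf0 : f ≠ 0)
    {n : ℤ} (hW : wronskian a f g n = 0) : ∃ c : ℂ, ∀ m, g m = c * f m := by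
  have hW' : f n * g (n + 1) - f (n + 1) * g n = 0 :=
    (mul_eq_zero.1 hW).resolve_left (by exact_mod_cast (ha _).ne')
  have hc : ∃ c : ℂ, g n = c * f n ∧ g (n + 1) = c * f (n + 1) := by
    by_cases h0 : f n = 0
    · have h1 : f (n + 1) ≠ 0 := fun h1 => hf0 (eq_zero_of_eq_zero ha hf h0 h1)
      refine ⟨g (n + 1) / f (n + 1), ?_, by field_simp⟩
      rw [h0, zero_mul, zero_sub, neg_eq_zero] at hW'
      rw [h0, mul_zero]
      exact (mul_eq_zero.1 hW').resolve_left h1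
    · refine ⟨g n / f n, by field_simp, ?_⟩
      field_simp
      linear_combination hW'
  obtain ⟨c, hc0, hc1⟩ := hc
  refine ⟨c, fun m => ?_⟩
  have hd : ∀ n, jacobi a b (fun n => g n - c * f n) n = l * (g n - c * f n) := by
    intro n
    have h1 := hf n
    have h2 := hg n
    simp only [jacobi] at h1 h2 ⊢
    linear_combination h2 - c * h1
  have := congrFun (eq_zero_of_eq_zero ha hd (n := n) (by simp [hc0]) (by simp [hc1])) m
  simpa [sub_eq_zero] using this

theorem jacobi_conj (hf : ∀ n, jacobi a b f n = l * f n) (n : ℤ) :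
    jacobi a b (fun n => (starRingEnd ℂ) (f n)) n = (starRingEnd ℂ) l * (starRingEnd ℂ) (f n) := by
  have := congrArg (starRingEnd ℂ) (hf n)
  simpa [jacobi] using this

end solutions

/-! ### Existence and uniqueness of the Jost solutions -/

section jost

variable {a b : ℤ → ℝ} {z : ℂ}

theorem HasDecay.tendsto_coeff (h : HasDecay a b) : Tendsto a atTop (𝓝 (1 / 2)) := by
  obtain ⟨K, hK⟩ := h.exists_le 0
  have h1 : Tendsto (fun n : ℤ => K / ((n : ℝ) + 1)) atTop (𝓝 0) :=
    Tendsto.const_div_atTop (tendsto_atTop_add_const_right _ _ tendsto_intCast_atTop_atTop) _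
  rw [tendsto_iff_norm_sub_tendsto_zero]
  refine squeeze_zero' (Eventually.of_forall fun _ => norm_nonneg _) ?_ h1
  filter_upwards [eventually_ge_atTop 0] with n hn
  obtain ⟨p, rfl⟩ := Int.eq_ofNat_of_zero_le hn
  have h2 := hK p
  have hK0 : 0 ≤ K := by
    have := hK 0
    simp only [Nat.cast_zero, add_zero, zero_add, one_pow, div_one] at this
    exact le_trans (by positivity) this
  rw [zero_add] at h2
  have h3 : K / ((p : ℝ) + 1) ^ 6 ≤ K / ((p : ℝ) + 1) := by
    gcongr
    exact le_self_pow₀ (by linarith [(Nat.cast_nonneg p : (0 : ℝ) ≤ p)]) (by norm_num)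
  rw [Real.norm_eq_abs]
  have := abs_nonneg (b p)
  simp only [Int.cast_natCast]
  linarith

theorem HasDecay.tendsto_jostFun (h : HasDecay a b) (hz : ‖z‖ ≤ 1) :
    Tendsto (fun n => jostFun a b n z) atTop (𝓝 1) := by
  obtain ⟨ε, hε, hb⟩ := h.exists_jostFun_bound
  rw [tendsto_iff_norm_sub_tendsto_zero]
  refine squeeze_zero' (Eventually.of_forall fun _ => norm_nonneg _) ?_ hε
  filter_upwards [eventually_ge_atTop 0] with n hn using hb n hn z hz

theorem HasDecay.isJostPlus (h : HasDecay a b) (ha : ∀ n, 0 < a n) (hz0 : z ≠ 0) (hz : ‖z‖ ≤ 1) :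
    IsJostPlus a b z fun n => z ^ n * jostFun a b n z := by
  constructor
  · intro n
    have h1 := h.jostFun_rec ha n hz
    simp only [jacobi]
    rw [zpow_add_one₀ hz0, zpow_sub_one₀ hz0]
    field_simp
    linear_combination (2 : ℂ) * h1
  · refine (h.tendsto_jostFun hz).congr fun n => ?_
    rw [← mul_assoc, ← zpow_add₀ hz0]
    simp

/-- The behaviour of a Wronskian at `+∞` for sequences `f ∼ x zⁿ`, `g ∼ y wⁿ`. -/
theorem wronskian_tendsto_of_tendsto {f g : ℤ → ℂ} {x y : ℂ} (h : HasDecay a b) (hz0 : z ≠ 0)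
    {w : ℂ} (hw0 : w ≠ 0) (hzw : ‖z * w‖ ≤ 1)
    (hf : Tendsto (fun n : ℤ => z ^ (-n) * f n) atTop (𝓝 x))
    (hg : Tendsto (fun n : ℤ => w ^ (-n) * g n) atTop (𝓝 y)) :
    Tendsto (fun n : ℤ => wronskian a f g n - (z * w) ^ n * ((w - z) / 2 * (x * y))) atTop
      (𝓝 0) := by
  have hs : Tendsto (fun n : ℤ => n + 1) atTop atTop := tendsto_atTop_add_const_right _ _ tendsto_id
  have hf' := hf.comp hs
  have hg' := hg.comp hs
  have ha : Tendsto (fun n => (a n : ℂ)) atTop (𝓝 (1 / 2)) := by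
    have := (Complex.continuous_ofReal.tendsto _).comp h.tendsto_coeff
    rwa [show ((1 / 2 : ℝ) : ℂ) = 1 / 2 by norm_num] at this
  have h1 := (ha.mul (((hf.mul hg').mul_const w).sub ((hf'.mul hg).mul_const z))).sub_const
    ((w - z) / 2 * (x * y))
  have h2 : (1 / 2 * (x * y * w - x * y * z) - (w - z) / 2 * (x * y) : ℂ) = 0 := by ring
  rw [h2] at h1
  have h3 : ∀ᶠ n : ℤ in atTop, ‖(z * w) ^ n‖ ≤ 1 := by
    filter_upwards [eventually_ge_atTop 0] with n hn
    rw [norm_zpow]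
    exact zpow_le_one₀ (norm_pos_iff.2 (mul_ne_zero hz0 hw0)) hzw hn
  have h4 := h1.zero_mul_isBoundedUnder_le (g := fun n : ℤ => (z * w) ^ n)
    ⟨1, eventually_map.2 h3⟩
  refine h4.congr fun n => ?_
  simp only [Function.comp_apply, wronskian]
  rw [neg_add, zpow_add₀ hz0, zpow_add₀ hw0, mul_zpow, zpow_neg, zpow_neg, zpow_neg_one,
    zpow_neg_one]
  have := zpow_ne_zero n hz0
  have := zpow_ne_zero n hw0
  field_simp

theorem wronskian_eq_zero_of_tendsto {f g : ℤ → ℂ} {l x w : ℂ} (h : HasDecay a b)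
    (hz0 : z ≠ 0) (hw0 : w ≠ 0) (hzw : ‖z * w‖ ≤ 1)
    (hfs : ∀ n, jacobi a b f n = l * f n) (hgs : ∀ n, jacobi a b g n = l * g n)
    (hf : Tendsto (fun n : ℤ => z ^ (-n) * f n) atTop (𝓝 x))
    (hg : Tendsto (fun n : ℤ => w ^ (-n) * g n) atTop (𝓝 0)) (n : ℤ) :
    wronskian a f g n = 0 := by
  have h1 := wronskian_tendsto_of_tendsto h hz0 hw0 hzw hf hg
  simp only [mul_zero, sub_zero] at h1
  have h2 : Tendsto (fun _ : ℤ => wronskian a f g n) atTop (𝓝 0) :=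
    h1.congr fun m => wronskian_eq hfs hgs m n
  exact tendsto_nhds_unique tendsto_const_nhds h2

theorem wronskian_eq_of_tendsto {f g : ℤ → ℂ} {l x y : ℂ} (h : HasDecay a b) (hz0 : z ≠ 0)
    (hfs : ∀ n, jacobi a b f n = l * f n) (hgs : ∀ n, jacobi a b g n = l * g n)
    (hf : Tendsto (fun n : ℤ => z⁻¹ ^ (-n) * f n) atTop (𝓝 x))
    (hg : Tendsto (fun n : ℤ => z ^ (-n) * g n) atTop (𝓝 y)) (n : ℤ) :
    wronskian a f g n = (z - z⁻¹) / 2 * (x * y) := by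
  have h1 := wronskian_tendsto_of_tendsto h (inv_ne_zero hz0) hz0 (by simp [hz0]) hf hg
  simp only [inv_mul_cancel₀ hz0, one_zpow, one_mul] at h1
  have h2 : Tendsto (fun _ : ℤ => wronskian a f g n - (z - z⁻¹) / 2 * (x * y)) atTop (𝓝 0) :=
    h1.congr fun m => by rw [wronskian_eq hfs hgs m n]
  exact sub_eq_zero.1 (tendsto_nhds_unique tendsto_const_nhds h2)

/-- A solution that is `o(zⁿ)` at `+∞` vanishes: its Wronskian with the Jost solution is zero, so
it is a multiple of it. -/
theorem eq_zero_of_tendsto {f : ℤ → ℂ} (h : HasDecay a b) (ha : ∀ n, 0 < a n) (hz0 : z ≠ 0)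
    (hz : ‖z‖ ≤ 1) (hfs : ∀ n, jacobi a b f n = (z + z⁻¹) / 2 * f n)
    (hf : Tendsto (fun n : ℤ => z ^ (-n) * f n) atTop (𝓝 0)) : f = 0 := by
  obtain ⟨hψ, hψ1⟩ := h.isJostPlus ha hz0 hz
  have hzz : ‖z * z‖ ≤ 1 := by
    rw [norm_mul]; exact mul_le_one₀ hz (norm_nonneg _) hz
  have hW := wronskian_eq_zero_of_tendsto h hz0 hz0 hzz hψ hfs hψ1 hf 0
  have hψ0 : (fun n : ℤ => z ^ n * jostFun a b n z) ≠ 0 := by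
    intro h0
    simp only [fun n => congrFun h0 n, Pi.zero_apply, mul_zero] at hψ1
    exact zero_ne_one (tendsto_nhds_unique tendsto_const_nhds hψ1)
  obtain ⟨c, hc⟩ := exists_eq_mul_of_wronskian_eq_zero ha hψ hfs hψ0 hW
  have h1 := hψ1.const_mul c
  have h2 : Tendsto (fun n : ℤ => z ^ (-n) * f n) atTop (𝓝 (c * 1)) :=
    h1.congr fun n => by rw [hc n]; ring
  have hc0 : c = 0 := by simpa using tendsto_nhds_unique h2 hf
  funext n
  rw [hc n, hc0, zero_mul, Pi.zero_apply]

theorem HasDecay.isJostPlus_unique {f g : ℤ → ℂ} (h : HasDecay a b) (ha : ∀ n, 0 < a n)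
    (hz0 : z ≠ 0) (hz : ‖z‖ ≤ 1) (hf : IsJostPlus a b z f) (hg : IsJostPlus a b z g) : f = g := by
  have h1 : (fun n => f n - g n) = 0 := by
    refine eq_zero_of_tendsto h ha hz0 hz (fun n => ?_) ?_
    · have e1 := hf.1 n
      have e2 := hg.1 n
      simp only [jacobi] at e1 e2 ⊢
      linear_combination e1 - e2
    · have := hf.2.sub hg.2
      rw [sub_self] at this
      exact this.congr fun n => by ring
  funext n
  exact sub_eq_zero.1 (congrFun h1 n)

theorem HasDecay.jostPlus_spec (h : HasDecay a b) (ha : ∀ n, 0 < a n) (hz0 : z ≠ 0)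
    (hz : ‖z‖ ≤ 1) : IsJostPlus a b z (jostPlus a b z) :=
  Classical.epsilon_spec ⟨_, h.isJostPlus ha hz0 hz⟩

theorem HasDecay.jostPlus_apply (h : HasDecay a b) (ha : ∀ n, 0 < a n) (hz0 : z ≠ 0)
    (hz : ‖z‖ ≤ 1) (n : ℤ) : jostPlus a b z n = z ^ n * jostFun a b n z :=
  congrFun (h.isJostPlus_unique ha hz0 hz (h.jostPlus_spec ha hz0 hz) (h.isJostPlus ha hz0 hz)) n

/-! ### Reflection of the lattice -/

/-- The off-diagonal coefficients of the reflected operator. -/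
def reflectA (a : ℤ → ℝ) (n : ℤ) : ℝ := a (-n - 1)

/-- The diagonal coefficients of the reflected operator. -/
def reflectB (b : ℤ → ℝ) (n : ℤ) : ℝ := b (-n)

theorem jacobi_reflect (f : ℤ → ℂ) (n : ℤ) :
    jacobi (reflectA a) (reflectB b) (fun m => f (-m)) n = jacobi a b f (-n) := by
  simp only [jacobi, reflectA, reflectB]
  rw [show -(n - 1) - 1 = -n by ring, show -(n + 1) = -n - 1 by ring,
    show -(n - 1) = -n + 1 by ring]
  ring

theorem wronskian_reflect (f g : ℤ → ℂ) (n : ℤ) :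
    wronskian (reflectA a) (fun m => f (-m)) (fun m => g (-m)) n = -wronskian a f g (-n - 1) := by
  simp only [wronskian, reflectA]
  rw [show -(n + 1) = -n - 1 by ring, show -n - 1 + 1 = -n by ring]
  ring

theorem HasDecay.reflect (h : HasDecay a b) : HasDecay (reflectA a) (reflectB b) := by
  intro l
  have hb : Summable fun n : ℤ => |(n : ℝ)| ^ l * |b n| :=
    Summable.of_nonneg_of_le (fun _ => by positivity)
      (fun n => by gcongr; linarith [abs_nonneg (a n - 1 / 2)]) (h l)
  have ha : ∀ l : ℕ, Summable fun n : ℤ => |(n : ℝ)| ^ l * |a n - 1 / 2| := fun l =>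
    Summable.of_nonneg_of_le (fun _ => by positivity)
      (fun n => by gcongr; linarith [abs_nonneg (b n)]) (h l)
  have ha' : Summable fun n : ℤ => |((-n - 1 : ℤ) : ℝ)| ^ l * |a n - 1 / 2| := by
    refine Summable.of_nonneg_of_le (fun _ => by positivity) (fun n => ?_)
      (((ha l).add (ha 0)).mul_left (2 ^ (l - 1) : ℝ))
    have h1 : |((-n - 1 : ℤ) : ℝ)| ≤ |(n : ℝ)| + 1 := by
      push_cast
      rw [← abs_neg, neg_sub, sub_neg_eq_add, add_comm]
      simpa using abs_add_le (n : ℝ) 1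
    have h2 := add_pow_le (abs_nonneg (n : ℝ)) zero_le_one l
    rw [one_pow] at h2
    calc _ ≤ (|(n : ℝ)| + 1) ^ l * |a n - 1 / 2| := by gcongr
      _ ≤ (2 ^ (l - 1) * (|(n : ℝ)| ^ l + 1)) * |a n - 1 / 2| := by gcongr
      _ = _ := by ring
  have e1 := (Equiv.neg ℤ).summable_iff.2 hb
  have e2 := (Equiv.subLeft (-1 : ℤ)).summable_iff.2 ha'
  refine (e2.add e1).congr fun n => ?_
  simp only [Function.comp_apply, Equiv.subLeft_apply, Equiv.neg_apply, reflectA, reflectB]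
  rw [show -(-1 - n) - 1 = n by ring, show -n - 1 = -1 - n by ring]
  push_cast
  rw [abs_neg]
  ring

theorem isJostPlus_reflect {f : ℤ → ℂ} :
    IsJostPlus (reflectA a) (reflectB b) z (fun m => f (-m)) ↔ IsJostMinus a b z f := by
  refine and_congr ⟨fun h n => ?_, fun h n => ?_⟩ ⟨fun h => ?_, fun h => ?_⟩
  · have := h (-n)
    simpa [jacobi_reflect] using this
  · rw [jacobi_reflect, h]
  · refine (h.comp tendsto_neg_atBot_atTop).congr fun n => ?_
    simp
  · exact h.comp tendsto_neg_atTop_atBot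

/-- The left Jost solution multiplied by `zⁿ`, as a function of `z` in the closed unit disc. -/
noncomputable def jostFunLeft (a b : ℤ → ℝ) (n : ℤ) (z : ℂ) : ℂ :=
  jostFun (reflectA a) (reflectB b) (-n) z

theorem HasDecay.isJostMinus (h : HasDecay a b) (ha : ∀ n, 0 < a n) (hz0 : z ≠ 0) (hz : ‖z‖ ≤ 1) :
    IsJostMinus a b z fun n => z ^ (-n) * jostFunLeft a b n z := by
  rw [← isJostPlus_reflect]
  simp only [jostFunLeft, neg_neg]
  exact h.reflect.isJostPlus (fun n => ha _) hz0 hz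

theorem HasDecay.isJostMinus_unique {f g : ℤ → ℂ} (h : HasDecay a b) (ha : ∀ n, 0 < a n)
    (hz0 : z ≠ 0) (hz : ‖z‖ ≤ 1) (hf : IsJostMinus a b z f) (hg : IsJostMinus a b z g) :
    f = g := by
  have := h.reflect.isJostPlus_unique (fun n => ha _) hz0 hz (isJostPlus_reflect.2 hf)
    (isJostPlus_reflect.2 hg)
  funext n
  simpa using congrFun this (-n)

theorem HasDecay.jostMinus_spec (h : HasDecay a b) (ha : ∀ n, 0 < a n) (hz0 : z ≠ 0)
    (hz : ‖z‖ ≤ 1) : IsJostMinus a b z (jostMinus a b z) :=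
  Classical.epsilon_spec ⟨_, h.isJostMinus ha hz0 hz⟩

theorem HasDecay.jostMinus_apply (h : HasDecay a b) (ha : ∀ n, 0 < a n) (hz0 : z ≠ 0)
    (hz : ‖z‖ ≤ 1) (n : ℤ) : jostMinus a b z n = z ^ (-n) * jostFunLeft a b n z :=
  congrFun (h.isJostMinus_unique ha hz0 hz (h.jostMinus_spec ha hz0 hz)
    (h.isJostMinus ha hz0 hz)) n

theorem HasDecay.differentiableOn_jostFunLeft (h : HasDecay a b) (n : ℤ) :
    DifferentiableOn ℂ (jostFunLeft a b n) (Metric.closedBall 0 1) :=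
  h.reflect.differentiableOn_jostFun _

theorem jostFunLeft_conj (n : ℤ) (z : ℂ) :
    jostFunLeft a b n ((starRingEnd ℂ) z) = (starRingEnd ℂ) (jostFunLeft a b n z) :=
  jostFun_conj _ _

/-- The normalisation `∏_{m < n} (2 a(m))⁻¹` of the left Jost solution. -/
noncomputable def jostNormLeft (a : ℤ → ℝ) (n : ℤ) : ℝ := jostNorm (reflectA a) (-n)

theorem jostNormLeft_pos (n : ℤ) : 0 < jostNormLeft a n := jostNorm_pos _ _

theorem jostFunLeft_zero (n : ℤ) : jostFunLeft a b n 0 = jostNormLeft a n := jostFun_zero _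

theorem HasDecay.jostNormLeft_eq (h : HasDecay a b) (ha : ∀ n, 0 < a n) (n : ℤ) :
    jostNormLeft a n = 2 * a n * jostNormLeft a (n + 1) := by
  have := h.reflect.jostNorm_add_one (fun n => ha _) (-(n + 1))
  rw [show -(n + 1) + 1 = -n by ring] at this
  simpa [jostNormLeft, reflectA] using this

theorem HasDecay.jostPlus_ne_zero (h : HasDecay a b) (ha : ∀ n, 0 < a n) (hz0 : z ≠ 0)
    (hz : ‖z‖ ≤ 1) : jostPlus a b z ≠ 0 := by
  intro h0
  have h1 := (h.jostPlus_spec ha hz0 hz).2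
  simp only [h0, Pi.zero_apply, mul_zero] at h1
  exact zero_ne_one (tendsto_nhds_unique tendsto_const_nhds h1)

theorem HasDecay.jostMinus_ne_zero (h : HasDecay a b) (ha : ∀ n, 0 < a n) (hz0 : z ≠ 0)
    (hz : ‖z‖ ≤ 1) : jostMinus a b z ≠ 0 := by
  intro h0
  have h1 := (h.jostMinus_spec ha hz0 hz).2
  simp only [h0, Pi.zero_apply, mul_zero] at h1
  exact zero_ne_one (tendsto_nhds_unique tendsto_const_nhds h1)

end jost

/-! ### The Jost determinant -/

/-- The Jost determinant `-2 z W(ψ₋, ψ₊)`. The factor `z` removes the pole at the origin. -/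
noncomputable def jostDet (a b : ℤ → ℝ) (z : ℂ) : ℂ :=
  2 * a 0 * (jostFunLeft a b 1 z * jostFun a b 0 z -
    z ^ 2 * jostFunLeft a b 0 z * jostFun a b 1 z)

section det

variable {a b : ℤ → ℝ} {z : ℂ}

theorem HasDecay.jostDet_eq (h : HasDecay a b) (ha : ∀ n, 0 < a n) (hz0 : z ≠ 0) (hz : ‖z‖ ≤ 1)
    (n : ℤ) : jostDet a b z = -2 * z * wronskian a (jostMinus a b z) (jostPlus a b z) n := by
  rw [wronskian_eq (h.jostMinus_spec ha hz0 hz).1 (h.jostPlus_spec ha hz0 hz).1 n 0]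
  simp only [wronskian, zero_add, h.jostMinus_apply ha hz0 hz, h.jostPlus_apply ha hz0 hz, jostDet]
  simp only [neg_zero, zpow_zero, zpow_neg, zpow_one]
  field_simp
  ring

theorem HasDecay.differentiableOn_jostDet (h : HasDecay a b) :
    DifferentiableOn ℂ (jostDet a b) (Metric.closedBall 0 1) := by
  have h1 := h.differentiableOn_jostFun 0
  have h2 := h.differentiableOn_jostFun 1
  have h3 := h.differentiableOn_jostFunLeft 0
  have h4 := h.differentiableOn_jostFunLeft 1
  unfold jostDet
  fun_prop

theorem analyticAt_of_norm_lt_one {f : ℂ → ℂ}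
    (hf : DifferentiableOn ℂ f (Metric.closedBall 0 1)) (hz : ‖z‖ < 1) : AnalyticAt ℂ f z :=
  (hf.mono Metric.ball_subset_closedBall).analyticAt
    (Metric.isOpen_ball.mem_nhds (mem_ball_zero_iff.2 hz))

theorem jostDet_conj (z : ℂ) :
    jostDet a b ((starRingEnd ℂ) z) = (starRingEnd ℂ) (jostDet a b z) := by
  simp only [jostDet, jostFun_conj, jostFunLeft_conj, map_mul, map_sub, map_pow, map_ofNat,
    Complex.conj_ofReal]

/-- The value at the origin is `∏ (2 a(m))⁻¹` over all sites, split at any `n`. -/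
theorem HasDecay.jostDet_zero (h : HasDecay a b) (ha : ∀ n, 0 < a n) (n : ℤ) :
    jostDet a b 0 = jostNormLeft a n * jostNorm a n := by
  have hstep : ∀ n : ℤ, jostNormLeft a (n + 1) * jostNorm a (n + 1) =
      jostNormLeft a n * jostNorm a n := by
    intro n
    rw [h.jostNormLeft_eq ha n, h.jostNorm_add_one ha n]; ring
  have hconst : ∀ n : ℤ, jostNormLeft a n * jostNorm a n = jostNormLeft a 0 * jostNorm a 0 := by
    intro n
    induction n with
    | zero => rfl
    | succ k ih => rw [hstep, ih]
    | pred k ih => rw [← ih, ← hstep, sub_add_cancel]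
  have h1 := h.jostNormLeft_eq ha 0
  rw [zero_add] at h1
  rw [← Complex.ofReal_mul, hconst n, h1]
  simp only [jostDet, jostFunLeft_zero, jostFun_zero]
  push_cast
  ring

theorem HasDecay.jostDet_zero_ne_zero (h : HasDecay a b) (ha : ∀ n, 0 < a n) :
    jostDet a b 0 ≠ 0 := by
  rw [h.jostDet_zero ha 0]
  exact_mod_cast (mul_pos (jostNormLeft_pos 0) (jostNorm_pos a 0)).ne'

/-! ### Scattering on the unit circle -/

theorem conj_eq_inv (hz : ‖z‖ = 1) : (starRingEnd ℂ) z = z⁻¹ := by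
  rw [Complex.inv_def, Complex.normSq_eq_norm_sq, hz]; simp

theorem ne_zero_of_norm_eq_one (hz : ‖z‖ = 1) : z ≠ 0 := by
  rintro rfl; simp at hz

theorem conj_spectral (hz : ‖z‖ = 1) : (starRingEnd ℂ) ((z + z⁻¹) / 2) = (z + z⁻¹) / 2 := by
  have h1 := conj_eq_inv hz
  have h2 : (starRingEnd ℂ) z⁻¹ = z := by rw [← h1, Complex.conj_conj]
  rw [map_div₀, map_add, h1, h2, add_comm, map_ofNat]

theorem HasDecay.jacobi_conj_jostPlus (h : HasDecay a b) (ha : ∀ n, 0 < a n) (hz : ‖z‖ = 1)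
    (n : ℤ) : jacobi a b (fun n => (starRingEnd ℂ) (jostPlus a b z n)) n =
      (z + z⁻¹) / 2 * (starRingEnd ℂ) (jostPlus a b z n) := by
  rw [jacobi_conj (h.jostPlus_spec ha (ne_zero_of_norm_eq_one hz) hz.le).1, conj_spectral hz]

theorem HasDecay.wronskian_conj_jostPlus (h : HasDecay a b) (ha : ∀ n, 0 < a n) (hz : ‖z‖ = 1)
    (n : ℤ) : wronskian a (fun n => (starRingEnd ℂ) (jostPlus a b z n)) (jostPlus a b z) n =
      (z - z⁻¹) / 2 := by
  have hz0 := ne_zero_of_norm_eq_one hz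
  obtain ⟨h1, h2⟩ := h.jostPlus_spec ha hz0 hz.le
  have h3 := (Complex.continuous_conj.tendsto _).comp h2
  rw [map_one] at h3
  have := wronskian_eq_of_tendsto h hz0 (h.jacobi_conj_jostPlus ha hz) h1 (x := 1) (y := 1)
    (h3.congr fun n => ?_) h2 n
  · rw [this]; ring
  · simp only [Function.comp_apply, map_mul, map_zpow₀, conj_eq_inv hz]

theorem HasDecay.wronskian_conj_jostMinus (h : HasDecay a b) (ha : ∀ n, 0 < a n) (hz : ‖z‖ = 1)
    (n : ℤ) : wronskian a (fun n => (starRingEnd ℂ) (jostMinus a b z n)) (jostMinus a b z) n =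
      -((z - z⁻¹) / 2) := by
  have hz0 := ne_zero_of_norm_eq_one hz
  have h1 := h.reflect.wronskian_conj_jostPlus (fun n => ha _) hz (-n - 1)
  have h2 : (fun m => jostMinus a b z (-m)) = jostPlus (reflectA a) (reflectB b) z :=
    h.reflect.isJostPlus_unique (fun n => ha _) hz0 hz.le
      (isJostPlus_reflect.2 (h.jostMinus_spec ha hz0 hz.le))
      (h.reflect.jostPlus_spec (fun n => ha _) hz0 hz.le)
  rw [← h2, wronskian_reflect (fun m => (starRingEnd ℂ) (jostMinus a b z m))] at h1
  rw [← h1, neg_neg]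
  congr 1; ring

/-- Conservation of energy on the unit circle: by the Plücker relation,
`|W(ψ₋, ψ₊)|² = |W(ψ̄₋, ψ₊)|² + |(z - z⁻¹) / 2|²`. -/
theorem HasDecay.norm_one_sub_sq_le (h : HasDecay a b) (ha : ∀ n, 0 < a n) (hz : ‖z‖ = 1) :
    ‖1 - z ^ 2‖ ≤ ‖jostDet a b z‖ := by
  have hz0 := ne_zero_of_norm_eq_one hz
  have h1 := h.wronskian_conj_jostPlus ha hz 0
  have h2 := h.wronskian_conj_jostMinus ha hz 0
  have h3 := h.jostDet_eq ha hz0 hz.le 0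
  set W := wronskian a (jostMinus a b z) (jostPlus a b z) 0 with hW
  set V := wronskian a (fun n => (starRingEnd ℂ) (jostMinus a b z n)) (jostPlus a b z) 0 with hV
  set s := (z - z⁻¹) / 2 with hs
  have hsconj : (starRingEnd ℂ) s = -s := by
    have h2 : (starRingEnd ℂ) z⁻¹ = z := by rw [← conj_eq_inv hz, Complex.conj_conj]
    rw [hs, map_div₀, map_sub, conj_eq_inv hz, h2]
    simp only [map_ofNat]
    ring
  have hplu : W * (starRingEnd ℂ) W = V * (starRingEnd ℂ) V + s * (starRingEnd ℂ) s := by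
    have e : s * (starRingEnd ℂ) s = -(s * s) := by rw [hsconj]; ring
    have e2 : s * s = -(wronskian a (fun n => (starRingEnd ℂ) (jostMinus a b z n))
        (jostMinus a b z) 0) *
        wronskian a (fun n => (starRingEnd ℂ) (jostPlus a b z n)) (jostPlus a b z) 0 := by
      rw [h1, h2]; ring
    rw [e, e2, hW, hV]
    simp only [wronskian, map_mul, map_sub, Complex.conj_ofReal, Complex.conj_conj]
    ring
  have hnorm : ‖W‖ ^ 2 = ‖V‖ ^ 2 + ‖s‖ ^ 2 := by
    simp only [Complex.mul_conj, Complex.normSq_eq_norm_sq] at hplu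
    exact_mod_cast hplu
  have hle : ‖s‖ ≤ ‖W‖ := by
    exact le_of_sq_le_sq (by nlinarith [sq_nonneg ‖V‖]) (norm_nonneg _)
  have e3 : 1 - z ^ 2 = -2 * z * s := by rw [hs]; field_simp; ring
  rw [e3, h3, norm_mul, norm_mul (-2 * z)]
  gcongr

theorem one_sub_sq_ne_zero (h1 : z ≠ 1) (h2 : z ≠ -1) : 1 - z ^ 2 ≠ 0 := by
  intro h0
  have : (z - 1) * (z + 1) = 0 := by linear_combination -h0
  rcases mul_eq_zero.1 this with h | h
  · exact h1 (sub_eq_zero.1 h)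
  · exact h2 (eq_neg_of_add_eq_zero_left h)

theorem HasDecay.jostDet_ne_zero_of_norm_eq_one (h : HasDecay a b) (ha : ∀ n, 0 < a n)
    (hz : ‖z‖ = 1) (h1 : 1 - z ^ 2 ≠ 0) : jostDet a b z ≠ 0 := by
  have := h.norm_one_sub_sq_le ha hz
  exact norm_pos_iff.1 ((norm_pos_iff.2 h1).trans_le this)

/-- The scattering relation before division by the Wronskian. -/
theorem HasDecay.scattering_identity (h : HasDecay a b) (ha : ∀ n, 0 < a n) (hz : ‖z‖ = 1)
    (n : ℤ) : (z - z⁻¹) / 2 * jostMinus a b z n =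
      wronskian a (jostMinus a b z) (jostPlus a b z) 0 * (starRingEnd ℂ) (jostPlus a b z n) -
      wronskian a (jostMinus a b z) (fun n => (starRingEnd ℂ) (jostPlus a b z n)) 0 *
        jostPlus a b z n := by
  have hz0 := ne_zero_of_norm_eq_one hz
  have hM := (h.jostMinus_spec ha hz0 hz.le).1
  have hP := (h.jostPlus_spec ha hz0 hz.le).1
  have hPc := h.jacobi_conj_jostPlus ha hz
  rw [← h.wronskian_conj_jostPlus ha hz n, wronskian_eq hM hP 0 n, wronskian_eq hM hPc 0 n]
  simp only [wronskian]
  ring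

end det

/-! ### Eigenvalues and zeros of the Jost determinant -/

section eigenvalues

variable {a b : ℤ → ℝ} {z : ℂ}

theorem HasDecay.exists_norm_jostPlus_le (h : HasDecay a b) (ha : ∀ n, 0 < a n) :
    ∃ B : ℝ, ∀ z : ℂ, z ≠ 0 → ‖z‖ ≤ 1 → ∀ p : ℕ, ‖jostPlus a b z p‖ ≤ B * ‖z‖ ^ p := by
  obtain ⟨ε, hε, hb⟩ := h.exists_jostFun_bound
  obtain ⟨B, hB⟩ := (hε.comp tendsto_natCast_atTop_atTop).bddAbove_range
  refine ⟨B + 1, fun z hz0 hz p => ?_⟩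
  rw [h.jostPlus_apply ha hz0 hz, zpow_natCast, norm_mul, norm_pow, mul_comm]
  gcongr
  have h1 := hb p (Int.natCast_nonneg p) z hz
  have h2 : ε p ≤ B := hB ⟨p, rfl⟩
  have h3 := norm_le_norm_sub_add (jostFun a b p z) 1
  rw [norm_one] at h3
  linarith

theorem HasDecay.jostPlus_reflect (h : HasDecay a b) (ha : ∀ n, 0 < a n) (hz0 : z ≠ 0)
    (hz : ‖z‖ ≤ 1) (n : ℤ) :
    jostPlus (reflectA a) (reflectB b) z n = jostMinus a b z (-n) :=
  congrFun (h.reflect.isJostPlus_unique (fun _ => ha _) hz0 hz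
      (h.reflect.jostPlus_spec (fun _ => ha _) hz0 hz)
      (isJostPlus_reflect.2 (h.jostMinus_spec ha hz0 hz))) n

theorem HasDecay.exists_norm_jostMinus_le (h : HasDecay a b) (ha : ∀ n, 0 < a n) :
    ∃ B : ℝ, ∀ z : ℂ, z ≠ 0 → ‖z‖ ≤ 1 → ∀ p : ℕ, ‖jostMinus a b z (-p)‖ ≤ B * ‖z‖ ^ p := by
  obtain ⟨B, hB⟩ := h.reflect.exists_norm_jostPlus_le (fun n => ha _)
  refine ⟨B, fun z hz0 hz p => ?_⟩
  rw [← h.jostPlus_reflect ha hz0 hz]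
  exact hB z hz0 hz p

theorem HasDecay.tendsto_zero_right (h : HasDecay a b) {f g : ℤ → ℂ}
    (hf : Tendsto f atTop (𝓝 0)) (hg : Tendsto g atTop (𝓝 0)) :
    Tendsto (wronskian a f g) atTop (𝓝 0) := by
  have := wronskian_tendsto_of_tendsto h (z := 1) (w := 1) one_ne_zero one_ne_zero (by simp)
    (x := 0) (y := 0) (by simpa using hf) (by simpa using hg)
  simpa using this

theorem HasDecay.tendsto_jostPlus (h : HasDecay a b) (ha : ∀ n, 0 < a n) (hz0 : z ≠ 0)
    (hz : ‖z‖ < 1) : Tendsto (jostPlus a b z) atTop (𝓝 0) := by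
  have h1 := (h.jostPlus_spec ha hz0 hz.le).2
  have h2 : Tendsto (fun n : ℤ => z ^ n) atTop (𝓝 0) := by
    have h3 : Tendsto (fun p : ℕ => z ^ p) atTop (𝓝 0) :=
      tendsto_pow_atTop_nhds_zero_of_norm_lt_one hz
    have h4 : Tendsto (fun n : ℤ => z ^ n.toNat) atTop (𝓝 0) :=
      h3.comp (tendsto_atTop_atTop.2 fun p => ⟨p, fun m hm => by omega⟩)
    refine h4.congr' ?_
    filter_upwards [eventually_ge_atTop 0] with n hn
    rw [← zpow_natCast, Int.toNat_of_nonneg hn]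
  have h5 := h2.mul h1
  rw [zero_mul] at h5
  refine h5.congr fun n => ?_
  rw [← mul_assoc, ← zpow_add₀ hz0]
  simp

theorem HasDecay.tendsto_jostMinus (h : HasDecay a b) (ha : ∀ n, 0 < a n) (hz0 : z ≠ 0)
    (hz : ‖z‖ < 1) : Tendsto (jostMinus a b z) atBot (𝓝 0) := by
  refine ((h.reflect.tendsto_jostPlus (fun n => ha _) hz0 hz).comp
    tendsto_neg_atBot_atTop).congr fun n => ?_
  simp [h.jostPlus_reflect ha hz0 hz.le]

theorem HasDecay.tendsto_zero_left (h : HasDecay a b) {f g : ℤ → ℂ}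
    (hf : Tendsto f atBot (𝓝 0)) (hg : Tendsto g atBot (𝓝 0)) :
    Tendsto (wronskian a f g) atBot (𝓝 0) := by
  have h1 := h.reflect.tendsto_zero_right (f := fun m => f (-m)) (g := fun m => g (-m))
    (hf.comp tendsto_neg_atTop_atBot) (hg.comp tendsto_neg_atTop_atBot)
  have h2 : Tendsto (fun n : ℤ => -n - 1) atBot atTop := by
    have := tendsto_atTop_add_const_right _ (-1 : ℤ) (tendsto_neg_atBot_atTop (G := ℤ))
    simpa [sub_eq_add_neg] using this
  have h3 := (h1.comp h2).neg
  rw [neg_zero] at h3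
  refine h3.congr fun n => ?_
  rw [Function.comp_apply, wronskian_reflect]
  simp

/-- Proportionality of the two Jost solutions at a zero of the Jost determinant. -/
theorem HasDecay.exists_jostMinus_eq (h : HasDecay a b) (ha : ∀ n, 0 < a n) (hz0 : z ≠ 0)
    (hz : ‖z‖ ≤ 1) (hD : jostDet a b z = 0) :
    ∃ c : ℂ, c ≠ 0 ∧ ∀ n, jostMinus a b z n = c * jostPlus a b z n := by
  have hM := (h.jostMinus_spec ha hz0 hz).1
  have hP := (h.jostPlus_spec ha hz0 hz).1
  rw [h.jostDet_eq ha hz0 hz 0] at hD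
  have hW := (mul_eq_zero.1 hD).resolve_left (by simpa using hz0)
  have hW' : wronskian a (jostPlus a b z) (jostMinus a b z) 0 = 0 := by
    simp only [wronskian] at hW ⊢
    linear_combination -hW
  obtain ⟨c, hc⟩ := exists_eq_mul_of_wronskian_eq_zero ha hP hM (h.jostPlus_ne_zero ha hz0 hz) hW'
  refine ⟨c, ?_, hc⟩
  rintro rfl
  refine h.jostMinus_ne_zero ha hz0 hz (funext fun n => ?_)
  rw [hc n, zero_mul, Pi.zero_apply]

theorem HasDecay.summable_sq_jostPlus (h : HasDecay a b) (ha : ∀ n, 0 < a n) (hz0 : z ≠ 0)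
    (hz : ‖z‖ < 1) : Summable fun p : ℕ => ‖jostPlus a b z (1 + p)‖ ^ 2 := by
  obtain ⟨B, hB⟩ := h.exists_norm_jostPlus_le ha
  have hs : Summable fun p : ℕ => B ^ 2 * (‖z‖ ^ 2) ^ p :=
    (summable_geometric_of_lt_one (by positivity)
      (pow_lt_one₀ (norm_nonneg _) hz (by norm_num))).mul_left _
  have hs1 := (summable_nat_add_iff 1).2 hs
  refine Summable.of_nonneg_of_le (fun _ => by positivity) (fun p => ?_) hs1
  have h1 := hB z hz0 hz.le (p + 1)
  push_cast at h1
  rw [add_comm (1 : ℤ)]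
  calc _ ≤ (B * ‖z‖ ^ (p + 1)) ^ 2 := by gcongr
    _ = _ := by ring

theorem HasDecay.summable_sq_jostMinus (h : HasDecay a b) (ha : ∀ n, 0 < a n) (hz0 : z ≠ 0)
    (hz : ‖z‖ < 1) : Summable fun p : ℕ => ‖jostMinus a b z (-p)‖ ^ 2 := by
  obtain ⟨B, hB⟩ := h.exists_norm_jostMinus_le ha
  have hs : Summable fun p : ℕ => B ^ 2 * (‖z‖ ^ 2) ^ p :=
    (summable_geometric_of_lt_one (by positivity)
      (pow_lt_one₀ (norm_nonneg _) hz (by norm_num))).mul_left _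
  refine Summable.of_nonneg_of_le (fun _ => by positivity) (fun p => ?_) hs
  calc _ ≤ (B * ‖z‖ ^ p) ^ 2 := by gcongr; exact hB z hz0 hz.le p
    _ = _ := by ring

/-- Sums over the lattice, split between the sites `0` and `1`. -/
theorem hasSum_int_of_halves {f : ℤ → ℝ} {s t : ℝ} (hs : HasSum (fun p : ℕ => f (1 + p)) s)
    (ht : HasSum (fun p : ℕ => f (-p)) t) : HasSum f (s + t) := by
  have h1 := HasSum.of_nat_of_neg_add_one (f := fun n => f (-n)) ht
    (by simpa [add_comm] using hs)
  rw [add_comm, ← (Equiv.neg ℤ).hasSum_iff]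
  exact h1

/-- At a zero of the Jost determinant the Jost solution is square summable. -/
theorem HasDecay.hasSum_sq_jostPlus (h : HasDecay a b) (ha : ∀ n, 0 < a n) (hz0 : z ≠ 0)
    (hz : ‖z‖ < 1) (hD : jostDet a b z = 0) :
    HasSum (fun n => ‖jostPlus a b z n‖ ^ 2) ((∑' p : ℕ, ‖jostPlus a b z (1 + p)‖ ^ 2) +
      ∑' p : ℕ, ‖jostPlus a b z (-p)‖ ^ 2) := by
  obtain ⟨c, hc0, hc⟩ := h.exists_jostMinus_eq ha hz0 hz.le hD
  refine hasSum_int_of_halves (h.summable_sq_jostPlus ha hz0 hz).hasSum (Summable.hasSum ?_)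
  have h1 := (h.summable_sq_jostMinus ha hz0 hz).mul_left (‖c‖⁻¹ ^ 2)
  refine h1.congr fun p => ?_
  rw [hc, norm_mul]
  have := norm_ne_zero_iff.2 hc0
  field_simp

/-- The Wronskian of an eigenvector with either Jost solution vanishes, so both Jost solutions are
multiples of it. -/
theorem HasDecay.isEigenvalue_iff (h : HasDecay a b) (ha : ∀ n, 0 < a n) {ζ : ℝ} (h0 : ζ ≠ 0)
    (h1 : |ζ| < 1) : IsEigenvalue a b ((ζ + ζ⁻¹) / 2) ↔ jostDet a b (ζ : ℂ) = 0 := by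
  have hz0 : (ζ : ℂ) ≠ 0 := by exact_mod_cast h0
  have hz : ‖(ζ : ℂ)‖ < 1 := by simpa using h1
  have hl : (((ζ + ζ⁻¹) / 2 : ℝ) : ℂ) = ((ζ : ℂ) + (ζ : ℂ)⁻¹) / 2 := by push_cast; rfl
  have hM := (h.jostMinus_spec ha hz0 hz.le).1
  have hP := (h.jostPlus_spec ha hz0 hz.le).1
  constructor
  · rintro ⟨f, hf0, hf2, hf⟩
    rw [hl] at hf
    have hsum : Summable fun n => ‖f n‖ ^ 2 := by
      have := (memℓp_gen_iff (by norm_num)).1 hf2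
      simpa using this
    have hf_cof : Tendsto f cofinite (𝓝 0) := by
      have h1 := hsum.tendsto_cofinite_zero.sqrt
      rw [tendsto_zero_iff_norm_tendsto_zero]
      simpa using h1
    have hf_top : Tendsto f atTop (𝓝 0) := hf_cof.mono_left (Int.cofinite_eq ▸ le_sup_right)
    have hf_bot : Tendsto f atBot (𝓝 0) := hf_cof.mono_left (Int.cofinite_eq ▸ le_sup_left)
    have hWP : ∀ n, wronskian a f (jostPlus a b ζ) n = 0 := fun n => by
      have h2 := h.tendsto_zero_right hf_top (h.tendsto_jostPlus ha hz0 hz)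
      have h3 : Tendsto (fun _ : ℤ => wronskian a f (jostPlus a b ζ) n) atTop (𝓝 0) :=
        h2.congr fun m => wronskian_eq hf hP m n
      exact tendsto_nhds_unique tendsto_const_nhds h3
    have hWM : ∀ n, wronskian a f (jostMinus a b ζ) n = 0 := fun n => by
      have h2 := h.tendsto_zero_left hf_bot (h.tendsto_jostMinus ha hz0 hz)
      have h3 : Tendsto (fun _ : ℤ => wronskian a f (jostMinus a b ζ) n) atBot (𝓝 0) :=
        h2.congr fun m => wronskian_eq hf hM m n
      exact tendsto_nhds_unique tendsto_const_nhds h3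
    obtain ⟨c, hc⟩ := exists_eq_mul_of_wronskian_eq_zero ha hf hP hf0 (hWP 0)
    obtain ⟨d, hd⟩ := exists_eq_mul_of_wronskian_eq_zero ha hf hM hf0 (hWM 0)
    rw [h.jostDet_eq ha hz0 hz.le 0]
    simp only [wronskian, hc, hd]
    ring
  · intro hD
    refine ⟨jostPlus a b ζ, h.jostPlus_ne_zero ha hz0 hz.le, ?_, fun n => ?_⟩
    · refine (memℓp_gen_iff (by norm_num)).2 ?_
      simpa using (h.hasSum_sq_jostPlus ha hz0 hz hD).summable
    · rw [hl]; exact hP n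

/-- Zeros of the Jost determinant in the open disc are real, by symmetry of the operator. -/
theorem HasDecay.im_eq_zero_of_jostDet_eq_zero (h : HasDecay a b) (ha : ∀ n, 0 < a n)
    (hz : ‖z‖ < 1) (hD : jostDet a b z = 0) : z.im = 0 := by
  have hz0 : z ≠ 0 := by
    rintro rfl; exact h.jostDet_zero_ne_zero ha hD
  obtain ⟨c, hc0, hc⟩ := h.exists_jostMinus_eq ha hz0 hz.le hD
  set ψ := jostPlus a b z with hψ
  have hP := (h.jostPlus_spec ha hz0 hz.le).1
  have htop := h.tendsto_jostPlus ha hz0 hz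
  have hbot : Tendsto ψ atBot (𝓝 0) := by
    have := (h.tendsto_jostMinus ha hz0 hz).const_mul c⁻¹
    rw [mul_zero] at this
    refine this.congr fun n => ?_
    rw [hc]; field_simp
  by_contra him
  set l := (z + z⁻¹) / 2 with hl
  have hlim : l.im ≠ 0 := by
    have e : l.im = z.im * (1 - (Complex.normSq z)⁻¹) / 2 := by
      rw [hl]; simp [Complex.inv_im]; ring
    rw [e]
    have hn : 0 < Complex.normSq z := Complex.normSq_pos.2 hz0
    have hn1 : Complex.normSq z < 1 := by
      rw [Complex.normSq_eq_norm_sq]; exact pow_lt_one₀ (norm_nonneg _) hz (by norm_num)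
    have : 1 < (Complex.normSq z)⁻¹ := (one_lt_inv₀ hn).2 hn1
    exact div_ne_zero (mul_ne_zero him (by linarith)) two_ne_zero
  -- the imaginary part of `W(ψ̄, ψ) / (2 Im l)` is monotone and vanishes at both ends
  set g : ℤ → ℝ := fun n => (wronskian a (fun n => (starRingEnd ℂ) (ψ n)) ψ n).im / (2 * l.im)
  have hg : ∀ n, g n - g (n - 1) = ‖ψ n‖ ^ 2 := by
    intro n
    have h1 := congrArg Complex.im (wronskian_sub (jacobi_conj hP) hP n)
    have h2 : (starRingEnd ℂ) (ψ n) * ψ n = ((‖ψ n‖ ^ 2 : ℝ) : ℂ) := by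
      rw [mul_comm, Complex.mul_conj, Complex.normSq_eq_norm_sq]
    rw [h2, Complex.im_mul_ofReal] at h1
    simp only [Complex.sub_im, Complex.conj_im] at h1
    simp only [g]
    rw [← sub_div, h1]
    field_simp
    ring
  have hmono : Monotone g := monotone_int_of_le_succ fun n => by
    have := hg (n + 1)
    rw [add_sub_cancel_right] at this
    nlinarith [sq_nonneg ‖ψ (n + 1)‖]
  have hconj : ∀ {F : Filter ℤ}, Tendsto ψ F (𝓝 0) →
      Tendsto (fun n => (starRingEnd ℂ) (ψ n)) F (𝓝 0) := fun hF => by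
    have := (Complex.continuous_conj.tendsto _).comp hF
    rwa [map_zero] at this
  have hlimg : ∀ {F : Filter ℤ}, Tendsto (wronskian a (fun n => (starRingEnd ℂ) (ψ n)) ψ) F (𝓝 0) →
      Tendsto g F (𝓝 0) := fun hF => by
    have := ((Complex.continuous_im.tendsto _).comp hF).div_const (2 * l.im)
    simpa using this
  have g0 : ∀ n, g n = 0 := fun n => le_antisymm
    (hmono.ge_of_tendsto (hlimg (h.tendsto_zero_right (hconj htop) htop)) n)
    (hmono.le_of_tendsto (hlimg (h.tendsto_zero_left (hconj hbot) hbot)) n)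
  refine h.jostPlus_ne_zero ha hz0 hz.le (funext fun n => ?_)
  have := hg n
  rw [g0, g0, sub_zero] at this
  simpa using this.symm

theorem HasDecay.jostDet_eq_zero_iff (h : HasDecay a b) (ha : ∀ n, 0 < a n) (hz : ‖z‖ < 1) :
    jostDet a b z = 0 ↔ ∃ ζ ∈ discreteData a b, z = (ζ : ℂ) := by
  constructor
  · intro hD
    have him := h.im_eq_zero_of_jostDet_eq_zero ha hz hD
    have hre : z = (z.re : ℂ) := Complex.ext (by simp) (by simp [him])
    have h0 : z.re ≠ 0 := by
      intro h0
      rw [hre, h0] at hD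
      exact h.jostDet_zero_ne_zero ha (by simpa using hD)
    have h1 : |z.re| < 1 := by rw [hre] at hz; simpa using hz
    refine ⟨z.re, ⟨h0, h1, (h.isEigenvalue_iff ha h0 h1).2 ?_⟩, hre⟩
    rwa [← hre]
  · rintro ⟨ζ, ⟨h0, h1, h2⟩, rfl⟩
    exact (h.isEigenvalue_iff ha h0 h1).1 h2

end eigenvalues

/-! ### Norming constants and the derivative of the Jost determinant -/

section norming

variable {a b : ℤ → ℝ} {z : ℂ}

/-- Green's formula on the right half line. -/
theorem tsum_right_of_wronskian {W d : ℤ → ℂ} (hW : ∀ n, W n - W (n - 1) = d n)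
    (hlim : Tendsto W atTop (𝓝 0)) (hd : Summable fun p : ℕ => d (1 + p)) :
    W 0 = -∑' p : ℕ, d (1 + p) := by
  have hpart : ∀ N : ℕ, ∑ p ∈ Finset.range N, d (1 + p) = W N - W 0 := by
    intro N
    induction N with
    | zero => simp
    | succ N ih =>
      rw [Finset.sum_range_succ, ih, ← hW]
      push_cast
      rw [add_comm (1 : ℤ), add_sub_cancel_right]
      ring
  have h1 := hd.hasSum.tendsto_sum_nat
  have h2 : Tendsto (fun N : ℕ => W N - W 0) atTop (𝓝 (0 - W 0)) :=
    (hlim.comp tendsto_natCast_atTop_atTop).sub_const _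
  have h3 := tendsto_nhds_unique (h1.congr hpart) h2
  rw [h3]; ring

/-- Green's formula on the left half line. -/
theorem tsum_left_of_wronskian {W d : ℤ → ℂ} (hW : ∀ n, W n - W (n - 1) = d n)
    (hlim : Tendsto W atBot (𝓝 0)) (hd : Summable fun p : ℕ => d (-p)) :
    W 0 = ∑' p : ℕ, d (-p) := by
  have hpart : ∀ N : ℕ, ∑ p ∈ Finset.range N, d (-p) = W 0 - W (-N) := by
    intro N
    induction N with
    | zero => simp
    | succ N ih =>
      rw [Finset.sum_range_succ, ih, ← hW]
      push_cast
      rw [show -((N : ℤ) + 1) = -N - 1 by ring]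
      ring
  have h1 := hd.hasSum.tendsto_sum_nat
  have h2 : Tendsto (fun N : ℕ => W 0 - W (-N)) atTop (𝓝 (W 0 - 0)) :=
    ((hlim.comp tendsto_neg_atTop_atBot).comp tendsto_natCast_atTop_atTop).const_sub _
  have h3 := tendsto_nhds_unique (h1.congr hpart) h2
  rw [h3, sub_zero]

/-- The inverse norming constant is a positive number given by a convergent series. -/
theorem HasDecay.normingConstant_inv (h : HasDecay a b) (ha : ∀ n, 0 < a n) {ζ : ℝ}
    (h0 : ζ ≠ 0) (h1 : |ζ| < 1) (hD : jostDet a b (ζ : ℂ) = 0) :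
    0 < normingConstant a b ζ ∧ (normingConstant a b ζ)⁻¹ =
      (∑' p : ℕ, ‖jostPlus a b ζ (1 + p)‖ ^ 2) + ∑' p : ℕ, ‖jostPlus a b ζ (-p)‖ ^ 2 := by
  have hz0 : (ζ : ℂ) ≠ 0 := by exact_mod_cast h0
  have hz : ‖(ζ : ℂ)‖ < 1 := by simpa using h1
  have hS := h.hasSum_sq_jostPlus ha hz0 hz hD
  refine ⟨inv_pos.2 ?_, by rw [normingConstant, inv_inv, hS.tsum_eq]⟩
  obtain ⟨n, hn⟩ := Function.ne_iff.1 (h.jostPlus_ne_zero ha hz0 hz.le)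
  exact hS.summable.tsum_pos (fun _ => by positivity) n (by
    have : 0 < ‖jostPlus a b ζ n‖ := norm_pos_iff.2 hn
    positivity)

theorem conj_jostPlus_ofReal (h : HasDecay a b) (ha : ∀ n, 0 < a n) {ζ : ℝ} (h0 : ζ ≠ 0)
    (h1 : |ζ| ≤ 1) (n : ℤ) : (starRingEnd ℂ) (jostPlus a b ζ n) = jostPlus a b ζ n := by
  have hz0 : (ζ : ℂ) ≠ 0 := by exact_mod_cast h0
  have hz : ‖(ζ : ℂ)‖ ≤ 1 := by simpa using h1
  rw [h.jostPlus_apply ha hz0 hz, map_mul, map_zpow₀, ← jostFun_conj, Complex.conj_ofReal]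

theorem HasDecay.analyticAt_jostPlus (h : HasDecay a b) (ha : ∀ n, 0 < a n) (hz0 : z ≠ 0)
    (hz : ‖z‖ < 1) (n : ℤ) : AnalyticAt ℂ (fun w => jostPlus a b w n) z := by
  have h1 := analyticAt_of_norm_lt_one (h.differentiableOn_jostFun n) hz
  have h2 : AnalyticAt ℂ (fun w : ℂ => w ^ n) z := analyticAt_id.zpow hz0
  refine (h2.mul h1).congr ?_
  filter_upwards [isOpen_ne.mem_nhds hz0,
    (isOpen_lt continuous_norm continuous_const).mem_nhds hz] with w hw0 hw
  exact (h.jostPlus_apply ha hw0 (le_of_lt hw) n).symm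

theorem HasDecay.analyticAt_jostMinus (h : HasDecay a b) (ha : ∀ n, 0 < a n) (hz0 : z ≠ 0)
    (hz : ‖z‖ < 1) (n : ℤ) : AnalyticAt ℂ (fun w => jostMinus a b w n) z := by
  have h1 := analyticAt_of_norm_lt_one (h.differentiableOn_jostFunLeft n) hz
  have h2 : AnalyticAt ℂ (fun w : ℂ => w ^ (-n)) z := analyticAt_id.zpow hz0
  refine (h2.mul h1).congr ?_
  filter_upwards [isOpen_ne.mem_nhds hz0,
    (isOpen_lt continuous_norm continuous_const).mem_nhds hz] with w hw0 hw
  exact (h.jostMinus_apply ha hw0 (le_of_lt hw) n).symm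

/-- The Jost determinant has a simple zero at each eigenvalue; its derivative is given by the
norming constant. With `f = ψ₋(z) - ψ₋(ζ)` and `g = ψ₊(z) - ψ₊(ζ)`, the Wronskian `W(f, g)` is
`O((z - ζ)²)`, and the remaining three terms in its expansion are `W(ψ₋, ψ₊)(z)` and two mixed
Wronskians, which Green's formula turns into half-line sums. -/
theorem HasDecay.tendsto_jostDet_div (h : HasDecay a b) (ha : ∀ n, 0 < a n) {ζ : ℝ}
    (h0 : ζ ≠ 0) (h1 : |ζ| < 1) (hD : jostDet a b (ζ : ℂ) = 0) {c : ℂ}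
    (hc : ∀ n, jostMinus a b ζ n = c * jostPlus a b ζ n) :
    Tendsto (fun z => jostDet a b z / (z - ζ)) (𝓝[≠] (ζ : ℂ))
      (𝓝 (((ζ : ℂ) - (ζ : ℂ)⁻¹) * c * ((normingConstant a b ζ : ℝ) : ℂ)⁻¹)) := by
  have hz0 : (ζ : ℂ) ≠ 0 := by exact_mod_cast h0
  have hz : ‖(ζ : ℂ)‖ < 1 := by simpa using h1
  obtain ⟨B, hB⟩ := h.exists_norm_jostPlus_le ha
  obtain ⟨B', hB'⟩ := h.exists_norm_jostMinus_le ha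
  have hB0 : 0 ≤ B := by
    have := (norm_nonneg _).trans (hB ζ hz0 hz.le 0); simpa using this
  have hB0' : 0 ≤ B' := by
    have := (norm_nonneg _).trans (hB' ζ hz0 hz.le 0); simpa using this
  obtain ⟨c', hc'0, hc'⟩ := h.exists_jostMinus_eq ha hz0 hz.le hD
  have hcc : c = c' := by
    obtain ⟨n, hn⟩ := Function.ne_iff.1 (h.jostPlus_ne_zero ha hz0 hz.le)
    exact mul_right_cancel₀ hn ((hc n).symm.trans (hc' n))
  subst hcc
  have hcinv : ∀ n, jostPlus a b ζ n = c⁻¹ * jostMinus a b ζ n := fun n => by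
    rw [hc]; field_simp
  -- the mixed half-line sums
  set qR : ℂ → ℂ := fun z => ∑' p : ℕ, jostMinus a b ζ (1 + p) * jostPlus a b z (1 + p) with hqR
  set qL : ℂ → ℂ := fun z => ∑' p : ℕ, jostMinus a b z (-p) * jostPlus a b ζ (-p) with hqL
  have hgeo : Summable fun p : ℕ => ‖(ζ : ℂ)‖ ^ p :=
    summable_geometric_of_lt_one (norm_nonneg _) hz
  have hgeo1 : Summable fun p : ℕ => ‖(ζ : ℂ)‖ ^ (p + 1) := (summable_nat_add_iff 1).2 hgeo
  have bR : ∀ z : ℂ, z ≠ 0 → ‖z‖ < 1 → ∀ p : ℕ,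
      ‖jostMinus a b ζ (1 + p) * jostPlus a b z (1 + p)‖ ≤ ‖c‖ * B * B * ‖(ζ : ℂ)‖ ^ (p + 1) := by
    intro z hz0' hz' p
    have e1 := hB ζ hz0 hz.le (p + 1)
    have e2 := hB z hz0' hz'.le (p + 1)
    push_cast at e1 e2
    rw [add_comm (1 : ℤ), norm_mul, hc, norm_mul]
    have e3 : ‖jostPlus a b z (p + 1)‖ ≤ B :=
      e2.trans (mul_le_of_le_one_right hB0 (pow_le_one₀ (norm_nonneg _) hz'.le))
    calc _ ≤ ‖c‖ * (B * ‖(ζ : ℂ)‖ ^ (p + 1)) * B := by gcongr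
      _ = _ := by ring
  have bL : ∀ z : ℂ, z ≠ 0 → ‖z‖ < 1 → ∀ p : ℕ,
      ‖jostMinus a b z (-p) * jostPlus a b ζ (-p)‖ ≤ ‖c⁻¹‖ * B' * B' * ‖(ζ : ℂ)‖ ^ p := by
    intro z hz0' hz' p
    have e1 := hB' ζ hz0 hz.le p
    have e2 := hB' z hz0' hz'.le p
    rw [norm_mul, hcinv, norm_mul]
    have e3 : ‖jostMinus a b z (-p)‖ ≤ B' :=
      e2.trans (mul_le_of_le_one_right hB0' (pow_le_one₀ (norm_nonneg _) hz'.le))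
    calc _ ≤ B' * (‖c⁻¹‖ * (B' * ‖(ζ : ℂ)‖ ^ p)) := by gcongr
      _ = _ := by ring
  have hnear : ∀ᶠ z : ℂ in 𝓝 (ζ : ℂ), z ≠ 0 ∧ ‖z‖ < 1 :=
    (isOpen_ne.eventually_mem hz0 : ∀ᶠ z : ℂ in 𝓝 (ζ : ℂ), z ≠ 0).and
      ((isOpen_lt continuous_norm continuous_const).mem_nhds hz)
  have tR : Tendsto qR (𝓝 (ζ : ℂ)) (𝓝 (qR ζ)) := by
    refine tendsto_tsum_of_dominated_convergence (hgeo1.mul_left (‖c‖ * B * B)) (fun p => ?_) ?_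
    · exact ((h.analyticAt_jostPlus ha hz0 hz _).continuousAt.tendsto).const_mul _
    · filter_upwards [hnear] with z hz' p using bR z hz'.1 hz'.2 p
  have tL : Tendsto qL (𝓝 (ζ : ℂ)) (𝓝 (qL ζ)) := by
    refine tendsto_tsum_of_dominated_convergence (hgeo.mul_left (‖c⁻¹‖ * B' * B')) (fun p => ?_) ?_
    · exact ((h.analyticAt_jostMinus ha hz0 hz _).continuousAt.tendsto).mul_const _
    · filter_upwards [hnear] with z hz' p using bL z hz'.1 hz'.2 p
  -- the sum of both is `c` times the inverse norming constant
  have hq : qR ζ + qL ζ = c * ((normingConstant a b ζ : ℝ) : ℂ)⁻¹ := by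
    have e : ∀ n, jostMinus a b ζ n * jostPlus a b ζ n =
        c * ((‖jostPlus a b ζ n‖ ^ 2 : ℝ) : ℂ) := fun n => by
      have := Complex.mul_conj (jostPlus a b ζ n)
      rw [conj_jostPlus_ofReal h ha h0 h1.le, Complex.normSq_eq_norm_sq] at this
      rw [hc, ← this]; ring
    rw [← Complex.ofReal_inv, (h.normingConstant_inv ha h0 h1 hD).2]
    simp only [hqR, hqL, e, tsum_mul_left]
    rw [← mul_add]
    push_cast
    rfl
  set lam : ℂ → ℂ := fun z => (z + z⁻¹) / 2 with hlam
  -- Green's formula for the mixed Wronskians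
  have gR : ∀ z : ℂ, z ≠ 0 → ‖z‖ < 1 →
      wronskian a (jostMinus a b ζ) (jostPlus a b z) 0 = -((lam z - lam ζ) * qR z) := by
    intro z hz0' hz'
    have hM := (h.jostMinus_spec ha hz0 hz.le).1
    have hP := (h.jostPlus_spec ha hz0' hz'.le).1
    have hs : Summable fun p : ℕ => jostMinus a b ζ (1 + p) * jostPlus a b z (1 + p) :=
      Summable.of_norm_bounded (hgeo1.mul_left _) (bR z hz0' hz')
    have hMtop : Tendsto (jostMinus a b ζ) atTop (𝓝 0) := by
      have := (h.tendsto_jostPlus ha hz0 hz).const_mul c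
      rw [mul_zero] at this
      exact this.congr fun n => (hc n).symm
    rw [tsum_right_of_wronskian (wronskian_sub hM hP)
      (h.tendsto_zero_right hMtop (h.tendsto_jostPlus ha hz0' hz')) (hs.mul_left _), tsum_mul_left]
  have gL : ∀ z : ℂ, z ≠ 0 → ‖z‖ < 1 →
      wronskian a (jostMinus a b z) (jostPlus a b ζ) 0 = (lam ζ - lam z) * qL z := by
    intro z hz0' hz'
    have hM := (h.jostMinus_spec ha hz0' hz'.le).1
    have hP := (h.jostPlus_spec ha hz0 hz.le).1
    have hs : Summable fun p : ℕ => jostMinus a b z (-p) * jostPlus a b ζ (-p) :=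
      Summable.of_norm_bounded (hgeo.mul_left _) (bL z hz0' hz')
    have hPbot : Tendsto (jostPlus a b ζ) atBot (𝓝 0) := by
      have := (h.tendsto_jostMinus ha hz0 hz).const_mul c⁻¹
      rw [mul_zero] at this
      exact this.congr fun n => (hcinv n).symm
    rw [tsum_left_of_wronskian (wronskian_sub hM hP)
      (h.tendsto_zero_left (h.tendsto_jostMinus ha hz0' hz') hPbot) (hs.mul_left _), tsum_mul_left]
  -- difference quotients
  have dlam : Tendsto (fun z => (lam z - lam ζ) / (z - ζ)) (𝓝[≠] (ζ : ℂ))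
      (𝓝 ((1 - ((ζ : ℂ) ^ 2)⁻¹) / 2)) := by
    have := ((hasDerivAt_id (ζ : ℂ)).add (hasDerivAt_inv hz0)).div_const 2
    rw [← sub_eq_add_neg] at this
    refine (hasDerivAt_iff_tendsto_slope.1 this).congr fun z => ?_
    rw [slope_def_field]
    rfl
  have dM := fun n => hasDerivAt_iff_tendsto_slope.1
    (h.analyticAt_jostMinus ha hz0 hz n).differentiableAt.hasDerivAt
  have dP : ∀ n, Tendsto (fun z => jostPlus a b z n - jostPlus a b ζ n) (𝓝[≠] (ζ : ℂ)) (𝓝 0) :=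
    fun n => by
    have := ((h.analyticAt_jostPlus ha hz0 hz n).continuousAt.tendsto.mono_left
      (nhdsWithin_le_nhds (s := {(ζ : ℂ)}ᶜ))).sub_const (jostPlus a b ζ n)
    rwa [sub_self] at this
  have dW : Tendsto (fun z => (a 0 : ℂ) *
      (slope (fun w => jostMinus a b w 0) ζ z * (jostPlus a b z 1 - jostPlus a b ζ 1) -
       slope (fun w => jostMinus a b w 1) ζ z * (jostPlus a b z 0 - jostPlus a b ζ 0)))
      (𝓝[≠] (ζ : ℂ)) (𝓝 0) := by
    have := (((dM 0).mul (dP 1)).sub ((dM 1).mul (dP 0))).const_mul (a 0 : ℂ)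
    simpa using this
  have tid : Tendsto (fun z : ℂ => -2 * z) (𝓝[≠] (ζ : ℂ)) (𝓝 (-2 * ζ)) :=
    (tendsto_id.mono_left nhdsWithin_le_nhds).const_mul _
  have main := tid.mul (dW.sub (dlam.mul ((tR.add tL).mono_left nhdsWithin_le_nhds)))
  have hval : -2 * (ζ : ℂ) * (0 - (1 - ((ζ : ℂ) ^ 2)⁻¹) / 2 * (qR ζ + qL ζ)) =
      ((ζ : ℂ) - (ζ : ℂ)⁻¹) * c * ((normingConstant a b ζ : ℝ) : ℂ)⁻¹ := by
    rw [hq]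
    field_simp
    ring
  rw [hval] at main
  refine main.congr' ?_
  filter_upwards [hnear.filter_mono nhdsWithin_le_nhds, self_mem_nhdsWithin] with z hz' hne
  have hne' : z - ζ ≠ 0 := sub_ne_zero.2 hne
  have eR := gR z hz'.1 hz'.2
  have eL := gL z hz'.1 hz'.2
  have e0 : wronskian a (jostMinus a b ζ) (jostPlus a b ζ) 0 = 0 := by
    simp only [wronskian, hc]; ring
  rw [h.jostDet_eq ha hz'.1 hz'.2.le 0, slope_def_field, slope_def_field]
  simp only [wronskian, zero_add] at eR eL e0 ⊢
  field_simp
  linear_combination z * (eR + eL - e0)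

end norming

/-! ### The transmission and reflection coefficients -/

/-- The points of the unit circle near `z`, other than `z` itself. -/
noncomputable def circleFilter (z : ℂ) : Filter ℂ := 𝓝[≠] z ⊓ 𝓟 (Metric.sphere 0 1)

theorem circleFilter_neBot {z : ℂ} (hz : ‖z‖ = 1) : (circleFilter z).NeBot := by
  have h1 : IsPreconnected (Metric.sphere (0 : ℂ) 1) :=
    isPreconnected_sphere (by rw [Complex.rank_real_complex]; norm_num) 0 1
  have h2 : (Metric.sphere (0 : ℂ) 1).Nontrivial :=
    ⟨1, by simp, -1, by simp, by norm_num⟩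
  exact h1.preperfect_of_nontrivial h2 z (mem_sphere_zero_iff_norm.2 hz)

theorem eventually_circleFilter (z : ℂ) :
    ∀ᶠ w in circleFilter z, ‖w‖ = 1 ∧ 1 - w ^ 2 ≠ 0 ∧ w ≠ z := by
  have h1 : ∀ᶠ w in circleFilter z, w ∈ Metric.sphere (0 : ℂ) 1 :=
    mem_inf_of_right (mem_principal_self _)
  have h2 : ∀ᶠ w in circleFilter z, w ∈ ({z}ᶜ : Set ℂ) := mem_inf_of_left self_mem_nhdsWithin
  have h3 : ∀ᶠ w in circleFilter z, w ∈ ({1, -1}ᶜ : Set ℂ) :=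
    mem_inf_of_left (nhdsNE_le_cofinite z ((Set.toFinite _).compl_mem_cofinite))
  filter_upwards [h1, h2, h3] with w hw1 hw2 hw3
  simp only [Set.mem_compl_iff, Set.mem_insert_iff, Set.mem_singleton_iff, not_or] at hw3
  exact ⟨mem_sphere_zero_iff_norm.1 hw1, one_sub_sq_ne_zero hw3.1 hw3.2, hw2⟩

theorem circleFilter_le (z : ℂ) : circleFilter z ≤ 𝓝[Metric.sphere 0 1] z :=
  inf_le_inf_right _ nhdsWithin_le_nhds

/-- Continuous functions on the unit circle that agree off `±1` agree. -/
theorem eq_on_circle {f g : ℂ → ℂ} (hf : ContinuousOn f (Metric.sphere 0 1))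
    (hg : ContinuousOn g (Metric.sphere 0 1))
    (hfg : ∀ z : ℂ, ‖z‖ = 1 → 1 - z ^ 2 ≠ 0 → f z = g z) {z : ℂ} (hz : ‖z‖ = 1) : f z = g z := by
  have := circleFilter_neBot hz
  have hz' : z ∈ Metric.sphere (0 : ℂ) 1 := mem_sphere_zero_iff_norm.2 hz
  have h1 : Tendsto f (circleFilter z) (𝓝 (f z)) := (hf z hz').mono_left (circleFilter_le z)
  have h2 : Tendsto g (circleFilter z) (𝓝 (g z)) := (hg z hz').mono_left (circleFilter_le z)
  refine tendsto_nhds_unique h1 (h2.congr' ?_)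
  filter_upwards [eventually_circleFilter z] with w hw using (hfg w hw.1 hw.2.1).symm

section transmission

variable {a b : ℤ → ℝ} {z : ℂ}

open Classical in
/-- The transmission coefficient as a quotient. A zero of the Jost determinant on the unit circle
can only occur at `±1`, where it is simple; there the value is the limit of the quotient. -/
noncomputable def transFun (a b : ℤ → ℝ) (z : ℂ) : ℂ :=
  if ‖z‖ = 1 ∧ jostDet a b z = 0 then
    -(2 * z) / derivWithin (jostDet a b) (Metric.closedBall 0 1) z
  else (1 - z ^ 2) / jostDet a b z

theorem transFun_of_ne_zero (hD : jostDet a b z ≠ 0) :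
    transFun a b z = (1 - z ^ 2) / jostDet a b z :=
  if_neg fun h => hD h.2

theorem transFun_of_norm_lt_one (hz : ‖z‖ < 1) :
    transFun a b z = (1 - z ^ 2) / jostDet a b z :=
  if_neg fun h => hz.ne h.1

theorem HasDecay.sq_eq_one_of_jostDet_eq_zero (h : HasDecay a b) (ha : ∀ n, 0 < a n)
    (hz : ‖z‖ = 1) (hD : jostDet a b z = 0) : z ^ 2 = 1 := by
  by_contra hne
  exact h.jostDet_ne_zero_of_norm_eq_one ha hz (sub_ne_zero.2 (Ne.symm hne)) hD

theorem HasDecay.tendsto_slope_jostDet (h : HasDecay a b) (hz : ‖z‖ = 1)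
    (hD : jostDet a b z = 0) :
    Tendsto (fun w => jostDet a b w / (w - z)) (𝓝[Metric.closedBall 0 1 \ {z}] z)
      (𝓝 (derivWithin (jostDet a b) (Metric.closedBall 0 1) z)) := by
  have h1 := (h.differentiableOn_jostDet z (by simp [hz])).hasDerivWithinAt
  rw [hasDerivWithinAt_iff_tendsto_slope] at h1
  refine h1.congr fun w => ?_
  rw [slope_def_field, hD, sub_zero]

/-- Zeros of the Jost determinant on the unit circle are simple, because `|1 - z²|` is a lower
bound for the determinant there. -/
theorem HasDecay.derivWithin_jostDet_ne_zero (h : HasDecay a b) (ha : ∀ n, 0 < a n)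
    (hz : ‖z‖ = 1) (hD : jostDet a b z = 0) :
    derivWithin (jostDet a b) (Metric.closedBall 0 1) z ≠ 0 := by
  have hsq := h.sq_eq_one_of_jostDet_eq_zero ha hz hD
  have := circleFilter_neBot hz
  have hle : circleFilter z ≤ 𝓝[Metric.closedBall 0 1 \ {z}] z := by
    rw [circleFilter, nhdsWithin, nhdsWithin, inf_assoc, inf_principal]
    refine inf_le_inf_left _ (principal_mono.2 fun w hw => ⟨?_, hw.1⟩)
    exact Metric.sphere_subset_closedBall hw.2
  have h1 := ((h.tendsto_slope_jostDet hz hD).mono_left hle).norm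
  have h2 : Tendsto (fun w : ℂ => ‖w + z‖) (circleFilter z) (𝓝 ‖z + z‖) := by
    have : Continuous fun w : ℂ => ‖w + z‖ := by fun_prop
    exact (this.tendsto z).mono_left (inf_le_left.trans nhdsWithin_le_nhds)
  have h3 := le_of_tendsto_of_tendsto h2 h1 (by
    filter_upwards [eventually_circleFilter z] with w hw
    have h4 := h.norm_one_sub_sq_le ha hw.1
    have h5 : 1 - w ^ 2 = -((w + z) * (w - z)) := by rw [← hsq]; ring
    rw [h5, norm_neg, norm_mul] at h4
    rw [norm_div]
    exact (le_div_iff₀ (norm_pos_iff.2 (sub_ne_zero.2 hw.2.2))).2 h4)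
  rw [← two_mul, norm_mul, hz] at h3
  intro h0
  rw [h0] at h3
  norm_num at h3

/-- The transmission coefficient is continuous up to the unit circle, away from its poles. -/
theorem HasDecay.continuousWithinAt_transFun (h : HasDecay a b) (ha : ∀ n, 0 < a n)
    (hz : ‖z‖ ≤ 1) (hD : jostDet a b z ≠ 0 ∨ ‖z‖ = 1) :
    ContinuousWithinAt (transFun a b) (Metric.closedBall 0 1) z := by
  have hzmem : z ∈ Metric.closedBall (0 : ℂ) 1 := mem_closedBall_zero_iff.2 hz
  by_cases hD0 : jostDet a b z = 0
  · have hz1 : ‖z‖ = 1 := hD.resolve_left (not_not.2 hD0)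
    have hsq := h.sq_eq_one_of_jostDet_eq_zero ha hz1 hD0
    have hd := h.derivWithin_jostDet_ne_zero ha hz1 hD0
    have hs := h.tendsto_slope_jostDet hz1 hD0
    rw [← continuousWithinAt_sdiff_self]
    have h1 : Tendsto (fun w : ℂ => -(w + z)) (𝓝[Metric.closedBall 0 1 \ {z}] z)
        (𝓝 (-(z + z))) := by
      have : Continuous fun w : ℂ => -(w + z) := by fun_prop
      exact (this.tendsto z).mono_left nhdsWithin_le_nhds
    have h2 := h1.div hs hd
    have h3 : transFun a b z = -(z + z) / derivWithin (jostDet a b) (Metric.closedBall 0 1) z := by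
      rw [transFun, if_pos ⟨hz1, hD0⟩]; ring
    rw [ContinuousWithinAt, h3]
    refine h2.congr' ?_
    filter_upwards [hs.eventually_ne hd, self_mem_nhdsWithin] with w hw hw2
    have hwz : w - z ≠ 0 := sub_ne_zero.2 hw2.2
    have hw0 : jostDet a b w ≠ 0 := by
      intro h0; rw [h0, zero_div] at hw; exact hw rfl
    have e : 1 - w ^ 2 = -(w + z) * (w - z) := by rw [← hsq]; ring
    rw [transFun_of_ne_zero hw0, e]
    simp only [Pi.div_apply]
    field_simp
  · have hc := (h.differentiableOn_jostDet z hzmem).continuousWithinAt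
    have h1 : ContinuousWithinAt (fun w => (1 - w ^ 2) / jostDet a b w)
        (Metric.closedBall 0 1) z := ContinuousWithinAt.div (by fun_prop) hc hD0
    refine h1.congr_of_eventuallyEq ?_ (transFun_of_ne_zero hD0)
    filter_upwards [hc.eventually_ne hD0] with w hw using transFun_of_ne_zero hw

theorem HasDecay.eventually_jostDet_ne_zero (h : HasDecay a b) (ha : ∀ n, 0 < a n)
    (hz : ‖z‖ ≤ 1) : ∀ᶠ w in 𝓝[Metric.closedBall 0 1 \ {z}] z, jostDet a b w ≠ 0 := by
  rcases hz.lt_or_eq with hlt | heq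
  · have hball : AnalyticOnNhd ℂ (jostDet a b) (Metric.ball 0 1) := fun w hw =>
      analyticAt_of_norm_lt_one h.differentiableOn_jostDet (mem_ball_zero_iff.1 hw)
    rcases (hball z (mem_ball_zero_iff.2 hlt)).eventually_eq_zero_or_eventually_ne_zero with h1 | h1
    · have := hball.eqOn_zero_of_preconnected_of_eventuallyEq_zero
        (convex_ball (0 : ℂ) 1).isPreconnected (mem_ball_zero_iff.2 hlt) h1
      exact absurd (this (by simp)) (h.jostDet_zero_ne_zero ha)
    · exact h1.filter_mono (nhdsWithin_mono _ fun w hw => hw.2)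
  · by_cases hD : jostDet a b z = 0
    · filter_upwards [(h.tendsto_slope_jostDet heq hD).eventually_ne
        (h.derivWithin_jostDet_ne_zero ha heq hD)] with w hw h0
      rw [h0, zero_div] at hw
      exact hw rfl
    · have hc := (h.differentiableOn_jostDet z (mem_closedBall_zero_iff.2 hz)).continuousWithinAt
      exact (hc.eventually_ne hD).filter_mono (nhdsWithin_mono _ Set.sdiff_subset)

/-- Zeros are isolated, also at the boundary, and the closed disc is compact. -/
theorem HasDecay.finite_zeros (h : HasDecay a b) (ha : ∀ n, 0 < a n) :
    {z : ℂ | ‖z‖ ≤ 1 ∧ jostDet a b z = 0}.Finite := by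
  by_contra hinf
  obtain ⟨z, hz, hacc⟩ := Set.Infinite.exists_accPt_of_subset_isCompact hinf
    (isCompact_closedBall (0 : ℂ) 1) fun w hw => mem_closedBall_zero_iff.2 hw.1
  have h1 := h.eventually_jostDet_ne_zero ha (mem_closedBall_zero_iff.1 hz)
  rw [accPt_iff_frequently_nhdsNE] at hacc
  rw [eventually_nhdsWithin_iff] at h1
  refine hacc ?_
  filter_upwards [h1.filter_mono nhdsWithin_le_nhds, self_mem_nhdsWithin] with w hw hne hmem
  exact hw ⟨mem_closedBall_zero_iff.2 hmem.1, hne⟩ hmem.2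

/-- The poles of the transmission coefficient stay away from the unit circle. -/
theorem HasDecay.exists_radius (h : HasDecay a b) (ha : ∀ n, 0 < a n) :
    ∃ r : ℝ, 0 ≤ r ∧ r < 1 ∧ ∀ z : ℂ, ‖z‖ < 1 → jostDet a b z = 0 → ‖z‖ ≤ r := by
  have hfin : {z : ℂ | ‖z‖ < 1 ∧ jostDet a b z = 0}.Finite :=
    (h.finite_zeros ha).subset fun z hz => ⟨hz.1.le, hz.2⟩
  rcases Set.eq_empty_or_nonempty {z : ℂ | ‖z‖ < 1 ∧ jostDet a b z = 0} with he | hne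
  · exact ⟨0, le_rfl, one_pos, fun z h1 h2 =>
      absurd ⟨h1, h2⟩ (Set.eq_empty_iff_forall_notMem.1 he z)⟩
  · obtain ⟨w, hw, hmax⟩ := Set.exists_max_image _ norm hfin hne
    exact ⟨‖w‖, norm_nonneg _, hw.1, fun z h1 h2 => hmax z ⟨h1, h2⟩⟩

theorem HasDecay.meromorphicNFOn_transFun (h : HasDecay a b) :
    MeromorphicNFOn (transFun a b) (Metric.ball 0 1) := by
  intro z hz
  have hz' := mem_ball_zero_iff.1 hz
  have hD := analyticAt_of_norm_lt_one h.differentiableOn_jostDet hz'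
  have h1 : MeromorphicNFAt ((fun w : ℂ => 1 - w ^ 2) * (jostDet a b)⁻¹) z := by
    rw [meromorphicNFAt_mul_iff_right (by fun_prop)]
    · exact hD.meromorphicNFAt.inv
    · refine one_sub_sq_ne_zero ?_ ?_ <;> rintro rfl <;> simp at hz'
  refine (meromorphicNFAt_congr ?_).2 h1
  filter_upwards [Metric.isOpen_ball.mem_nhds hz] with w hw
  rw [transFun_of_norm_lt_one (mem_ball_zero_iff.1 hw), div_eq_mul_inv]
  rfl

theorem HasDecay.continuousOn_transFun_sphere (h : HasDecay a b) (ha : ∀ n, 0 < a n) :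
    ContinuousOn (transFun a b) (Metric.sphere 0 1) := fun _ hz =>
  (h.continuousWithinAt_transFun ha (mem_sphere_zero_iff_norm.1 hz).le
    (Or.inr (mem_sphere_zero_iff_norm.1 hz))).mono Metric.sphere_subset_closedBall

theorem HasDecay.continuousOn_jostPlus_sphere (h : HasDecay a b) (ha : ∀ n, 0 < a n) (n : ℤ) :
    ContinuousOn (fun z => jostPlus a b z n) (Metric.sphere 0 1) := by
  have h1 := ((h.differentiableOn_jostFun n).continuousOn).mono
    (Metric.sphere_subset_closedBall (x := (0 : ℂ)) (ε := 1))
  have hne : ∀ z ∈ Metric.sphere (0 : ℂ) 1, z ≠ 0 := fun z hz =>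
    ne_zero_of_norm_eq_one (mem_sphere_zero_iff_norm.1 hz)
  have h2 : ContinuousOn (fun z : ℂ => z ^ n) (Metric.sphere 0 1) :=
    continuousOn_id.zpow₀ n fun z hz => Or.inl (hne z hz)
  exact (h2.mul h1).congr fun z hz =>
    h.jostPlus_apply ha (hne z hz) (mem_sphere_zero_iff_norm.1 hz).le n

theorem HasDecay.continuousOn_jostMinus_sphere (h : HasDecay a b) (ha : ∀ n, 0 < a n) (n : ℤ) :
    ContinuousOn (fun z => jostMinus a b z n) (Metric.sphere 0 1) := by
  refine (h.reflect.continuousOn_jostPlus_sphere (fun _ => ha _) (-n)).congr fun z hz => ?_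
  have hz1 := mem_sphere_zero_iff_norm.1 hz
  simp [h.jostPlus_reflect ha (ne_zero_of_norm_eq_one hz1) hz1.le]

/-- The reflection coefficient: `T ψ₋ - ψ̄₊` is a multiple of `ψ₊`, and the factor is read off by
projecting the values at the sites `0` and `1`. -/
noncomputable def reflFun (a b : ℤ → ℝ) (z : ℂ) : ℂ :=
  ((starRingEnd ℂ) (jostPlus a b z 0) *
      (transFun a b z * jostMinus a b z 0 - (starRingEnd ℂ) (jostPlus a b z 0)) +
    (starRingEnd ℂ) (jostPlus a b z 1) *
      (transFun a b z * jostMinus a b z 1 - (starRingEnd ℂ) (jostPlus a b z 1))) /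
  (((‖jostPlus a b z 0‖ ^ 2 + ‖jostPlus a b z 1‖ ^ 2 : ℝ)) : ℂ)

theorem HasDecay.norm_sq_add_pos (h : HasDecay a b) (ha : ∀ n, 0 < a n) (hz0 : z ≠ 0)
    (hz : ‖z‖ ≤ 1) : 0 < ‖jostPlus a b z 0‖ ^ 2 + ‖jostPlus a b z 1‖ ^ 2 := by
  by_contra hle
  have h0 : ‖jostPlus a b z 0‖ = 0 := by
    by_contra hne
    have : 0 < ‖jostPlus a b z 0‖ := lt_of_le_of_ne (norm_nonneg _) (Ne.symm hne)
    exact hle (by positivity)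
  have h1 : ‖jostPlus a b z 1‖ = 0 := by
    by_contra hne
    have : 0 < ‖jostPlus a b z 1‖ := lt_of_le_of_ne (norm_nonneg _) (Ne.symm hne)
    exact hle (by positivity)
  exact h.jostPlus_ne_zero ha hz0 hz (eq_zero_of_eq_zero ha (h.jostPlus_spec ha hz0 hz).1
    (norm_eq_zero.1 h0) (norm_eq_zero.1 h1))

/-- `T ψ₋ - ψ̄₊` is proportional to `ψ₊`. Off `±1` this is the scattering identity, and continuity
extends it to the whole circle. -/
theorem HasDecay.cross_relation (h : HasDecay a b) (ha : ∀ n, 0 < a n) (hz : ‖z‖ = 1) (n m : ℤ) :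
    (transFun a b z * jostMinus a b z n - (starRingEnd ℂ) (jostPlus a b z n)) * jostPlus a b z m =
    (transFun a b z * jostMinus a b z m - (starRingEnd ℂ) (jostPlus a b z m)) *
      jostPlus a b z n := by
  have hT := h.continuousOn_transFun_sphere ha
  have hP := h.continuousOn_jostPlus_sphere ha
  have hM := h.continuousOn_jostMinus_sphere ha
  have hPc : ∀ n, ContinuousOn (fun z => (starRingEnd ℂ) (jostPlus a b z n))
      (Metric.sphere 0 1) := fun n => Complex.continuous_conj.comp_continuousOn (hP n)
  refine eq_on_circle (((hT.mul (hM n)).sub (hPc n)).mul (hP m))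
    (((hT.mul (hM m)).sub (hPc m)).mul (hP n)) (fun z hz h1 => ?_) hz
  have hz0 := ne_zero_of_norm_eq_one hz
  have hD := h.jostDet_ne_zero_of_norm_eq_one ha hz h1
  have e1 := h.jostDet_eq ha hz0 hz.le 0
  have e2 := h.scattering_identity ha hz n
  have e3 := h.scattering_identity ha hz m
  set W := wronskian a (jostMinus a b z) (jostPlus a b z) 0
  set V := wronskian a (jostMinus a b z) (fun n => (starRingEnd ℂ) (jostPlus a b z n)) 0
  have hW : W ≠ 0 := fun h0 => hD (by rw [e1, h0, mul_zero])
  have hTW : transFun a b z * W = (z - z⁻¹) / 2 := by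
    rw [transFun_of_ne_zero hD, e1]; field_simp; ring
  refine mul_left_cancel₀ hW ?_
  simp only [Pi.mul_apply, Pi.sub_apply]
  linear_combination (jostMinus a b z n * jostPlus a b z m - jostMinus a b z m * jostPlus a b z n)
    * hTW + jostPlus a b z m * e2 - jostPlus a b z n * e3

theorem HasDecay.isScatteringPair (h : HasDecay a b) (ha : ∀ n, 0 < a n) :
    IsScatteringPair a b (transFun a b) (reflFun a b) where
  meromorphic := h.meromorphicNFOn_transFun
  boundary := by
    obtain ⟨r, -, hr, hzero⟩ := h.exists_radius ha
    refine ⟨r, hr, fun z hz => ?_⟩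
    refine (h.continuousWithinAt_transFun ha hz.2 ?_).mono fun w hw => by simpa using hw.2
    rcases hz.2.lt_or_eq with hlt | heq
    · exact Or.inl fun h0 => (hzero z hlt h0).not_gt hz.1
    · exact Or.inr heq
  continuous_reflection := by
    have hT := h.continuousOn_transFun_sphere ha
    have hP := h.continuousOn_jostPlus_sphere ha
    have hM := h.continuousOn_jostMinus_sphere ha
    have hPc : ∀ n, ContinuousOn (fun z => (starRingEnd ℂ) (jostPlus a b z n))
        (Metric.sphere 0 1) := fun n => Complex.continuous_conj.comp_continuousOn (hP n)
    refine (((hPc 0).mul ((hT.mul (hM 0)).sub (hPc 0))).add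
      ((hPc 1).mul ((hT.mul (hM 1)).sub (hPc 1)))).div
      (Complex.continuous_ofReal.comp_continuousOn
        (((hP 0).norm.pow 2).add ((hP 1).norm.pow 2))) fun z hz => ?_
    have hz1 := mem_sphere_zero_iff_norm.1 hz
    exact Complex.ofReal_ne_zero.2
      (h.norm_sq_add_pos ha (ne_zero_of_norm_eq_one hz1) hz1.le).ne'
  relation z hz n := by
    have hN := Complex.ofReal_ne_zero.2
      (h.norm_sq_add_pos ha (ne_zero_of_norm_eq_one hz) hz.le).ne'
    have e0 := h.cross_relation ha hz 0 n
    have e1 := h.cross_relation ha hz 1 n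
    have hsq : ∀ w : ℂ, ((‖w‖ : ℂ)) ^ 2 = (starRingEnd ℂ) w * w := fun w => by
      rw [mul_comm, Complex.mul_conj, Complex.normSq_eq_norm_sq]; push_cast; rfl
    rw [← sub_eq_iff_eq_add', reflFun, div_mul_eq_mul_div, eq_div_iff hN]
    push_cast
    rw [hsq, hsq]
    linear_combination -(starRingEnd ℂ) (jostPlus a b z 0) * e0 -
      (starRingEnd ℂ) (jostPlus a b z 1) * e1

/-- Uniqueness at the boundary: a function holomorphic in an annulus that extends continuously by
zero to the outer circle vanishes. The maximum principle for `zᵏ f(z)`, `k → ∞`, shows this. -/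
theorem eq_zero_of_boundary_zero {f : ℂ → ℂ} {r : ℝ} (hr0 : 0 ≤ r)
    (hf : ContinuousOn f {z | r < ‖z‖ ∧ ‖z‖ ≤ 1})
    (hd : ∀ z : ℂ, r < ‖z‖ → ‖z‖ < 1 → DifferentiableAt ℂ f z)
    (h0 : ∀ z : ℂ, ‖z‖ = 1 → f z = 0) {z : ℂ} (hz : r < ‖z‖) (hz1 : ‖z‖ < 1) : f z = 0 := by
  obtain ⟨ρ, hrρ, hρz⟩ := exists_between hz
  have hρ0 : 0 < ρ := hr0.trans_lt hrρ
  set U : Set ℂ := {w | ρ < ‖w‖ ∧ ‖w‖ < 1} with hU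
  have hUo : IsOpen U := (isOpen_lt continuous_const continuous_norm).inter
    (isOpen_lt continuous_norm continuous_const)
  have hUc : closure U ⊆ {w | ρ ≤ ‖w‖ ∧ ‖w‖ ≤ 1} :=
    closure_minimal (fun w hw => ⟨hw.1.le, hw.2.le⟩)
      ((isClosed_le continuous_const continuous_norm).inter
        (isClosed_le continuous_norm continuous_const))
  have hUb : Bornology.IsBounded U := Metric.isBounded_ball.subset
    (fun w hw => mem_ball_zero_iff.2 hw.2 : U ⊆ Metric.ball 0 1)
  have hcl : ContinuousOn f (closure U) :=
    hf.mono fun w hw => ⟨hrρ.trans_le (hUc hw).1, (hUc hw).2⟩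
  have hcompact : IsCompact (closure U) := Metric.isCompact_of_isClosed_isBounded isClosed_closure
    hUb.closure
  obtain ⟨M, hM⟩ := hcompact.exists_bound_of_continuousOn hcl
  have hzU : z ∈ U := ⟨hρz, hz1⟩
  have hM0 : 0 ≤ M := (norm_nonneg _).trans (hM z (subset_closure hzU))
  have key : ∀ k : ℕ, ‖f z‖ ≤ M * (ρ / ‖z‖) ^ k := by
    intro k
    have hdc : DiffContOnCl ℂ (fun w => w ^ k * f w) U := by
      constructor
      · intro w hw
        exact ((differentiableAt_pow k).mul
          (hd w (hrρ.trans hw.1) hw.2)).differentiableWithinAt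
      · exact (continuousOn_pow k).mul hcl
    have h1 := Complex.norm_le_of_forall_mem_frontier_norm_le hUb hdc (C := ρ ^ k * M)
      (fun w hw => ?_) (subset_closure hzU)
    · rw [norm_mul, norm_pow] at h1
      have hzpos : 0 < ‖z‖ ^ k := pow_pos (hρ0.trans hρz) k
      rw [div_pow, mul_div_assoc', le_div_iff₀ hzpos]
      linarith
    · rw [hUo.frontier_eq] at hw
      have hw1 := hUc hw.1
      rw [norm_mul, norm_pow]
      rcases hw1.2.lt_or_eq with hlt | heq
      · have : ‖w‖ = ρ := le_antisymm (not_lt.1 fun hlt' => hw.2 ⟨hlt', hlt⟩) hw1.1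
        rw [this]
        gcongr
        exact hM w hw.1
      · rw [h0 w heq, norm_zero, mul_zero]
        positivity
  have hlim : Tendsto (fun k : ℕ => M * (ρ / ‖z‖) ^ k) atTop (𝓝 (M * 0)) :=
    (tendsto_pow_atTop_nhds_zero_of_lt_one (by positivity)
      ((div_lt_one (hρ0.trans hρz)).2 hρz)).const_mul M
  rw [mul_zero] at hlim
  exact norm_le_zero_iff.1 (ge_of_tendsto' hlim key)

theorem analyticAt_of_meromorphicNFAt {f : ℂ → ℂ} (hf : MeromorphicNFAt f z)
    (hc : ContinuousAt f z) : AnalyticAt ℂ f z :=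
  hf.meromorphicOrderAt_nonneg_iff_analyticAt.1
    ((tendsto_nhds_iff_meromorphicOrderAt_nonneg hf.meromorphicAt).1
      ⟨_, hc.tendsto.mono_left nhdsWithin_le_nhds⟩)

/-- On the unit circle off `±1` the scattering relation determines `T`, by taking the Wronskian
with `ψ₊`. -/
theorem IsScatteringPair.mul_wronskian {T R : ℂ → ℂ} (hTR : IsScatteringPair a b T R)
    (h : HasDecay a b) (ha : ∀ n, 0 < a n) (hz : ‖z‖ = 1) :
    T z * wronskian a (jostMinus a b z) (jostPlus a b z) 0 = (z - z⁻¹) / 2 := by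
  rw [← h.wronskian_conj_jostPlus ha hz 0]
  have e0 := hTR.relation z hz 0
  have e1 := hTR.relation z hz 1
  simp only [wronskian, zero_add]
  linear_combination (a 0 : ℂ) * (jostPlus a b z 1 * e0 - jostPlus a b z 0 * e1)

/-- The relation fixes `T` on the circle off `±1`, continuity at `±1`, the maximum principle in an
annulus and the identity theorem in the disc; the normal form excludes exceptional values. -/
theorem IsScatteringPair.unique {T R T' R' : ℂ → ℂ} (h : HasDecay a b) (ha : ∀ n, 0 < a n)
    (h1 : IsScatteringPair a b T R) (h2 : IsScatteringPair a b T' R') :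
    (∀ z : ℂ, ‖z‖ ≤ 1 → T z = T' z) ∧ ∀ z : ℂ, ‖z‖ = 1 → R z = R' z := by
  obtain ⟨r₁, hr₁, hc₁⟩ := h1.boundary
  obtain ⟨r₂, hr₂, hc₂⟩ := h2.boundary
  set r := max (max r₁ r₂) 0 with hr
  have hr0 : 0 ≤ r := le_max_right _ _
  have hrlt : r < 1 := max_lt (max_lt hr₁ hr₂) one_pos
  have hr1 : r₁ ≤ r := (le_max_left _ _).trans (le_max_left _ _)
  have hr2 : r₂ ≤ r := (le_max_right _ _).trans (le_max_left _ _)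
  have hc₁' : ContinuousOn T {z | r < ‖z‖ ∧ ‖z‖ ≤ 1} :=
    hc₁.mono fun z hz => ⟨hr1.trans_lt hz.1, hz.2⟩
  have hc₂' : ContinuousOn T' {z | r < ‖z‖ ∧ ‖z‖ ≤ 1} :=
    hc₂.mono fun z hz => ⟨hr2.trans_lt hz.1, hz.2⟩
  have hsub : Metric.sphere (0 : ℂ) 1 ⊆ {z | r < ‖z‖ ∧ ‖z‖ ≤ 1} := fun z hz => by
    rw [mem_sphere_zero_iff_norm] at hz
    exact ⟨by rw [hz]; exact hrlt, hz.le⟩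
  have hcircle : ∀ z : ℂ, ‖z‖ = 1 → T z = T' z := fun z hz => by
    refine eq_on_circle (hc₁'.mono hsub) (hc₂'.mono hsub) (fun z hz hne => ?_) hz
    have hD := h.jostDet_ne_zero_of_norm_eq_one ha hz hne
    rw [h.jostDet_eq ha (ne_zero_of_norm_eq_one hz) hz.le 0] at hD
    have hW := (mul_ne_zero_iff.1 hD).2
    exact mul_right_cancel₀ hW ((h1.mul_wronskian h ha hz).trans (h2.mul_wronskian h ha hz).symm)
  have hann : ∀ z : ℂ, r < ‖z‖ → ‖z‖ < 1 →
      {z : ℂ | r < ‖z‖ ∧ ‖z‖ ≤ 1} ∈ 𝓝 z := fun z hz hz1 => by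
    filter_upwards [(isOpen_lt continuous_const continuous_norm).mem_nhds hz,
      (isOpen_lt continuous_norm continuous_const).mem_nhds hz1] with w hw hw1 using ⟨hw, hw1.le⟩
  have hannulus : ∀ z : ℂ, r < ‖z‖ → ‖z‖ < 1 → T z - T' z = 0 := fun z hz hz1 => by
    refine eq_zero_of_boundary_zero (f := fun z => T z - T' z) hr0 (hc₁'.sub hc₂')
      (fun w hw hw1 => ?_) (fun w hw => sub_eq_zero.2 (hcircle w hw)) hz hz1
    have hw' := mem_ball_zero_iff.2 hw1
    exact ((analyticAt_of_meromorphicNFAt (h1.meromorphic hw')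
        (hc₁'.continuousAt (hann w hw hw1))).differentiableAt).sub
      ((analyticAt_of_meromorphicNFAt (h2.meromorphic hw')
        (hc₂'.continuousAt (hann w hw hw1))).differentiableAt)
  have hdisc : ∀ z : ℂ, ‖z‖ < 1 → T z = T' z := fun z hz => by
    obtain ⟨x, hx, hx1⟩ := exists_between hrlt
    have hx0 : ‖(x : ℂ)‖ = x := by
      rw [Complex.norm_real, Real.norm_eq_abs, abs_of_nonneg (hr0.trans hx.le)]
    have hmero : MeromorphicOn (fun z => T z - T' z) (Metric.ball 0 1) := fun w hw =>
      (h1.meromorphic hw).meromorphicAt.sub (h2.meromorphic hw).meromorphicAt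
    have htop : meromorphicOrderAt (fun z => T z - T' z) (x : ℂ) = ⊤ := by
      rw [meromorphicOrderAt_eq_top_iff]
      refine Filter.Eventually.filter_mono nhdsWithin_le_nhds ?_
      filter_upwards [(isOpen_lt continuous_const continuous_norm).mem_nhds
        (show r < ‖(x : ℂ)‖ by rwa [hx0]),
        (isOpen_lt continuous_norm continuous_const).mem_nhds
        (show ‖(x : ℂ)‖ < 1 by rwa [hx0])] with w hw hw1 using hannulus w hw hw1
    have hz' := mem_ball_zero_iff.2 hz
    have htop' : meromorphicOrderAt (fun z => T z - T' z) z = ⊤ := by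
      by_contra hne
      exact hmero.meromorphicOrderAt_ne_top_of_isPreconnected
        (convex_ball (0 : ℂ) 1).isPreconnected hz' (mem_ball_zero_iff.2 (by rwa [hx0])) hne htop
    rw [meromorphicOrderAt_eq_top_iff] at htop'
    have heq : T =ᶠ[𝓝[≠] z] T' := htop'.mono fun w hw => sub_eq_zero.1 hw
    exact (((h1.meromorphic hz').eventuallyEq_nhdsNE_iff_eventuallyEq_nhds
      (h2.meromorphic hz')).1 heq).eq_of_nhds
  refine ⟨fun z hz => hz.lt_or_eq.elim (hdisc z) (hcircle z), fun z hz => ?_⟩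
  obtain ⟨n, hn⟩ := Function.ne_iff.1 (h.jostPlus_ne_zero ha (ne_zero_of_norm_eq_one hz) hz.le)
  have e1 := h1.relation z hz n
  have e2 := h2.relation z hz n
  rw [hcircle z hz, e2] at e1
  exact mul_right_cancel₀ hn (add_left_cancel e1).symm

theorem HasDecay.scatteringPair_spec (h : HasDecay a b) (ha : ∀ n, 0 < a n) :
    IsScatteringPair a b (transmission a b) (reflection a b) :=
  Classical.epsilon_spec (p := fun p : (ℂ → ℂ) × (ℂ → ℂ) => IsScatteringPair a b p.1 p.2)
    ⟨(transFun a b, reflFun a b), h.isScatteringPair ha⟩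

theorem HasDecay.transmission_eq (h : HasDecay a b) (ha : ∀ n, 0 < a n) (hz : ‖z‖ ≤ 1) :
    transmission a b z = transFun a b z :=
  (IsScatteringPair.unique h ha (h.scatteringPair_spec ha) (h.isScatteringPair ha)).1 z hz

end transmission

/-! ### Persistence of decay under the Toda flow -/

/-- Finite speed of propagation: if the rate of change of `w n` is controlled by `w` at the
neighbouring sites, then a majorant of the initial values whose neighbouring terms are comparable
remains one, up to a factor depending on time. Induction on `p` shows the bound with the extra term
`M (L s)ᵖ / p!`, which tends to zero. -/
theorem norm_le_mul_exp_of_propagation {E : Type*} [NormedAddCommGroup E] [NormedSpace ℝ E]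
    {w w' : ℤ → ℝ → E} {v : ℤ → ℝ} {S M κ q : ℝ} (hκ : 0 ≤ κ) (hq : 1 ≤ q)
    (hv0 : ∀ n, 0 ≤ v n) (hv1 : ∀ n, v (n + 1) ≤ q * v n) (hv2 : ∀ n, v (n - 1) ≤ q * v n)
    (hd : ∀ n s, HasDerivAt (w n) (w' n s) s)
    (hw' : ∀ n, ∀ s ∈ Set.Icc 0 S, ‖w' n s‖ ≤ κ * (‖w (n - 1) s‖ + ‖w n s‖ + ‖w (n + 1) s‖))
    (hM : ∀ n, ∀ s ∈ Set.Icc 0 S, ‖w n s‖ ≤ M) (h0 : ∀ n, ‖w n 0‖ ≤ v n) (n : ℤ) {s : ℝ}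
    (hs : s ∈ Set.Icc 0 S) : ‖w n s‖ ≤ v n * Real.exp (κ * (3 * q) * s) := by
  set L := κ * (3 * q) with hL
  have hL0 : 0 ≤ L := by positivity
  have hM0 : 0 ≤ M := (norm_nonneg _).trans (hM n s hs)
  have key : ∀ (p : ℕ) (n : ℤ), ∀ s ∈ Set.Icc 0 S,
      ‖w n s‖ ≤ v n * Real.exp (L * s) + M * ((L * s) ^ p / p.factorial) := by
    intro p
    induction p with
    | zero =>
      intro n s hs
      have := mul_nonneg (hv0 n) (Real.exp_pos (L * s)).le
      have := hM n s hs
      simp only [pow_zero, Nat.factorial_zero, Nat.cast_one, div_one, mul_one]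
      linarith
    | succ p ih =>
      intro n s hs
      have hB : ∀ x, HasDerivAt
          (fun s => v n * Real.exp (L * s) + M * ((L * s) ^ (p + 1) / (p + 1).factorial))
          (L * (v n * Real.exp (L * x) + M * ((L * x) ^ p / p.factorial))) x := by
        intro x
        have e1 : HasDerivAt (fun s => L * s) L x := by simpa using (hasDerivAt_id x).const_mul L
        have e2 := (e1.exp.const_mul (v n)).add
          (((e1.pow (p + 1)).div_const ((p + 1).factorial : ℝ)).const_mul M)
        refine e2.congr_deriv ?_
        rw [Nat.factorial_succ]
        push_cast
        have : (p.factorial : ℝ) ≠ 0 := by positivity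
        have : (p : ℝ) + 1 ≠ 0 := by positivity
        field_simp
      refine image_norm_le_of_norm_deriv_right_le_deriv_boundary'
        (f' := w' n) (fun x _ => (hd n x).continuousAt.continuousWithinAt)
        (fun x _ => (hd n x).hasDerivWithinAt) ?_
        (fun x _ => (hB x).continuousAt.continuousWithinAt)
        (fun x _ => (hB x).hasDerivWithinAt) ?_ hs
      · simpa using h0 n
      · intro x hx
        have hx' : x ∈ Set.Icc 0 S := ⟨hx.1, hx.2.le⟩
        refine (hw' n x hx').trans ?_
        have i0 := ih n x hx'
        have i1 := ih (n - 1) x hx'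
        have i2 := ih (n + 1) x hx'
        set e := Real.exp (L * x) with he
        set f := M * ((L * x) ^ p / p.factorial) with hf
        have hf0 : 0 ≤ f := by
          have := hx'.1
          positivity
        have he0 : 0 < e := Real.exp_pos _
        have j1 : v (n - 1) * e ≤ q * v n * e := by gcongr; exact hv2 n
        have j2 : v (n + 1) * e ≤ q * v n * e := by gcongr; exact hv1 n
        have j0 : v n * e ≤ q * v n * e := by
          have := hv0 n
          gcongr
          exact le_mul_of_one_le_left this hq
        have j3 : f ≤ q * f := le_mul_of_one_le_left hf0 hq
        rw [hL, mul_assoc]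
        gcongr
        linarith
  have hlim : Tendsto (fun p : ℕ => v n * Real.exp (L * s) + M * ((L * s) ^ p / p.factorial))
      atTop (𝓝 (v n * Real.exp (L * s) + M * 0)) :=
    ((FloorSemiring.tendsto_pow_div_factorial_atTop (L * s)).const_mul M).const_add _
  rw [mul_zero, add_zero] at hlim
  exact ge_of_tendsto' hlim fun p => key p n s hs

theorem one_add_abs_le_two_mul {x y : ℝ} (h : |x - y| ≤ 1) : 1 + |x| ≤ 2 * (1 + |y|) := by
  have := abs_sub_abs_le_abs_sub x y
  linarith [abs_nonneg y]

/-- Finite moments give pointwise bounds of every polynomial order. -/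
theorem HasDecay.exists_le_div {a b : ℤ → ℝ} (h : HasDecay a b) (l : ℕ) :
    ∃ K : ℝ, 0 ≤ K ∧ ∀ n : ℤ, |a n - 1 / 2| + |b n| ≤ K / (1 + |(n : ℝ)|) ^ l := by
  set s : ℤ → ℝ := fun n => |a n - 1 / 2| + |b n| with hs
  have hs0 : ∀ n, 0 ≤ s n := fun n => by positivity
  have hle : ∀ l : ℕ, ∀ n : ℤ, |(n : ℝ)| ^ l * s n ≤ ∑' n : ℤ, |(n : ℝ)| ^ l * s n := fun l n =>
    (h l).le_tsum n fun m _ => mul_nonneg (by positivity) (hs0 m)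
  have hS : ∀ l : ℕ, 0 ≤ ∑' n : ℤ, |(n : ℝ)| ^ l * s n := fun l =>
    tsum_nonneg fun n => mul_nonneg (by positivity) (hs0 n)
  refine ⟨2 ^ (l - 1) * ((∑' n : ℤ, |(n : ℝ)| ^ 0 * s n) + ∑' n : ℤ, |(n : ℝ)| ^ l * s n),
    mul_nonneg (by positivity) (add_nonneg (hS 0) (hS l)), fun n => ?_⟩
  rw [le_div_iff₀ (by positivity)]
  have h1 := add_pow_le zero_le_one (abs_nonneg (n : ℝ)) l
  rw [one_pow] at h1
  have h2 := hle 0 n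
  rw [pow_zero, one_mul] at h2
  calc s n * (1 + |(n : ℝ)|) ^ l ≤ s n * (2 ^ (l - 1) * (1 + |(n : ℝ)| ^ l)) := by gcongr
    _ = 2 ^ (l - 1) * (s n + |(n : ℝ)| ^ l * s n) := by ring
    _ ≤ _ := by gcongr; exact hle l n

section toda

variable {a b : ℤ → ℝ → ℝ}

/-- Along a Toda solution the coefficients decay faster than any power, locally uniformly in
time. -/
theorem IsTodaSolution.exists_le_div (hsol : IsTodaSolution a b) {t₀ : ℝ}
    (h : HasDecay (fun n => a n t₀) fun n => b n t₀) (l : ℕ) (τ : ℝ) :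
    ∃ K : ℝ, 0 ≤ K ∧ ∀ t : ℝ, |t| ≤ τ → ∀ n : ℤ,
      |a n t - 1 / 2| ≤ K / (1 + |(n : ℝ)|) ^ l ∧ |b n t| ≤ K / (1 + |(n : ℝ)|) ^ l := by
  obtain ⟨K, hK0, hK⟩ := h.exists_le_div l
  set τ' := max τ |t₀| with hτ'
  obtain ⟨C, hC⟩ := hsol.locallyBounded τ'
  have hC0 : 0 ≤ C := (abs_nonneg _).trans (hC t₀ (le_max_right _ _) 0).1
  set v : ℤ → ℝ := fun n => K / (1 + |(n : ℝ)|) ^ l with hv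
  have hv0 : ∀ n, 0 ≤ v n := fun n => by positivity
  have hvstep : ∀ n m : ℤ, |(n : ℝ) - m| ≤ 1 → v m ≤ 2 ^ l * v n := by
    intro n m hnm
    simp only [hv]
    rw [mul_div_assoc', div_le_div_iff₀ (by positivity) (by positivity)]
    have : (1 + |(n : ℝ)|) ^ l ≤ (2 * (1 + |(m : ℝ)|)) ^ l := by
      gcongr; exact one_add_abs_le_two_mul hnm
    rw [mul_pow] at this
    calc K * (1 + |(n : ℝ)|) ^ l ≤ K * (2 ^ l * (1 + |(m : ℝ)|) ^ l) := by gcongr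
      _ = _ := by ring
  set w : ℤ → ℝ → ℝ × ℝ := fun n t => (a n t - 1 / 2, b n t) with hw
  set w' : ℤ → ℝ → ℝ × ℝ := fun n t =>
    (a n t * (b (n + 1) t - b n t), 2 * (a n t ^ 2 - a (n - 1) t ^ 2)) with hw'
  have hder : ∀ n t, HasDerivAt (w n) (w' n t) t := fun n t =>
    ((hsol.deriv_a n t).sub_const _).prodMk (hsol.deriv_b n t)
  have hbound : ∀ n t, |t| ≤ τ' →
      ‖w' n t‖ ≤ 4 * C * (‖w (n - 1) t‖ + ‖w n t‖ + ‖w (n + 1) t‖) := by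
    intro n t ht
    have x0 : |a n t - 1 / 2| ≤ ‖w n t‖ := norm_fst_le (w n t)
    have y0 : |b n t| ≤ ‖w n t‖ := norm_snd_le (w n t)
    have x1 : |a (n - 1) t - 1 / 2| ≤ ‖w (n - 1) t‖ := norm_fst_le (w (n - 1) t)
    have y1 : |b (n + 1) t| ≤ ‖w (n + 1) t‖ := norm_snd_le (w (n + 1) t)
    have c0 := (hC t ht n).1
    have c1 := (hC t ht (n - 1)).1
    have p0 := norm_nonneg (w n t)
    have p1 := norm_nonneg (w (n - 1) t)
    have p2 := norm_nonneg (w (n + 1) t)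
    refine max_le ?_ ?_
    · rw [Real.norm_eq_abs, abs_mul]
      have : |b (n + 1) t - b n t| ≤ ‖w (n + 1) t‖ + ‖w n t‖ := (abs_sub _ _).trans (by linarith)
      calc _ ≤ C * (‖w (n + 1) t‖ + ‖w n t‖) := by gcongr
        _ ≤ _ := by nlinarith
    · have e : 2 * (a n t ^ 2 - a (n - 1) t ^ 2) =
          2 * ((a n t + a (n - 1) t) * ((a n t - 1 / 2) - (a (n - 1) t - 1 / 2))) := by ring
      change |2 * (a n t ^ 2 - a (n - 1) t ^ 2)| ≤ _
      rw [e, abs_mul, abs_mul, abs_of_pos (two_pos : (0 : ℝ) < 2)]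
      have h1 : |a n t + a (n - 1) t| ≤ C + C := (abs_add_le _ _).trans (by linarith)
      have h2 : |(a n t - 1 / 2) - (a (n - 1) t - 1 / 2)| ≤ ‖w n t‖ + ‖w (n - 1) t‖ :=
        (abs_sub _ _).trans (by linarith)
      calc _ ≤ 2 * ((C + C) * (‖w n t‖ + ‖w (n - 1) t‖)) := by gcongr
        _ ≤ _ := by nlinarith
  have hMb : ∀ n t, |t| ≤ τ' → ‖w n t‖ ≤ C + 1 := by
    intro n t ht
    refine max_le ?_ ?_
    · rw [Real.norm_eq_abs]
      refine (abs_sub _ _).trans ?_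
      have := (hC t ht n).1
      rw [abs_of_pos (by norm_num : (0 : ℝ) < 1 / 2)]
      linarith
    · have := (hC t ht n).2
      rw [Real.norm_eq_abs]; linarith
  have hinit : ∀ n, ‖w n t₀‖ ≤ v n := by
    intro n
    refine le_trans (max_le ?_ ?_) (hK n)
    · rw [Real.norm_eq_abs]; linarith [abs_nonneg (b n t₀)]
    · rw [Real.norm_eq_abs]; linarith [abs_nonneg (a n t₀ - 1 / 2)]
  set L := 4 * C * (3 * 2 ^ l) with hL
  have hL0 : 0 ≤ L := by positivity
  -- forward and backward in time at once, through the sign `σ`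
  have hprop : ∀ σ : ℝ, |σ| = 1 → ∀ s : ℝ, 0 ≤ s → |t₀ + σ * s| ≤ τ' → ∀ n,
      ‖w n (t₀ + σ * s)‖ ≤ v n * Real.exp (L * s) := by
    intro σ hσ s hs hsτ n
    have hin : ∀ x ∈ Set.Icc 0 s, |t₀ + σ * x| ≤ τ' := by
      intro x hx
      have ht₀ : |t₀| ≤ τ' := le_max_right _ _
      rw [abs_le] at ht₀ hsτ ⊢
      rcases abs_eq (zero_le_one' ℝ) |>.1 hσ with h1 | h1 <;> subst h1 <;>
        constructor <;> linarith [hx.1, hx.2, ht₀.1, ht₀.2, hsτ.1, hsτ.2]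
    refine norm_le_mul_exp_of_propagation (w := fun n s => w n (t₀ + σ * s))
      (w' := fun n s => σ • w' n (t₀ + σ * s)) (S := s) (M := C + 1) (by positivity)
      (one_le_pow₀ one_le_two) hv0 (fun n => hvstep _ _ (by simp)) (fun n => hvstep _ _ (by simp))
      (fun n x => ?_) (fun n x hx => ?_) (fun n x hx => hMb n _ (hin x hx))
      (fun n => by simpa using hinit n) n ⟨hs, le_rfl⟩
    · have h1 : HasDerivAt (fun s => t₀ + σ * s) σ x := by
        simpa using ((hasDerivAt_id x).const_mul σ).const_add t₀
      exact (hder n _).scomp x h1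
    · rw [norm_smul, Real.norm_eq_abs, hσ, one_mul]
      exact hbound n _ (hin x hx)
  refine ⟨K * Real.exp (L * (2 * τ')), by positivity, fun t ht n => ?_⟩
  have ht' : |t| ≤ τ' := ht.trans (le_max_left _ _)
  have hw1 : ‖w n t‖ ≤ v n * Real.exp (L * |t - t₀|) := by
    rcases le_total t₀ t with hle | hle
    · have := hprop 1 (by simp) (t - t₀) (by linarith) (by simpa using ht') n
      rw [abs_of_nonneg (by linarith)]
      simpa using this
    · have := hprop (-1) (by simp) (t₀ - t) (by linarith) (by simpa using ht') n
      rw [abs_of_nonpos (by linarith), neg_sub]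
      simpa using this
  have hw2 : ‖w n t‖ ≤ K * Real.exp (L * (2 * τ')) / (1 + |(n : ℝ)|) ^ l := by
    refine hw1.trans ?_
    rw [mul_div_right_comm]
    have : |t - t₀| ≤ 2 * τ' := (abs_sub _ _).trans (by linarith [le_max_right τ |t₀|])
    gcongr
  exact ⟨(norm_fst_le (w n t)).trans hw2, (norm_snd_le (w n t)).trans hw2⟩

/-- All moments remain finite for all times. -/
theorem IsTodaSolution.hasDecay (hsol : IsTodaSolution a b) {t₀ : ℝ}
    (h : HasDecay (fun n => a n t₀) fun n => b n t₀) (t : ℝ) :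
    HasDecay (fun n => a n t) fun n => b n t := by
  intro l
  obtain ⟨K, hK0, hK⟩ := hsol.exists_le_div h (l + 2) |t|
  have hs : Summable fun n : ℤ => 1 / (1 + |(n : ℝ)|) ^ 2 := by
    have h1 : Summable fun p : ℕ => 1 / (1 + |((p : ℤ) : ℝ)|) ^ 2 := by
      refine summable_one_div_add_one_sq.congr fun p => ?_
      simp [add_comm]
    refine Summable.of_nat_of_neg h1 (h1.congr fun p => ?_)
    simp
  refine Summable.of_nonneg_of_le (fun _ => by positivity) (fun n => ?_) (hs.mul_left (2 * K))
  obtain ⟨h1, h2⟩ := hK t le_rfl n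
  have hpos : 0 < 1 + |(n : ℝ)| := by positivity
  have h3 : |(n : ℝ)| ^ l ≤ (1 + |(n : ℝ)|) ^ l := by gcongr; linarith
  calc |(n : ℝ)| ^ l * (|a n t - 1 / 2| + |b n t|)
      ≤ (1 + |(n : ℝ)|) ^ l * (K / (1 + |(n : ℝ)|) ^ (l + 2) + K / (1 + |(n : ℝ)|) ^ (l + 2)) := by
        gcongr
    _ = _ := by rw [pow_add]; field_simp; ring

end toda

/-! ### Linear differential equations on a given time interval -/

/-- The two-sided form of Gronwall's inequality. -/
theorem norm_le_gronwallBound_abs {E : Type*} [NormedAddCommGroup E] [NormedSpace ℝ E]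
    {f f' : ℝ → E} {K ε τ : ℝ} (hd : ∀ t, |t| < τ → HasDerivAt f (f' t) t)
    (hb : ∀ t, |t| < τ → ‖f' t‖ ≤ K * ‖f t‖ + ε) {t : ℝ} (ht : |t| < τ) :
    ‖f t‖ ≤ gronwallBound ‖f 0‖ K ε |t| := by
  have key : ∀ σ : ℝ, |σ| = 1 → ∀ s, 0 ≤ s → s < τ →
      ‖f (σ * s)‖ ≤ gronwallBound ‖f 0‖ K ε s := by
    intro σ hσ s hs hsτ
    have habs : ∀ x ∈ Set.Icc 0 s, |σ * x| < τ := fun x hx => by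
      rw [abs_mul, hσ, one_mul, abs_of_nonneg hx.1]; exact hx.2.trans_lt hsτ
    have hder : ∀ x ∈ Set.Icc 0 s, HasDerivAt (fun s => f (σ * s)) (σ • f' (σ * x)) x := by
      intro x hx
      have h1 : HasDerivAt (fun s => σ * s) σ x := by simpa using (hasDerivAt_id x).const_mul σ
      exact (hd _ (habs x hx)).scomp x h1
    have := norm_le_gronwallBound_of_norm_deriv_right_le (f := fun s => f (σ * s))
      (f' := fun x => σ • f' (σ * x)) (δ := ‖f 0‖) (K := K) (ε := ε) (a := 0) (b := s)
      (fun x hx => (hder x hx).continuousAt.continuousWithinAt)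
      (fun x hx => (hder x ⟨hx.1, hx.2.le⟩).hasDerivWithinAt) (by simp) (fun x hx => by
        rw [norm_smul, Real.norm_eq_abs, hσ, one_mul]
        exact hb _ (habs x ⟨hx.1, hx.2.le⟩)) s ⟨hs, le_rfl⟩
    simpa using this
  rcases le_total 0 t with h | h
  · have := key 1 (by simp) t h (by rwa [abs_of_nonneg h] at ht)
    rw [abs_of_nonneg h]
    simpa using this
  · have := key (-1) (by simp) (-t) (by linarith) (by rwa [abs_of_nonpos h] at ht)
    rw [abs_of_nonpos h]
    simpa using this

/-- Radial truncation at radius `R`. -/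
noncomputable def truncate {E : Type*} [NormedAddCommGroup E] [NormedSpace ℝ E] (R : ℝ) (x : E) :
    E := (R / max R ‖x‖) • x

section truncate

variable {E : Type*} [NormedAddCommGroup E] [NormedSpace ℝ E] {R : ℝ}

theorem truncate_eq_self (hR : 0 < R) {x : E} (hx : ‖x‖ ≤ R) : truncate R x = x := by
  rw [truncate, max_eq_left hx, div_self hR.ne', one_smul]

theorem norm_truncate_le (hR : 0 < R) (x : E) : ‖truncate R x‖ ≤ R := by
  have hp : 0 < max R ‖x‖ := hR.trans_le (le_max_left _ _)
  rw [truncate, norm_smul, Real.norm_of_nonneg (by positivity), div_mul_eq_mul_div,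
    div_le_iff₀ hp]
  gcongr
  exact le_max_right _ _

theorem norm_truncate_le_norm (hR : 0 < R) (x : E) : ‖truncate R x‖ ≤ ‖x‖ := by
  have hp : 0 < max R ‖x‖ := hR.trans_le (le_max_left _ _)
  rw [truncate, norm_smul, Real.norm_of_nonneg (by positivity)]
  exact mul_le_of_le_one_left (norm_nonneg _) ((div_le_one hp).2 (le_max_left _ _))

theorem norm_truncate_sub_le (hR : 0 < R) (x y : E) :
    ‖truncate R x - truncate R y‖ ≤ 2 * ‖x - y‖ := by
  set p := max R ‖x‖ with hp
  set q := max R ‖y‖ with hq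
  have hp0 : 0 < p := hR.trans_le (le_max_left _ _)
  have hq0 : 0 < q := hR.trans_le (le_max_left _ _)
  have e : truncate R x - truncate R y = (R / p) • (x - y) + (R / p - R / q) • y := by
    rw [truncate, truncate, ← hp, ← hq]; module
  have h1 : ‖(R / p) • (x - y)‖ ≤ ‖x - y‖ := by
    rw [norm_smul, Real.norm_of_nonneg (by positivity)]
    exact mul_le_of_le_one_left (norm_nonneg _) ((div_le_one hp0).2 (le_max_left _ _))
  have h2 : ‖(R / p - R / q) • y‖ ≤ ‖x - y‖ := by
    have hpq : |q - p| ≤ ‖x - y‖ := by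
      rw [abs_sub_comm]
      refine (abs_max_sub_max_le_max R ‖x‖ R ‖y‖).trans ?_
      rw [sub_self, abs_zero]
      exact max_le (norm_nonneg _) (abs_norm_sub_norm_le x y)
    have e2 : R / p - R / q = R / p * ((q - p) / q) := by field_simp
    rw [norm_smul, e2, norm_mul, Real.norm_of_nonneg (by positivity : 0 ≤ R / p), norm_div,
      Real.norm_of_nonneg hq0.le, Real.norm_eq_abs]
    calc R / p * (|q - p| / q) * ‖y‖ ≤ 1 * (|q - p| / q) * q := by
          gcongr
          · exact (div_le_one hp0).2 (le_max_left _ _)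
          · exact le_max_right _ _
      _ = |q - p| := by field_simp
      _ ≤ _ := hpq
  rw [e]
  refine (norm_add_le _ _).trans ?_
  linarith

end truncate

/-- A globally Lipschitz vector field fixing the origin has solutions on any given interval. The
Picard-Lindelöf theorem is applied to the field truncated at a radius which, by Gronwall's
inequality, the solution does not reach. -/
theorem exists_solution_of_lipschitz {E : Type*} [NormedAddCommGroup E] [NormedSpace ℝ E]
    [CompleteSpace E] {f : ℝ → E → E} {C τ : ℝ} (hC : 0 ≤ C) (hτ : 0 < τ)
    (hlip : ∀ t, |t| ≤ τ → ∀ x y, ‖f t x - f t y‖ ≤ C * ‖x - y‖) (hzero : ∀ t, f t 0 = 0)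
    (hcont : ∀ x, Continuous fun t => f t x) (x₀ : E) :
    ∃ x : ℝ → E, x 0 = x₀ ∧ ∀ t, |t| < τ → HasDerivAt x (f t (x t)) t := by
  set R : ℝ := ‖x₀‖ * Real.exp (C * τ) + 1 with hR
  have hR0 : 0 < R := by positivity
  have hbd : ∀ t, |t| ≤ τ → ∀ x, ‖f t x‖ ≤ C * ‖x‖ := fun t ht x => by
    simpa [hzero] using hlip t ht x 0
  have hmem : ∀ t ∈ Set.Icc (-τ) τ, |t| ≤ τ := fun t ht => abs_le.2 ht
  have h0mem : (0 : ℝ) ∈ Set.Icc (-τ) τ := ⟨by linarith, hτ.le⟩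
  have hPL : IsPicardLindelof (fun t x => f t (truncate R x)) (⟨0, h0mem⟩ : Set.Icc (-τ) τ) x₀
      ⟨C * R * τ, by positivity⟩ 0 ⟨C * R, by positivity⟩ ⟨C * 2, by positivity⟩ := by
    refine ⟨fun t ht => ?_, fun x _ => (hcont _).continuousOn, fun t ht x _ => ?_, ?_⟩
    · refine LipschitzWith.lipschitzOnWith (LipschitzWith.of_dist_le_mul fun x y => ?_)
      rw [dist_eq_norm, dist_eq_norm]
      refine (hlip t (hmem t ht) _ _).trans ?_
      change _ ≤ C * 2 * _
      rw [mul_assoc]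
      gcongr
      exact norm_truncate_sub_le hR0 x y
    · refine (hbd t (hmem t ht) _).trans ?_
      change _ ≤ C * R
      gcongr
      exact norm_truncate_le hR0 x
    · change C * R * max (τ - 0) (0 - -τ) ≤ C * R * τ - 0
      simp
  obtain ⟨x, hx0, hx⟩ := hPL.exists_eq_forall_mem_Icc_hasDerivWithinAt₀
  refine ⟨x, hx0, ?_⟩
  have hder : ∀ t, |t| < τ → HasDerivAt x (f t (truncate R (x t))) t := fun t ht => by
    have ht' := abs_lt.1 ht
    exact (hx t ⟨ht'.1.le, ht'.2.le⟩).hasDerivAt (Icc_mem_nhds ht'.1 ht'.2)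
  intro t ht
  have h1 := norm_le_gronwallBound_abs (K := C) (ε := 0) hder (fun s hs => by
    rw [add_zero]
    refine (hbd s hs.le _).trans ?_
    gcongr
    exact norm_truncate_le_norm hR0 _) ht
  rw [gronwallBound_ε0, hx0] at h1
  have h2 : ‖x t‖ ≤ R := by
    refine h1.trans ?_
    have : ‖x₀‖ * Real.exp (C * |t|) ≤ ‖x₀‖ * Real.exp (C * τ) := by gcongr
    linarith
  have := hder t ht
  rwa [truncate_eq_self hR0 h2] at this

/-! ### The time evolution of solutions of the difference equation -/

/-- A family of solutions of `H(t) φ = l φ` for `|t| < τ` that evolves in time by the second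
equation of the Lax pair, `φ̇(n) = a(n) φ(n + 1) - a(n - 1) φ(n - 1)`, here written with
`φ(n - 1)` eliminated. -/
structure IsFlow (a b : ℤ → ℝ → ℝ) (l : ℂ) (τ : ℝ) (φ : ℤ → ℝ → ℂ) : Prop where
  sol : ∀ t, |t| < τ → ∀ n,
    jacobi (fun k => a k t) (fun k => b k t) (fun k => φ k t) n = l * φ n t
  deriv : ∀ t, |t| < τ → ∀ n,
    HasDerivAt (φ n) (2 * a n t * φ (n + 1) t + (b n t - l) * φ n t) t

section flow

variable {a b : ℤ → ℝ → ℝ} {l : ℂ} {τ : ℝ} {φ χ : ℤ → ℝ → ℂ}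

/-- The evolution at site `n + 1` in terms of the values at `n` and `n + 1`. -/
theorem IsFlow.deriv_succ (h : IsFlow a b l τ φ) {t : ℝ} (ht : |t| < τ) (n : ℤ) :
    HasDerivAt (φ (n + 1)) ((l - b (n + 1) t) * φ (n + 1) t - 2 * a n t * φ n t) t := by
  refine (h.deriv t ht (n + 1)).congr_deriv ?_
  have := h.sol t ht (n + 1)
  simp only [jacobi, add_sub_cancel_right] at this
  linear_combination 2 * this

theorem IsFlow.linear_comb (h : IsFlow a b l τ φ) (h' : IsFlow a b l τ χ) (c d : ℂ) :
    IsFlow a b l τ fun n t => c * φ n t + d * χ n t where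
  sol t ht n := by
    have e1 := h.sol t ht n
    have e2 := h'.sol t ht n
    simp only [jacobi] at e1 e2 ⊢
    linear_combination c * e1 + d * e2
  deriv t ht n := by
    refine (((h.deriv t ht n).const_mul c).add ((h'.deriv t ht n).const_mul d)).congr_deriv ?_
    ring

theorem IsFlow.conj (h : IsFlow a b l τ φ) (hl : (starRingEnd ℂ) l = l) :
    IsFlow a b l τ fun n t => (starRingEnd ℂ) (φ n t) where
  sol t ht n := by
    have := jacobi_conj (h.sol t ht) n
    rwa [hl] at this
  deriv t ht n := by
    refine (h.deriv t ht n).star.congr_deriv ?_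
    change (starRingEnd ℂ) _ = _
    simp only [map_add, map_sub, map_mul, map_ofNat, Complex.conj_ofReal, hl]

/-- A bound for the linear vector field that drives the values of a flow at two neighbouring sites,
rescaled by factors `p`, `q`. -/
theorem norm_flow_le {C A β β' : ℝ} {x y p q : ℂ} (hA : |A| ≤ C) (hβ : |β| ≤ C) (hβ' : |β'| ≤ C)
    (hC : 0 ≤ C) :
    ‖((2 * A * p * y + (β - l) * x, (l - β') * y - 2 * A * q * x) : ℂ × ℂ)‖ ≤
      (C + ‖l‖ + 2 * C * (‖p‖ + ‖q‖)) * ‖((x, y) : ℂ × ℂ)‖ := by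
  have hx : ‖x‖ ≤ ‖((x, y) : ℂ × ℂ)‖ := norm_fst_le (x, y)
  have hy : ‖y‖ ≤ ‖((x, y) : ℂ × ℂ)‖ := norm_snd_le (x, y)
  set N := ‖((x, y) : ℂ × ℂ)‖
  have hN : 0 ≤ N := norm_nonneg _
  have e1 : ‖(β : ℂ) - l‖ ≤ C + ‖l‖ := (norm_sub_le _ _).trans (by
    rw [Complex.norm_real, Real.norm_eq_abs]; linarith)
  have e2 : ‖l - (β' : ℂ)‖ ≤ C + ‖l‖ := (norm_sub_le _ _).trans (by
    rw [Complex.norm_real, Real.norm_eq_abs]; linarith)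
  have e3 : ∀ r : ℂ, ‖2 * (A : ℂ) * r‖ ≤ 2 * C * ‖r‖ := fun r => by
    rw [norm_mul, norm_mul, Complex.norm_real, Real.norm_eq_abs, Complex.norm_ofNat]; gcongr
  have hp := mul_nonneg (mul_nonneg (mul_nonneg two_pos.le hC) (norm_nonneg p)) hN
  have hq := mul_nonneg (mul_nonneg (mul_nonneg two_pos.le hC) (norm_nonneg q)) hN
  refine max_le ?_ ?_
  · calc ‖2 * (A : ℂ) * p * y + (β - l) * x‖ ≤ ‖2 * (A : ℂ) * p * y‖ + ‖((β : ℂ) - l) * x‖ :=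
          norm_add_le _ _
      _ ≤ 2 * C * ‖p‖ * N + (C + ‖l‖) * N := by
          rw [norm_mul _ y, norm_mul _ x]; gcongr; exact e3 p
      _ ≤ _ := by nlinarith
  · calc ‖(l - β') * y - 2 * (A : ℂ) * q * x‖ ≤ ‖(l - β') * y‖ + ‖2 * (A : ℂ) * q * x‖ :=
          norm_sub_le _ _
      _ ≤ (C + ‖l‖) * N + 2 * C * ‖q‖ * N := by
          rw [norm_mul, norm_mul (2 * (A : ℂ) * q)]; gcongr; exact e3 q
      _ ≤ _ := by nlinarith

/-- Uniqueness for the pair equation satisfied by the values of a flow at two neighbouring sites. -/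
theorem pair_eq_zero {x y : ℝ → ℂ} {A β β' : ℝ → ℝ} {C : ℝ} (hC : 0 ≤ C)
    (hA : ∀ t, |t| < τ → |A t| ≤ C) (hβ : ∀ t, |t| < τ → |β t| ≤ C)
    (hβ' : ∀ t, |t| < τ → |β' t| ≤ C)
    (hx : ∀ t, |t| < τ → HasDerivAt x (2 * A t * y t + (β t - l) * x t) t)
    (hy : ∀ t, |t| < τ → HasDerivAt y ((l - β' t) * y t - 2 * A t * x t) t)
    (hx0 : x 0 = 0) (hy0 : y 0 = 0) {t : ℝ} (ht : |t| < τ) : x t = 0 ∧ y t = 0 := by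
  have h := norm_le_gronwallBound_abs (f := fun t => (x t, y t)) (ε := 0)
    (K := C + ‖l‖ + 2 * C * (‖(1 : ℂ)‖ + ‖(1 : ℂ)‖))
    (fun t ht => (hx t ht).prodMk (hy t ht)) (fun t ht => by
      have := norm_flow_le (l := l) (x := x t) (y := y t) (p := 1) (q := 1)
        (hA t ht) (hβ t ht) (hβ' t ht) hC
      simpa using this) ht
  rw [hx0, hy0, gronwallBound_ε0] at h
  have h' : ((x t, y t) : ℂ × ℂ) = 0 := norm_le_zero_iff.1 (by simpa using h)
  exact Prod.mk_eq_zero.1 h'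

/-- A flow is determined by its values at time zero. -/
theorem IsFlow.eq_zero (hsol : IsTodaSolution a b) (h : IsFlow a b l τ φ) (h0 : ∀ n, φ n 0 = 0)
    {t : ℝ} (ht : |t| < τ) (n : ℤ) : φ n t = 0 := by
  obtain ⟨C, hC⟩ := hsol.locallyBounded τ
  have hC0 : 0 ≤ C := (abs_nonneg _).trans (hC t ht.le 0).1
  exact (pair_eq_zero hC0 (fun t ht => (hC t ht.le n).1) (fun t ht => (hC t ht.le n).2)
    (fun t ht => (hC t ht.le (n + 1)).2) (fun t ht => h.deriv t ht n)
    (fun t ht => h.deriv_succ ht n) (h0 n) (h0 (n + 1)) ht).1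

/-- Every solution of the difference equation at time zero extends to a flow. The two values at
neighbouring sites satisfy a closed linear differential equation; the Toda equations make these
compatible from one site to the next. -/
theorem IsTodaSolution.exists_flow (hsol : IsTodaSolution a b) (hτ : 0 < τ) {f : ℤ → ℂ}
    (hf : ∀ n, jacobi (fun k => a k 0) (fun k => b k 0) f n = l * f n) :
    ∃ φ, IsFlow a b l τ φ ∧ ∀ n, φ n 0 = f n := by
  obtain ⟨C, hC⟩ := hsol.locallyBounded τ
  have hC0 : 0 ≤ C := (abs_nonneg _).trans (hC 0 (by simpa using hτ.le) 0).1
  have hca : ∀ n, Continuous fun t => (a n t : ℂ) := fun n => Complex.continuous_ofReal.comp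
    (continuous_iff_continuousAt.2 fun t => (hsol.deriv_a n t).continuousAt)
  have hcb : ∀ n, Continuous fun t => (b n t : ℂ) := fun n => Complex.continuous_ofReal.comp
    (continuous_iff_continuousAt.2 fun t => (hsol.deriv_b n t).continuousAt)
  have hex : ∀ n : ℤ, ∃ u : ℝ → ℂ × ℂ, u 0 = (f n, f (n + 1)) ∧ ∀ t, |t| < τ →
      HasDerivAt u (2 * a n t * (u t).2 + (b n t - l) * (u t).1,
        (l - b (n + 1) t) * (u t).2 - 2 * a n t * (u t).1) t := by
    intro n
    refine exists_solution_of_lipschitz (f := fun t u => (2 * (a n t : ℂ) * u.2 + (b n t - l) * u.1,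
        (l - b (n + 1) t) * u.2 - 2 * (a n t : ℂ) * u.1))
        (C := C + ‖l‖ + 2 * C * (‖(1 : ℂ)‖ + ‖(1 : ℂ)‖)) (by positivity) hτ (fun t ht x y => ?_)
        (fun t => by simp) (fun x => ?_) _
    · have := norm_flow_le (l := l) (x := x.1 - y.1) (y := x.2 - y.2) (p := 1) (q := 1)
        (hC t ht n).1 (hC t ht n).2 (hC t ht (n + 1)).2 hC0
      refine le_trans (le_of_eq ?_) this
      congr 1
      refine Prod.ext ?_ ?_
      · simp only [Prod.fst_sub]; ring
      · simp only [Prod.snd_sub]; ring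
    · have := hca n; have := hcb n; have := hcb (n + 1)
      fun_prop
  choose u hu0 hu using hex
  have hx : ∀ n t, |t| < τ →
      HasDerivAt (fun t => (u n t).1) (2 * a n t * (u n t).2 + (b n t - l) * (u n t).1) t :=
    fun n t ht => (ContinuousLinearMap.fst ℝ ℂ ℂ).hasFDerivAt.comp_hasDerivAt t (hu n t ht)
  have hy : ∀ n t, |t| < τ → HasDerivAt (fun t => (u n t).2)
      ((l - b (n + 1) t) * (u n t).2 - 2 * a n t * (u n t).1) t :=
    fun n t ht => (ContinuousLinearMap.snd ℝ ℂ ℂ).hasFDerivAt.comp_hasDerivAt t (hu n t ht)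
  have hane : ∀ n t, (a n t : ℂ) ≠ 0 := fun n t => by exact_mod_cast (hsol.a_pos n t).ne'
  -- the value at site `n + 2` predicted from sites `n`, `n + 1` by the difference equation
  set w : ℤ → ℝ → ℂ := fun n t =>
    ((l - b (n + 1) t) * (u n t).2 - a n t * (u n t).1) / a (n + 1) t with hw
  have hwd : ∀ n t, |t| < τ → HasDerivAt (w n)
      ((l - b (n + 2) t) * w n t - 2 * a (n + 1) t * (u n t).2) t := by
    intro n t ht
    have d1 := ((((hsol.deriv_b (n + 1) t).ofReal_comp.const_sub l).mul (hy n t ht)).sub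
      ((hsol.deriv_a n t).ofReal_comp.mul (hx n t ht))).div (hsol.deriv_a (n + 1) t).ofReal_comp
      (hane (n + 1) t)
    refine d1.congr_deriv ?_
    have := hane (n + 1) t
    simp only [hw]
    rw [show n + 1 + 1 = n + 2 by ring, add_sub_cancel_right]
    push_cast
    simp only [Pi.sub_apply, Pi.mul_apply]
    field_simp
    ring
  have hcompat : ∀ n t, |t| < τ → (u n t).2 = (u (n + 1) t).1 ∧ w n t = (u (n + 1) t).2 := by
    intro n t ht
    have hwu : ∀ t, (l - b (n + 1) t) * (u n t).2 - a n t * (u n t).1 = a (n + 1) t * w n t :=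
      fun t => by simp only [hw]; rw [mul_div_cancel₀ _ (hane (n + 1) t)]
    have := pair_eq_zero (l := l) (τ := τ) (x := fun t => (u n t).2 - (u (n + 1) t).1)
      (y := fun t => w n t - (u (n + 1) t).2) (A := a (n + 1)) (β := b (n + 1)) (β' := b (n + 2))
      hC0 (fun t ht => (hC t ht.le _).1) (fun t ht => (hC t ht.le _).2)
      (fun t ht => (hC t ht.le _).2) (fun t ht => ?_) (fun t ht => ?_) ?_ ?_ ht
    · exact ⟨sub_eq_zero.1 this.1, sub_eq_zero.1 this.2⟩
    · refine ((hy n t ht).sub (hx (n + 1) t ht)).congr_deriv ?_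
      linear_combination 2 * hwu t
    · refine ((hwd n t ht).sub (hy (n + 1) t ht)).congr_deriv ?_
      rw [show n + 1 + 1 = n + 2 by ring]
      ring
    · simp [hu0]
    · have h1 := hf (n + 1)
      simp only [jacobi, add_sub_cancel_right] at h1
      simp only [hw, hu0]
      rw [sub_eq_zero, div_eq_iff (hane _ _)]
      linear_combination -h1
  refine ⟨fun n t => (u n t).1, ⟨fun t ht n => ?_, fun t ht n => ?_⟩, fun n => by simp only [hu0]⟩
  · have h1 := (hcompat (n - 1) t ht).1
    have h2 := (hcompat (n - 1) t ht).2
    have h3 := (hcompat n t ht).1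
    rw [sub_add_cancel] at h1 h2
    simp only [hw, sub_add_cancel] at h2
    rw [div_eq_iff (hane _ _)] at h2
    simp only [jacobi]
    rw [← h3, ← h1] at *
    linear_combination -h2
  · have h3 := (hcompat n t ht).1
    have := hx n t ht
    rwa [h3] at this

end flow

/-! ### The time evolution of the scattering data -/

section evolution

variable {a b : ℤ → ℝ → ℝ} {τ t₀ : ℝ} {z : ℂ}

/-- A flow asymptotic to `wⁿ` at one end of the lattice stays asymptotic to
`exp (t (w - w⁻¹) / 2) wⁿ`. The vector `w^(-n) (φ(n), w⁻¹ φ(n + 1))` solves an equation whose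
coefficients converge, and `(1, 1)` is an eigenvector of the limit. The filter `F` is `atTop` or
`atBot`. -/
theorem IsFlow.tendsto (hsol : IsTodaSolution a b)
    (h : HasDecay (fun n => a n t₀) fun n => b n t₀) {φ : ℤ → ℝ → ℂ} {w : ℂ} (hw : w ≠ 0)
    (hφ : IsFlow a b ((w + w⁻¹) / 2) τ φ) {F : Filter ℤ}
    (hF : Tendsto (fun n : ℤ => n + 1) F F)
    (hF0 : Tendsto (fun n : ℤ => 1 / (1 + |(n : ℝ)|)) F (𝓝 0))
    (h0 : Tendsto (fun n : ℤ => w ^ (-n) * φ n 0) F (𝓝 1)) {t : ℝ} (ht : |t| < τ) :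
    Tendsto (fun n : ℤ => w ^ (-n) * φ n t) F (𝓝 (Complex.exp (t * ((w - w⁻¹) / 2)))) := by
  obtain ⟨C, hC⟩ := hsol.locallyBounded τ
  obtain ⟨K, hK0, hK⟩ := hsol.exists_le_div h 1 τ
  have hC0 : 0 < C := (hsol.a_pos 0 t).trans_le ((le_abs_self _).trans (hC t ht.le 0).1)
  set l := (w + w⁻¹) / 2 with hl
  set α := (w - w⁻¹) / 2 with hα
  set e : ℝ → ℂ := fun t => Complex.exp (t * α) with he
  have hed : ∀ t : ℝ, HasDerivAt e (α * e t) t := fun t => by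
    have h1 : HasDerivAt (fun t : ℝ => (t : ℂ) * α) α t := by
      simpa using (Complex.ofRealCLM.hasDerivAt (x := t)).mul_const α
    exact h1.cexp.congr_deriv (mul_comm _ _)
  set E₀ := Real.exp (τ * ‖α‖) with hE₀
  have heb : ∀ t : ℝ, |t| < τ → ‖e t‖ ≤ E₀ := fun t ht => by
    refine (Complex.norm_exp_le_exp_norm _).trans (Real.exp_le_exp.2 ?_)
    rw [norm_mul, Complex.norm_real, Real.norm_eq_abs]
    gcongr
  set x : ℤ → ℝ → ℂ := fun n t => w ^ (-n) * φ n t - e t with hx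
  set y : ℤ → ℝ → ℂ := fun n t => w ^ (-(n + 1)) * φ (n + 1) t - e t with hy
  set κ := C + ‖l‖ + 2 * C * (‖w‖ + ‖w⁻¹‖) with hκ
  have hκ0 : κ ≠ 0 := ne_of_gt (by positivity)
  set Q := E₀ * (K * (2 * ‖w‖ + 2 * ‖w⁻¹‖ + 2)) with hQ
  have hpow : ∀ n : ℤ, w ^ (-n) = w ^ (-(n + 1)) * w := fun n => by
    rw [← zpow_add_one₀ hw]; congr 1; ring
  have hxd : ∀ n t, |t| < τ → HasDerivAt (x n)
      ((2 * a n t * w * y n t + (b n t - l) * x n t) +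
        e t * ((2 * (a n t - 1 / 2 : ℝ)) * w + b n t)) t := fun n t ht => by
    refine (((hφ.deriv t ht n).const_mul (w ^ (-n))).sub (hed t)).congr_deriv ?_
    simp only [hx, hy, hl, hα]
    push_cast
    rw [hpow n]
    ring
  have hyd : ∀ n t, |t| < τ → HasDerivAt (y n)
      (((l - b (n + 1) t) * y n t - 2 * a n t * w⁻¹ * x n t) +
        e t * (-(2 * (a n t - 1 / 2 : ℝ)) * w⁻¹ - b (n + 1) t)) t := fun n t ht => by
    refine (((hφ.deriv_succ ht n).const_mul (w ^ (-(n + 1)))).sub (hed t)).congr_deriv ?_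
    simp only [hx, hy, hl, hα]
    push_cast
    rw [hpow n]
    field_simp
    ring
  have hb1 : ∀ n t, |t| < τ → |b (n + 1) t| ≤ 2 * (K / (1 + |(n : ℝ)|)) := fun n t ht => by
    refine (hK t ht.le (n + 1)).2.trans ?_
    rw [pow_one, mul_div_assoc', div_le_div_iff₀ (by positivity) (by positivity)]
    have : 1 + |(n : ℝ)| ≤ 2 * (1 + |((n + 1 : ℤ) : ℝ)|) := one_add_abs_le_two_mul (by simp)
    nlinarith
  have hres1 : ∀ n t, |t| < τ →
      ‖e t * ((2 * (a n t - 1 / 2 : ℝ)) * w + b n t)‖ ≤ Q * (1 / (1 + |(n : ℝ)|)) := by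
    intro n t ht
    have k1 := (hK t ht.le n).1
    have k2 := (hK t ht.le n).2
    rw [pow_one] at k1 k2
    set d := K / (1 + |(n : ℝ)|) with hd
    have hd0 : 0 ≤ d := by positivity
    rw [norm_mul]
    calc _ ≤ E₀ * (2 * d * ‖w‖ + d) := by
          gcongr
          · exact heb t ht
          · refine (norm_add_le _ _).trans (add_le_add ?_ ?_)
            · rw [norm_mul, norm_mul, Complex.norm_real, Real.norm_eq_abs, Complex.norm_ofNat]
              gcongr
            · rwa [Complex.norm_real, Real.norm_eq_abs]
      _ ≤ E₀ * (d * (2 * ‖w‖ + 2 * ‖w⁻¹‖ + 2)) := by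
          gcongr
          have := mul_nonneg hd0 (norm_nonneg w⁻¹)
          nlinarith
      _ = _ := by rw [hQ, hd]; ring
  have hres2 : ∀ n t, |t| < τ →
      ‖e t * (-(2 * (a n t - 1 / 2 : ℝ)) * w⁻¹ - b (n + 1) t)‖ ≤ Q * (1 / (1 + |(n : ℝ)|)) := by
    intro n t ht
    have k1 := (hK t ht.le n).1
    have k2 := hb1 n t ht
    rw [pow_one] at k1
    set d := K / (1 + |(n : ℝ)|) with hd
    have hd0 : 0 ≤ d := by positivity
    rw [norm_mul]
    calc _ ≤ E₀ * (2 * d * ‖w⁻¹‖ + 2 * d) := by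
          gcongr
          · exact heb t ht
          · refine (norm_sub_le _ _).trans (add_le_add ?_ ?_)
            · rw [norm_mul, norm_neg, norm_mul, Complex.norm_real, Real.norm_eq_abs,
                Complex.norm_ofNat]
              gcongr
            · rwa [Complex.norm_real, Real.norm_eq_abs]
      _ ≤ E₀ * (d * (2 * ‖w‖ + 2 * ‖w⁻¹‖ + 2)) := by
          gcongr
          have := mul_nonneg hd0 (norm_nonneg w)
          nlinarith
      _ = _ := by rw [hQ, hd]; ring
  have hgron : ∀ n, ‖((x n t, y n t) : ℂ × ℂ)‖ ≤
      gronwallBound ‖((x n 0, y n 0) : ℂ × ℂ)‖ κ (Q * (1 / (1 + |(n : ℝ)|))) |t| := by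
    intro n
    refine norm_le_gronwallBound_abs (f := fun t => (x n t, y n t))
      (fun t ht => (hxd n t ht).prodMk (hyd n t ht)) (fun t ht => ?_) ht
    rw [← Prod.mk_add_mk]
    refine (norm_add_le _ _).trans (add_le_add ?_ ?_)
    · exact norm_flow_le (hC t ht.le n).1 (hC t ht.le n).2 (hC t ht.le (n + 1)).2 hC0.le
    · exact max_le (hres1 n t ht) (hres2 n t ht)
  have hx0 : Tendsto (fun n => x n 0) F (𝓝 0) := by
    have := h0.sub_const 1
    rw [sub_self] at this
    refine this.congr fun n => ?_
    simp [hx, he]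
  have hy0 : Tendsto (fun n => y n 0) F (𝓝 0) := hx0.comp hF
  have hδ : Tendsto (fun n => ‖((x n 0, y n 0) : ℂ × ℂ)‖) F (𝓝 0) := by
    have := (hx0.prodMk_nhds hy0).norm
    simpa using this
  have hε : Tendsto (fun n : ℤ => Q * (1 / (1 + |(n : ℝ)|))) F (𝓝 0) := by
    simpa using hF0.const_mul Q
  have hbound : Tendsto (fun n : ℤ =>
      gronwallBound ‖((x n 0, y n 0) : ℂ × ℂ)‖ κ (Q * (1 / (1 + |(n : ℝ)|))) |t|) F (𝓝 0) := by
    simp only [gronwallBound_of_K_ne_0 hκ0]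
    have := (hδ.mul_const (Real.exp (κ * |t|))).add
      ((hε.div_const κ).mul_const (Real.exp (κ * |t|) - 1))
    simpa using this
  have hlim : Tendsto (fun n => x n t) F (𝓝 0) := by
    rw [tendsto_zero_iff_norm_tendsto_zero]
    exact squeeze_zero (fun _ => norm_nonneg _)
      (fun n => (norm_fst_le (x n t, y n t)).trans (hgron n)) hbound
  have := hlim.add_const (e t)
  rw [zero_add] at this
  refine this.congr fun n => ?_
  simp [hx]

theorem tendsto_one_div_atTop : Tendsto (fun n : ℤ => 1 / (1 + |(n : ℝ)|)) atTop (𝓝 0) :=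
  Tendsto.const_div_atTop (tendsto_atTop_add_const_left _ _
    (tendsto_abs_atTop_atTop.comp tendsto_intCast_atTop_atTop)) _

theorem tendsto_one_div_atBot : Tendsto (fun n : ℤ => 1 / (1 + |(n : ℝ)|)) atBot (𝓝 0) := by
  refine (tendsto_one_div_atTop.comp tendsto_neg_atBot_atTop).congr fun n => ?_
  simp

/-- The right Jost solution evolves as a flow, up to an explicit exponential. -/
theorem IsFlow.jostPlus_eq (hsol : IsTodaSolution a b)
    (h : HasDecay (fun n => a n t₀) fun n => b n t₀) {φ : ℤ → ℝ → ℂ} (hz0 : z ≠ 0)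
    (hz : ‖z‖ ≤ 1) (hφ : IsFlow a b ((z + z⁻¹) / 2) τ φ)
    (h0 : ∀ n, φ n 0 = jostPlus (fun n => a n 0) (fun n => b n 0) z n) {t : ℝ} (ht : |t| < τ)
    (n : ℤ) : φ n t = Complex.exp (t * ((z - z⁻¹) / 2)) *
      jostPlus (fun n => a n t) (fun n => b n t) z n := by
  have hJ0 := (hsol.hasDecay h 0).jostPlus_spec (fun n => hsol.a_pos n 0) hz0 hz
  have hd := hsol.hasDecay h t
  have hpos := fun n => hsol.a_pos n t
  set e := Complex.exp (t * ((z - z⁻¹) / 2)) with he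
  have hlim := hφ.tendsto hsol h hz0 (tendsto_atTop_add_const_right _ _ tendsto_id)
    tendsto_one_div_atTop (hJ0.2.congr fun n => by rw [h0]) ht
  have hJ : IsJostPlus (fun n => a n t) (fun n => b n t) z fun n => e⁻¹ * φ n t := by
    refine ⟨fun n => ?_, ?_⟩
    · have := hφ.sol t ht n
      simp only [jacobi] at this ⊢
      linear_combination e⁻¹ * this
    · have := hlim.const_mul e⁻¹
      rw [inv_mul_cancel₀ (Complex.exp_ne_zero _)] at this
      exact this.congr fun n => by ring
  have := congrFun (hd.isJostPlus_unique hpos hz0 hz hJ (hd.jostPlus_spec hpos hz0 hz)) n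
  rw [← this, mul_inv_cancel_left₀ (Complex.exp_ne_zero _)]

/-- The left Jost solution evolves as a flow, up to the inverse exponential. -/
theorem IsFlow.jostMinus_eq (hsol : IsTodaSolution a b)
    (h : HasDecay (fun n => a n t₀) fun n => b n t₀) {φ : ℤ → ℝ → ℂ} (hz0 : z ≠ 0)
    (hz : ‖z‖ ≤ 1) (hφ : IsFlow a b ((z + z⁻¹) / 2) τ φ)
    (h0 : ∀ n, φ n 0 = jostMinus (fun n => a n 0) (fun n => b n 0) z n) {t : ℝ} (ht : |t| < τ)
    (n : ℤ) : φ n t = Complex.exp (-(t * ((z - z⁻¹) / 2))) *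
      jostMinus (fun n => a n t) (fun n => b n t) z n := by
  have hJ0 := (hsol.hasDecay h 0).jostMinus_spec (fun n => hsol.a_pos n 0) hz0 hz
  have hd := hsol.hasDecay h t
  have hpos := fun n => hsol.a_pos n t
  set e := Complex.exp (-(t * ((z - z⁻¹) / 2))) with he
  have hφ' : IsFlow a b ((z⁻¹ + z⁻¹⁻¹) / 2) τ φ := by rwa [inv_inv, add_comm z⁻¹]
  have hlim := hφ'.tendsto hsol h (inv_ne_zero hz0) (tendsto_atBot_add_const_right _ _ tendsto_id)
    tendsto_one_div_atBot (hJ0.2.congr fun n => by rw [h0]; simp) ht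
  have hexp : (t : ℂ) * ((z⁻¹ - z⁻¹⁻¹) / 2) = -(t * ((z - z⁻¹) / 2)) := by rw [inv_inv]; ring
  rw [hexp, ← he] at hlim
  have hJ : IsJostMinus (fun n => a n t) (fun n => b n t) z fun n => e⁻¹ * φ n t := by
    refine ⟨fun n => ?_, ?_⟩
    · have := hφ.sol t ht n
      simp only [jacobi] at this ⊢
      linear_combination e⁻¹ * this
    · have := hlim.const_mul e⁻¹
      rw [inv_mul_cancel₀ (Complex.exp_ne_zero _)] at this
      exact this.congr fun n => by simp; ring
  have := congrFun (hd.isJostMinus_unique hpos hz0 hz hJ (hd.jostMinus_spec hpos hz0 hz)) n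
  rw [← this, mul_inv_cancel_left₀ (Complex.exp_ne_zero _)]

/-- Proportionality of the Jost solutions persists, with an exponential factor. -/
theorem IsTodaSolution.jostMinus_eq_mul (hsol : IsTodaSolution a b)
    (h : HasDecay (fun n => a n t₀) fun n => b n t₀) (hz0 : z ≠ 0) (hz : ‖z‖ ≤ 1) {c : ℂ}
    (hc : ∀ n, jostMinus (fun n => a n 0) (fun n => b n 0) z n =
      c * jostPlus (fun n => a n 0) (fun n => b n 0) z n) (t : ℝ) (n : ℤ) :
    jostMinus (fun n => a n t) (fun n => b n t) z n =
      c * Complex.exp (t * (z - z⁻¹)) * jostPlus (fun n => a n t) (fun n => b n t) z n := by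
  have hτ : |t| < |t| + 1 := lt_add_one _
  have hτ0 : 0 < |t| + 1 := by positivity
  have hd := hsol.hasDecay h 0
  have hpos := fun n => hsol.a_pos n 0
  obtain ⟨φ, hφ, hφ0⟩ := hsol.exists_flow hτ0 (hd.jostPlus_spec hpos hz0 hz).1
  obtain ⟨χ, hχ, hχ0⟩ := hsol.exists_flow hτ0 (hd.jostMinus_spec hpos hz0 hz).1
  have hzero := (hχ.linear_comb hφ 1 (-c)).eq_zero hsol
    (fun n => by rw [hφ0, hχ0, hc]; ring) hτ n
  rw [hφ.jostPlus_eq hsol h hz0 hz hφ0 hτ, hχ.jostMinus_eq hsol h hz0 hz hχ0 hτ,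
    Complex.exp_neg] at hzero
  have he : Complex.exp (t * (z - z⁻¹)) = Complex.exp (t * ((z - z⁻¹) / 2)) *
      Complex.exp (t * ((z - z⁻¹) / 2)) := by rw [← Complex.exp_add]; congr 1; ring
  rw [he]
  have := Complex.exp_ne_zero (t * ((z - z⁻¹) / 2))
  generalize Complex.exp (t * ((z - z⁻¹) / 2)) = e at *
  field_simp at hzero
  linear_combination hzero

theorem conj_exp_of_norm_eq_one (hz : ‖z‖ = 1) (t : ℝ) :
    (starRingEnd ℂ) (Complex.exp (t * ((z - z⁻¹) / 2))) =
      (Complex.exp (t * ((z - z⁻¹) / 2)))⁻¹ := by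
  have h2 : (starRingEnd ℂ) z⁻¹ = z := by rw [← conj_eq_inv hz, Complex.conj_conj]
  rw [← Complex.exp_conj, ← Complex.exp_neg, map_mul, map_div₀, map_sub, h2, conj_eq_inv hz,
    Complex.conj_ofReal, map_ofNat]
  congr 1
  ring

/-- The transmission coefficient is constant in time and the reflection coefficient evolves by an
exponential. -/
theorem IsTodaSolution.isScatteringPair (hsol : IsTodaSolution a b)
    (h : HasDecay (fun n => a n t₀) fun n => b n t₀) {T R : ℂ → ℂ}
    (hTR : IsScatteringPair (fun n => a n 0) (fun n => b n 0) T R) (t : ℝ) :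
    IsScatteringPair (fun n => a n t) (fun n => b n t) T
      fun z => R z * Complex.exp (t * (z - z⁻¹)) where
  meromorphic := hTR.meromorphic
  boundary := hTR.boundary
  continuous_reflection := by
    refine hTR.continuous_reflection.mul ?_
    have : ContinuousOn (fun z : ℂ => z⁻¹) (Metric.sphere 0 1) := continuousOn_id.inv₀ fun z hz =>
      ne_zero_of_norm_eq_one (mem_sphere_zero_iff_norm.1 hz)
    fun_prop
  relation z hz n := by
    have hz0 := ne_zero_of_norm_eq_one hz
    have hτ : |t| < |t| + 1 := lt_add_one _
    have hτ0 : 0 < |t| + 1 := by positivity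
    have hd := hsol.hasDecay h 0
    have hpos := fun n => hsol.a_pos n 0
    obtain ⟨φ, hφ, hφ0⟩ := hsol.exists_flow hτ0 (hd.jostPlus_spec hpos hz0 hz.le).1
    obtain ⟨χ, hχ, hχ0⟩ := hsol.exists_flow hτ0 (hd.jostMinus_spec hpos hz0 hz.le).1
    have hzero := (((hχ.linear_comb hφ (T z) (-R z)).linear_comb
      (hφ.conj (conj_spectral hz)) 1 (-1)).eq_zero hsol
      (fun n => by
        have := hTR.relation z hz n
        rw [hφ0, hχ0]
        linear_combination this) hτ n)
    rw [hφ.jostPlus_eq hsol h hz0 hz.le hφ0 hτ, hχ.jostMinus_eq hsol h hz0 hz.le hχ0 hτ,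
      Complex.exp_neg, map_mul, conj_exp_of_norm_eq_one hz] at hzero
    have he : Complex.exp (t * (z - z⁻¹)) = Complex.exp (t * ((z - z⁻¹) / 2)) *
        Complex.exp (t * ((z - z⁻¹) / 2)) := by rw [← Complex.exp_add]; congr 1; ring
    rw [he]
    have := Complex.exp_ne_zero (t * ((z - z⁻¹) / 2))
    generalize Complex.exp (t * ((z - z⁻¹) / 2)) = e at *
    field_simp at hzero
    linear_combination hzero

end evolution

/-! ### The vector of the Riemann–Hilbert problem at a fixed time -/

theorem vecMul_swap (v : Fin 2 → ℂ) : Matrix.vecMul v !![0, 1; 1, 0] = ![v 1, v 0] := by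
  ext i
  fin_cases i <;> simp [Matrix.vecMul, dotProduct, Fin.sum_univ_two]

theorem tendsto_fin_two {α : Type*} {l : Filter α} {f : α → Fin 2 → ℂ} {v : Fin 2 → ℂ}
    (h0 : Tendsto (fun x => f x 0) l (𝓝 (v 0))) (h1 : Tendsto (fun x => f x 1) l (𝓝 (v 1))) :
    Tendsto f l (𝓝 v) :=
  tendsto_pi_nhds.2 fun i => by fin_cases i <;> assumption

/-- A meromorphic function whose product with `z - w` has a limit at `w` has at most a simple
pole there. -/
theorem HasSimpleResidue.of_tendsto {m : ℂ → Fin 2 → ℂ} {w : ℂ} {ρ : Fin 2 → ℂ}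
    (hm : ∀ i, MeromorphicAt (fun z => m z i) w)
    (h : Tendsto (fun z => (z - w) • m z) (𝓝[≠] w) (𝓝 ρ)) : HasSimpleResidue m w ρ := by
  refine ⟨fun i => ⟨hm i, ?_⟩, h⟩
  have hid : MeromorphicAt (fun z : ℂ => z - w) w := by fun_prop
  have h0 : 0 ≤ meromorphicOrderAt ((fun z => z - w) * fun z => m z i) w :=
    (tendsto_nhds_iff_meromorphicOrderAt_nonneg (hid.mul (hm i))).1
      ⟨ρ i, (tendsto_pi_nhds.1 h i).congr fun z => by simp⟩
  rw [meromorphicOrderAt_mul hid (hm i), meromorphicOrderAt_id_sub_const] at h0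
  cases hk : meromorphicOrderAt (fun z => m z i) w with
  | top => exact le_top
  | coe k =>
    rw [hk] at h0
    have h1 : (0 : ℤ) ≤ 1 + k := by exact_mod_cast h0
    exact_mod_cast (by lia : -1 ≤ k)

section vector

variable {a b : ℤ → ℝ} {z : ℂ} {n : ℤ}

/-- The row vector inside the unit disc, `(T(z) ψ₋(z, n) zⁿ, ψ₊(z, n) z⁻ⁿ)`, in terms of the
normalized Jost functions; in this form it is defined at `z = 0` and on the unit circle too. -/
noncomputable def rhpDisc (a b : ℤ → ℝ) (n : ℤ) (z : ℂ) : Fin 2 → ℂ :=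
  ![transFun a b z * jostFunLeft a b n z, jostFun a b n z]

theorem HasDecay.rhpVectorAux_of_lt (h : HasDecay a b) (ha : ∀ n, 0 < a n) (hz0 : z ≠ 0)
    (hz : ‖z‖ < 1) : rhpVectorAux a b n z = rhpDisc a b n z := by
  have hzn : z ^ n ≠ 0 := zpow_ne_zero n hz0
  rw [rhpVectorAux, if_pos hz, h.transmission_eq ha hz.le, h.jostMinus_apply ha hz0 hz.le,
    h.jostPlus_apply ha hz0 hz.le, zpow_neg, rhpDisc]
  congr 1
  · field_simp
  · congr 1
    field_simp

theorem HasDecay.rhpVectorAux_of_gt (h : HasDecay a b) (ha : ∀ n, 0 < a n) (hz : 1 < ‖z‖) :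
    rhpVectorAux a b n z = ![rhpDisc a b n z⁻¹ 1, rhpDisc a b n z⁻¹ 0] := by
  have hz0 : z ≠ 0 := norm_pos_iff.1 (one_pos.trans hz)
  have hz1 : ‖z⁻¹‖ < 1 := by rw [norm_inv]; exact inv_lt_one_of_one_lt₀ hz
  have hzn : z ^ n ≠ 0 := zpow_ne_zero n hz0
  rw [rhpVectorAux, if_neg hz.not_gt, h.transmission_eq ha hz1.le,
    h.jostMinus_apply ha (inv_ne_zero hz0) hz1.le, h.jostPlus_apply ha (inv_ne_zero hz0) hz1.le,
    zpow_neg, zpow_neg, inv_zpow, inv_inv]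
  simp only [rhpDisc, Matrix.cons_val_zero, Matrix.cons_val_one]
  congr 1
  · field_simp
  · congr 1
    field_simp

theorem HasDecay.analyticAt_rhpDisc (h : HasDecay a b) (hz : ‖z‖ < 1) (hD : jostDet a b z ≠ 0) :
    AnalyticAt ℂ (rhpDisc a b n) z := by
  have hT : AnalyticAt ℂ (transFun a b) z := by
    have h1 : AnalyticAt ℂ (fun w => (1 - w ^ 2) / jostDet a b w) z :=
      AnalyticAt.div (by fun_prop) (analyticAt_of_norm_lt_one h.differentiableOn_jostDet hz) hD
    refine h1.congr ?_
    filter_upwards [continuous_norm.continuousAt.eventually_lt_const hz] with w hw using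
      (transFun_of_norm_lt_one hw).symm
  refine (analyticAt_pi_iff (f := fun i w => rhpDisc a b n w i)).2 fun i => ?_
  fin_cases i
  · exact hT.mul (analyticAt_of_norm_lt_one (h.differentiableOn_jostFunLeft n) hz)
  · exact analyticAt_of_norm_lt_one (h.differentiableOn_jostFun n) hz

theorem HasDecay.meromorphicAt_rhpDisc (h : HasDecay a b) (hz : ‖z‖ < 1) (i : Fin 2) :
    MeromorphicAt (fun w => rhpDisc a b n w i) z := by
  have hT : MeromorphicAt (transFun a b) z := by
    have h1 : MeromorphicAt (fun w => (1 - w ^ 2) / jostDet a b w) z :=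
      MeromorphicAt.div (by fun_prop)
        (analyticAt_of_norm_lt_one h.differentiableOn_jostDet hz).meromorphicAt
    refine h1.congr (Filter.EventuallyEq.filter_mono ?_ nhdsWithin_le_nhds)
    filter_upwards [continuous_norm.continuousAt.eventually_lt_const hz] with w hw using
      (transFun_of_norm_lt_one hw).symm
  fin_cases i
  · exact hT.mul (analyticAt_of_norm_lt_one (h.differentiableOn_jostFunLeft n) hz).meromorphicAt
  · exact (analyticAt_of_norm_lt_one (h.differentiableOn_jostFun n) hz).meromorphicAt

theorem HasDecay.continuousWithinAt_rhpDisc (h : HasDecay a b) (ha : ∀ n, 0 < a n)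
    (hz : ‖z‖ = 1) : ContinuousWithinAt (rhpDisc a b n) (Metric.closedBall 0 1) z := by
  have hz' : z ∈ Metric.closedBall (0 : ℂ) 1 := mem_closedBall_zero_iff.2 hz.le
  exact tendsto_fin_two
    ((h.continuousWithinAt_transFun ha hz.le (.inr hz)).mul
      ((h.differentiableOn_jostFunLeft n).continuousOn z hz'))
    ((h.differentiableOn_jostFun n).continuousOn z hz')

theorem HasDecay.rhpDisc_zero (h : HasDecay a b) (ha : ∀ n, 0 < a n) :
    rhpDisc a b n 0 = ![(((jostNorm a n)⁻¹ : ℝ) : ℂ), ((jostNorm a n : ℝ) : ℂ)] := by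
  have h1 : ((jostNormLeft a n : ℝ) : ℂ) ≠ 0 := Complex.ofReal_ne_zero.2 (jostNormLeft_pos n).ne'
  have h2 : ((jostNorm a n : ℝ) : ℂ) ≠ 0 := Complex.ofReal_ne_zero.2 (jostNorm_pos a n).ne'
  rw [rhpDisc, transFun_of_norm_lt_one (by simp), h.jostDet_zero ha n, jostFun_zero,
    jostFunLeft_zero]
  congr 1
  push_cast
  field_simp
  simp

theorem HasDecay.rhpVector_of_lt (h : HasDecay a b) (ha : ∀ n, 0 < a n) (hz : ‖z‖ < 1) :
    rhpVector a b n z = rhpDisc a b n z := by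
  by_cases hz0 : z = 0
  · subst hz0
    rw [rhpVector, if_pos rfl]
    have hc : Tendsto (rhpDisc a b n) (𝓝[≠] 0) (𝓝 (rhpDisc a b n 0)) :=
      (h.analyticAt_rhpDisc hz (h.jostDet_zero_ne_zero ha)).continuousAt.tendsto.mono_left
        nhdsWithin_le_nhds
    refine (hc.congr' ?_).limUnder_eq
    filter_upwards [self_mem_nhdsWithin, nhdsWithin_le_nhds
      (continuous_norm.continuousAt.eventually_lt_const hz)] with w hw0 hw using
      (h.rhpVectorAux_of_lt ha hw0 hw).symm
  · rw [rhpVector, if_neg hz0, h.rhpVectorAux_of_lt ha hz0 hz]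

theorem HasDecay.rhpVector_of_gt (h : HasDecay a b) (ha : ∀ n, 0 < a n) (hz : 1 < ‖z‖) :
    rhpVector a b n z = ![rhpDisc a b n z⁻¹ 1, rhpDisc a b n z⁻¹ 0] := by
  rw [rhpVector, if_neg (norm_pos_iff.1 (one_pos.trans hz)), h.rhpVectorAux_of_gt ha hz]

theorem HasDecay.rhpVector_eventuallyEq_of_lt (h : HasDecay a b) (ha : ∀ n, 0 < a n)
    (hz : ‖z‖ < 1) : rhpDisc a b n =ᶠ[𝓝 z] rhpVector a b n := by
  filter_upwards [continuous_norm.continuousAt.eventually_lt_const hz] with w hw using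
    (h.rhpVector_of_lt ha hw).symm

theorem HasDecay.rhpVector_eventuallyEq_of_gt (h : HasDecay a b) (ha : ∀ n, 0 < a n)
    (hz : 1 < ‖z‖) :
    (fun w => ![rhpDisc a b n w⁻¹ 1, rhpDisc a b n w⁻¹ 0]) =ᶠ[𝓝 z] rhpVector a b n := by
  filter_upwards [continuous_norm.continuousAt.eventually_const_lt hz] with w hw using
    (h.rhpVector_of_gt ha hw).symm

theorem HasDecay.analyticAt_rhpVector (h : HasDecay a b) (ha : ∀ n, 0 < a n) (hz : ‖z‖ ≠ 1)
    (hD : ‖z‖ < 1 → jostDet a b z ≠ 0) (hD' : 1 < ‖z‖ → jostDet a b z⁻¹ ≠ 0) :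
    AnalyticAt ℂ (rhpVector a b n) z := by
  rcases hz.lt_or_gt with hz | hz
  · exact (h.analyticAt_rhpDisc hz (hD hz)).congr (h.rhpVector_eventuallyEq_of_lt ha hz)
  · have hz0 : z ≠ 0 := norm_pos_iff.1 (one_pos.trans hz)
    have hz1 : ‖z⁻¹‖ < 1 := by rw [norm_inv]; exact inv_lt_one_of_one_lt₀ hz
    refine AnalyticAt.congr ?_ (h.rhpVector_eventuallyEq_of_gt ha hz)
    have h1 : AnalyticAt ℂ (fun w => rhpDisc a b n w⁻¹) z :=
      (h.analyticAt_rhpDisc hz1 (hD' hz)).comp (analyticAt_inv hz0)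
    have h2 := fun i => (analyticAt_pi_iff (f := fun i w => rhpDisc a b n w⁻¹ i)).1 h1 i
    refine (analyticAt_pi_iff
      (f := fun i w => ![rhpDisc a b n w⁻¹ 1, rhpDisc a b n w⁻¹ 0] i)).2 fun i => ?_
    fin_cases i
    · exact h2 1
    · exact h2 0

theorem HasDecay.rhpVector_inv (h : HasDecay a b) (ha : ∀ n, 0 < a n) (hz0 : z ≠ 0)
    (hz : ‖z‖ ≠ 1) :
    rhpVector a b n z⁻¹ = Matrix.vecMul (rhpVector a b n z) !![0, 1; 1, 0] := by
  rw [vecMul_swap]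
  rcases hz.lt_or_gt with hz | hz
  · have hz1 : 1 < ‖z⁻¹‖ := by rw [norm_inv]; exact (one_lt_inv₀ (norm_pos_iff.2 hz0)).2 hz
    rw [h.rhpVector_of_lt ha hz, h.rhpVector_of_gt ha hz1, inv_inv]
  · have hz1 : ‖z⁻¹‖ < 1 := by rw [norm_inv]; exact inv_lt_one_of_one_lt₀ hz
    rw [h.rhpVector_of_gt ha hz, h.rhpVector_of_lt ha hz1]
    ext i
    fin_cases i <;> rfl

theorem HasDecay.tendsto_rhpVector_cobounded (h : HasDecay a b) (ha : ∀ n, 0 < a n) :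
    Tendsto (rhpVector a b n) (Bornology.cobounded ℂ)
      (𝓝 (Matrix.vecMul (rhpVector a b n 0) !![0, 1; 1, 0])) := by
  have h0 : ‖(0 : ℂ)‖ < 1 := by simp
  rw [vecMul_swap, h.rhpVector_of_lt ha h0]
  have hc : Tendsto (fun w => rhpDisc a b n w⁻¹) (Bornology.cobounded ℂ) (𝓝 (rhpDisc a b n 0)) :=
    (h.analyticAt_rhpDisc h0 (h.jostDet_zero_ne_zero ha)).continuousAt.tendsto.comp
      tendsto_inv₀_cobounded
  have h2 : Tendsto (fun w => ![rhpDisc a b n w⁻¹ 1, rhpDisc a b n w⁻¹ 0])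
      (Bornology.cobounded ℂ) (𝓝 ![rhpDisc a b n 0 1, rhpDisc a b n 0 0]) :=
    tendsto_fin_two (tendsto_pi_nhds.1 hc 1) (tendsto_pi_nhds.1 hc 0)
  refine h2.congr' ?_
  filter_upwards [tendsto_norm_cobounded_atTop.eventually_gt_atTop (1 : ℝ)] with w hw using
    (h.rhpVector_of_gt ha hw).symm

theorem HasDecay.tendsto_rhpVector_inner (h : HasDecay a b) (ha : ∀ n, 0 < a n) (hz : ‖z‖ = 1) :
    Tendsto (rhpVector a b n) (𝓝[{w | ‖w‖ < 1}] z) (𝓝 (rhpDisc a b n z)) := by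
  refine Tendsto.congr' ?_ ((h.continuousWithinAt_rhpDisc ha hz).mono_left
    (nhdsWithin_mono z fun w (hw : ‖w‖ < 1) => mem_closedBall_zero_iff.2 hw.le))
  filter_upwards [self_mem_nhdsWithin] with w hw using (h.rhpVector_of_lt ha hw).symm

theorem HasDecay.tendsto_rhpVector_outer (h : HasDecay a b) (ha : ∀ n, 0 < a n) (hz : ‖z‖ = 1) :
    Tendsto (rhpVector a b n) (𝓝[{w | 1 < ‖w‖}] z)
      (𝓝 ![rhpDisc a b n z⁻¹ 1, rhpDisc a b n z⁻¹ 0]) := by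
  have hz0 := ne_zero_of_norm_eq_one hz
  have hinv : Tendsto (fun w : ℂ => w⁻¹) (𝓝[{w | 1 < ‖w‖}] z)
      (𝓝[Metric.closedBall 0 1] z⁻¹) := by
    refine tendsto_nhdsWithin_iff.2 ⟨(continuousAt_inv₀ hz0).tendsto.mono_left
      nhdsWithin_le_nhds, ?_⟩
    filter_upwards [self_mem_nhdsWithin] with w hw
    rw [mem_closedBall_zero_iff, norm_inv]
    exact inv_le_one_of_one_le₀ (le_of_lt hw)
  have hc := (h.continuousWithinAt_rhpDisc (n := n) ha
    (show ‖z⁻¹‖ = 1 by rw [norm_inv, hz, inv_one])).tendsto.comp hinv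
  have h2 : Tendsto (fun w => ![rhpDisc a b n w⁻¹ 1, rhpDisc a b n w⁻¹ 0])
      (𝓝[{w | 1 < ‖w‖}] z) (𝓝 ![rhpDisc a b n z⁻¹ 1, rhpDisc a b n z⁻¹ 0]) :=
    tendsto_fin_two (tendsto_pi_nhds.1 hc 1) (tendsto_pi_nhds.1 hc 0)
  refine h2.congr' ?_
  filter_upwards [self_mem_nhdsWithin] with w hw using (h.rhpVector_of_gt ha hw).symm

theorem HasDecay.continuousOn_rhpDisc_sphere (h : HasDecay a b) (ha : ∀ n, 0 < a n) :
    ContinuousOn (rhpDisc a b n) (Metric.sphere 0 1) := fun _ hz =>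
  (h.continuousWithinAt_rhpDisc ha (mem_sphere_zero_iff_norm.1 hz)).mono
    Metric.sphere_subset_closedBall

theorem HasDecay.continuousOn_rhpDisc_inv_sphere (h : HasDecay a b) (ha : ∀ n, 0 < a n) :
    ContinuousOn (fun z => ![rhpDisc a b n z⁻¹ 1, rhpDisc a b n z⁻¹ 0]) (Metric.sphere 0 1) := by
  have h1 : ContinuousOn (fun z => rhpDisc a b n z⁻¹) (Metric.sphere 0 1) :=
    (h.continuousOn_rhpDisc_sphere ha).comp
      (continuousOn_id.inv₀ fun z hz => ne_zero_of_norm_eq_one (mem_sphere_zero_iff_norm.1 hz))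
      fun z hz => by simpa using hz
  intro z hz
  exact tendsto_fin_two (tendsto_pi_nhds.1 (h1 z hz) 1) (tendsto_pi_nhds.1 (h1 z hz) 0)

theorem HasDecay.transFun_conj (h : HasDecay a b) (ha : ∀ n, 0 < a n) (hz : ‖z‖ = 1) :
    transFun a b z⁻¹ = (starRingEnd ℂ) (transFun a b z) := by
  have hc := h.continuousOn_transFun_sphere ha
  refine eq_on_circle (f := fun z => transFun a b z⁻¹)
    (g := fun z => (starRingEnd ℂ) (transFun a b z)) (hc.comp
      (continuousOn_id.inv₀ fun z hz => ne_zero_of_norm_eq_one (mem_sphere_zero_iff_norm.1 hz))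
      fun z hz => by simpa using hz) (Complex.continuous_conj.comp_continuousOn hc)
    (fun z hz h1 => ?_) hz
  have hD := h.jostDet_ne_zero_of_norm_eq_one ha hz h1
  have hD' : jostDet a b ((starRingEnd ℂ) z) ≠ 0 := by
    rw [jostDet_conj]; exact (map_ne_zero _).2 hD
  rw [← conj_eq_inv hz, transFun_of_ne_zero hD, transFun_of_ne_zero hD', jostDet_conj]
  simp

theorem exp_timesPhase (n : ℤ) (t : ℝ) (hz : z ≠ 0) :
    Complex.exp (timesPhase n t z) = z ^ (2 * n) * Complex.exp (t * (z - z⁻¹)) := by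
  have : (2 : ℂ) * n * Complex.log z = ((2 * n : ℤ) : ℂ) * Complex.log z := by push_cast; ring
  rw [timesPhase, Complex.exp_add, this, Complex.exp_int_mul, Complex.exp_log hz, mul_comm]

/-- On the unit circle `t Φ(z)` exponentiates to a number of modulus one. -/
theorem conj_exp_timesPhase (n : ℤ) (t : ℝ) (hz : ‖z‖ = 1) :
    (starRingEnd ℂ) (Complex.exp (timesPhase n t z)) =
      (Complex.exp (timesPhase n t z))⁻¹ := by
  have h2 : (starRingEnd ℂ) z⁻¹ = z := by rw [← conj_eq_inv hz, Complex.conj_conj]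
  rw [exp_timesPhase n t (ne_zero_of_norm_eq_one hz), map_mul, mul_inv, map_zpow₀,
    conj_eq_inv hz, inv_zpow, ← Complex.exp_conj, ← Complex.exp_neg, map_mul, map_sub, h2,
    conj_eq_inv hz, Complex.conj_ofReal]
  congr 2
  ring

/-- The scattering relation and its complex conjugate are the two components of the jump
condition. -/
theorem IsScatteringPair.jump {T R : ℂ → ℂ} {t : ℝ} (h : HasDecay a b) (ha : ∀ n, 0 < a n)
    (hTR : IsScatteringPair a b T fun z => R z * Complex.exp (t * (z - z⁻¹))) (hz : ‖z‖ = 1) :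
    rhpDisc a b n z = Matrix.vecMul ![rhpDisc a b n z⁻¹ 1, rhpDisc a b n z⁻¹ 0]
      (jumpMatrix R n t z) := by
  have hz0 := ne_zero_of_norm_eq_one hz
  have hT : T z = transFun a b z := by
    rw [(hTR.unique h ha (h.scatteringPair_spec ha)).1 z hz.le, h.transmission_eq ha hz.le]
  have hrel := hTR.relation z hz n
  have hzn : z ^ n ≠ 0 := zpow_ne_zero n hz0
  rw [h.jostMinus_apply ha hz0 hz.le, h.jostPlus_apply ha hz0 hz.le, hT, map_mul, map_zpow₀,
    conj_eq_inv hz, inv_zpow, zpow_neg] at hrel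
  have hE := exp_timesPhase n t hz0
  have hE' := conj_exp_timesPhase n t hz
  have hE0 := Complex.exp_ne_zero (timesPhase n t z)
  have hX : transFun a b z * jostFunLeft a b n z = (starRingEnd ℂ) (jostFun a b n z) +
      R z * Complex.exp (timesPhase n t z) * jostFun a b n z := by
    rw [hE, two_mul, zpow_add₀ hz0]
    have := congrArg (z ^ n * ·) hrel
    generalize Complex.exp (t * (z - z⁻¹)) = e at *
    field_simp at this
    linear_combination this
  have hX' : transFun a b z⁻¹ * jostFunLeft a b n z⁻¹ = jostFun a b n z +
      (starRingEnd ℂ) (R z) * (Complex.exp (timesPhase n t z))⁻¹ *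
        (starRingEnd ℂ) (jostFun a b n z) := by
    rw [h.transFun_conj ha hz, ← conj_eq_inv hz, jostFunLeft_conj, ← map_mul, hX]
    simp [hE']
  have hP : jostFun a b n z⁻¹ = (starRingEnd ℂ) (jostFun a b n z) := by
    rw [← conj_eq_inv hz, jostFun_conj]
  have hR : ((‖R z‖ : ℂ)) ^ 2 = R z * (starRingEnd ℂ) (R z) := by
    rw [Complex.mul_conj, Complex.normSq_eq_norm_sq]; push_cast; rfl
  simp only [rhpDisc, jumpMatrix, Matrix.cons_val_zero, Matrix.cons_val_one, hX, hX', hP, hR,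
    Complex.exp_neg]
  ext i
  fin_cases i
  · simp only [Matrix.vecMul, dotProduct, Fin.sum_univ_two]
    simp
    field_simp
    ring
  · simp only [Matrix.vecMul, dotProduct, Fin.sum_univ_two]
    simp
    ring

/-- The residue of the transmission coefficient, in terms of the norming constant and the
proportionality factor of the Jost solutions. -/
theorem HasDecay.tendsto_mul_transFun (h : HasDecay a b) (ha : ∀ n, 0 < a n) {ζ : ℝ}
    (h0 : ζ ≠ 0) (h1 : |ζ| < 1) (hD : jostDet a b ζ = 0) {c : ℂ} (hc0 : c ≠ 0)
    (hc : ∀ n, jostMinus a b ζ n = c * jostPlus a b ζ n) :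
    Tendsto (fun z => (z - ζ) * transFun a b z) (𝓝[≠] (ζ : ℂ))
      (𝓝 (-ζ * (normingConstant a b ζ : ℝ) / c)) := by
  have hz : ‖(ζ : ℂ)‖ < 1 := by simpa using h1
  have hζ : (ζ : ℂ) ≠ 0 := Complex.ofReal_ne_zero.2 h0
  have hγ : ((normingConstant a b ζ : ℝ) : ℂ) ≠ 0 :=
    Complex.ofReal_ne_zero.2 (h.normingConstant_inv ha h0 h1 hD).1.ne'
  have hsq : (ζ : ℂ) ^ 2 - 1 ≠ 0 := by
    have : ζ ^ 2 < 1 := (sq_lt_one_iff_abs_lt_one ζ).2 h1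
    exact_mod_cast (sub_neg.2 this).ne
  have hsub : (ζ : ℂ) - (ζ : ℂ)⁻¹ ≠ 0 := by
    have : (ζ : ℂ) - (ζ : ℂ)⁻¹ = ((ζ : ℂ) ^ 2 - 1) * (ζ : ℂ)⁻¹ := by field_simp
    rw [this]
    exact mul_ne_zero hsq (inv_ne_zero hζ)
  have hnum : Tendsto (fun z : ℂ => 1 - z ^ 2) (𝓝[≠] (ζ : ℂ)) (𝓝 (1 - (ζ : ℂ) ^ 2)) :=
    (by fun_prop : Continuous fun z : ℂ => 1 - z ^ 2).continuousAt.tendsto.mono_left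
      nhdsWithin_le_nhds
  have := hnum.div (h.tendsto_jostDet_div ha h0 h1 hD hc)
    (mul_ne_zero (mul_ne_zero hsub hc0) (inv_ne_zero hγ))
  have heq : -(ζ : ℂ) * (normingConstant a b ζ : ℝ) / c =
      (1 - (ζ : ℂ) ^ 2) / ((ζ - (ζ : ℂ)⁻¹) * c * ((normingConstant a b ζ : ℝ) : ℂ)⁻¹) := by
    rw [div_eq_div_iff hc0 (mul_ne_zero (mul_ne_zero hsub hc0) (inv_ne_zero hγ))]
    field_simp
    ring
  rw [heq]
  refine this.congr' ?_
  filter_upwards [self_mem_nhdsWithin, nhdsWithin_le_nhds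
    (continuous_norm.continuousAt.eventually_lt_const hz)] with w hw0 hw
  rw [Pi.div_apply, transFun_of_norm_lt_one hw, div_div_eq_mul_div]
  ring

end vector

/-! ### Poles of the vector along the Toda flow -/

section toda

variable {a b : ℤ → ℝ → ℝ} {t₀ : ℝ} {z : ℂ}

theorem IsTodaSolution.transFun_eq (hsol : IsTodaSolution a b)
    (h : HasDecay (fun n => a n t₀) fun n => b n t₀) (t : ℝ) (hz : ‖z‖ ≤ 1) :
    transFun (fun n => a n t) (fun n => b n t) z =
      transFun (fun n => a n 0) (fun n => b n 0) z := by
  have ha := fun t n => hsol.a_pos n t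
  have hd := hsol.hasDecay h
  have := ((hsol.isScatteringPair h ((hd 0).scatteringPair_spec (ha 0)) t).unique (hd t) (ha t)
    ((hd t).scatteringPair_spec (ha t))).1 z hz
  rw [(hd t).transmission_eq (ha t) hz, (hd 0).transmission_eq (ha 0) hz] at this
  exact this.symm

/-- The Toda flow is isospectral: the zeros of the Jost determinant do not move. -/
theorem IsTodaSolution.jostDet_eq_zero_iff (hsol : IsTodaSolution a b)
    (h : HasDecay (fun n => a n t₀) fun n => b n t₀) (t : ℝ) (hz : ‖z‖ < 1) :
    jostDet (fun n => a n t) (fun n => b n t) z = 0 ↔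
      ∃ ζ ∈ discreteData (fun n => a n 0) (fun n => b n 0), z = (ζ : ℂ) := by
  rw [← (hsol.hasDecay h 0).jostDet_eq_zero_iff (fun n => hsol.a_pos n 0) hz]
  have hsq : 1 - z ^ 2 ≠ 0 := one_sub_sq_ne_zero (by rintro rfl; simp at hz)
    (by rintro rfl; simp at hz)
  -- Division by zero gives zero, so both determinants vanish exactly where the quotient does.
  have key : ∀ s, jostDet (fun n => a n s) (fun n => b n s) z = 0 ↔
      transFun (fun n => a n s) (fun n => b n s) z = 0 := fun s => by
    rw [transFun_of_norm_lt_one hz, div_eq_zero_iff, or_iff_right hsq]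
  rw [key t, key 0, hsol.transFun_eq h t hz.le]

/-- The residue of the vector inside the disc, by time invariance of `T` and the evolution of the
proportionality factor of the Jost solutions. -/
theorem IsTodaSolution.tendsto_sub_smul_rhpDisc (hsol : IsTodaSolution a b)
    (h : HasDecay (fun n => a n t₀) fun n => b n t₀) (n : ℤ) (t : ℝ) {ζ : ℝ}
    (hζ : ζ ∈ discreteData (fun n => a n 0) (fun n => b n 0)) :
    Tendsto (fun z => (z - (ζ : ℂ)) • rhpDisc (fun n => a n t) (fun n => b n t) n z)
      (𝓝[≠] (ζ : ℂ)) (𝓝 ![-(ζ : ℂ) * (normingConstant (fun n => a n 0) (fun n => b n 0) ζ : ℝ) *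
        Complex.exp (timesPhase n t ζ) * jostFun (fun n => a n t) (fun n => b n t) n ζ, 0]) := by
  obtain ⟨h0, h1, -⟩ := id hζ
  have hz : ‖(ζ : ℂ)‖ < 1 := by simpa using h1
  have hz0 : (ζ : ℂ) ≠ 0 := Complex.ofReal_ne_zero.2 h0
  have ha := fun t n => hsol.a_pos n t
  have hd := hsol.hasDecay h
  have hD := ((hd 0).jostDet_eq_zero_iff (ha 0) hz).2 ⟨ζ, hζ, rfl⟩
  obtain ⟨c, hc0, hc⟩ := (hd 0).exists_jostMinus_eq (ha 0) hz0 hz.le hD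
  have hres := (hd 0).tendsto_mul_transFun (ha 0) h0 h1 hD hc0 hc
  have hprop := hsol.jostMinus_eq_mul h hz0 hz.le hc t n
  rw [(hd t).jostMinus_apply (ha t) hz0 hz.le, (hd t).jostPlus_apply (ha t) hz0 hz.le,
    zpow_neg] at hprop
  have hzn : (ζ : ℂ) ^ n ≠ 0 := zpow_ne_zero n hz0
  have hL : jostFunLeft (fun n => a n t) (fun n => b n t) n ζ = c *
      Complex.exp (timesPhase n t ζ) * jostFun (fun n => a n t) (fun n => b n t) n ζ := by
    rw [exp_timesPhase n t hz0, two_mul, zpow_add₀ hz0]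
    generalize Complex.exp (t * ((ζ : ℂ) - (ζ : ℂ)⁻¹)) = e at *
    field_simp at hprop
    linear_combination hprop
  have hcont : ∀ {f : ℂ → ℂ}, DifferentiableOn ℂ f (Metric.closedBall 0 1) →
      Tendsto f (𝓝[≠] (ζ : ℂ)) (𝓝 (f ζ)) := fun hf =>
    (analyticAt_of_norm_lt_one hf hz).continuousAt.tendsto.mono_left nhdsWithin_le_nhds
  refine tendsto_fin_two ?_ ?_
  · have := hres.mul (hcont ((hd t).differentiableOn_jostFunLeft n))
    rw [hL] at this
    have heq : ∀ γ E P : ℂ, -(ζ : ℂ) * γ / c * (c * E * P) = -(ζ : ℂ) * γ * E * P := by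
      intro γ E P
      field_simp
    rw [heq] at this
    refine this.congr' ?_
    filter_upwards [nhdsWithin_le_nhds
      (continuous_norm.continuousAt.eventually_lt_const hz)] with w hw
    simp [rhpDisc, hsol.transFun_eq h t hw.le, mul_assoc]
  · have hs : Tendsto (fun z : ℂ => z - ζ) (𝓝[≠] (ζ : ℂ)) (𝓝 ((ζ : ℂ) - ζ)) :=
      (by fun_prop : Continuous fun z : ℂ => z - ζ).continuousAt.tendsto.mono_left
        nhdsWithin_le_nhds
    have := hs.mul (hcont ((hd t).differentiableOn_jostFun n))
    rw [sub_self, zero_mul] at this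
    exact this.congr fun z => by simp [rhpDisc]

theorem IsTodaSolution.hasSimpleResidue (hsol : IsTodaSolution a b)
    (h : HasDecay (fun n => a n t₀) fun n => b n t₀) (n : ℤ) (t : ℝ) {ζ : ℝ}
    (hζ : ζ ∈ discreteData (fun n => a n 0) (fun n => b n 0)) :
    HasSimpleResidue (rhpVector (fun n => a n t) (fun n => b n t) n) (ζ : ℂ)
      ![-(ζ : ℂ) * (normingConstant (fun n => a n 0) (fun n => b n 0) ζ : ℝ) *
        Complex.exp (timesPhase n t ζ) * jostFun (fun n => a n t) (fun n => b n t) n ζ, 0] := by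
  have hz : ‖(ζ : ℂ)‖ < 1 := by simpa using hζ.2.1
  have hd := hsol.hasDecay h t
  have heq := hd.rhpVector_eventuallyEq_of_lt (n := n) (fun n => hsol.a_pos n t) hz
  refine .of_tendsto (fun i => (hd.meromorphicAt_rhpDisc (n := n) hz i).congr ?_)
    ((hsol.tendsto_sub_smul_rhpDisc h n t hζ).congr' ?_)
  · filter_upwards [nhdsWithin_le_nhds heq] with w hw using congrFun hw i
  · filter_upwards [nhdsWithin_le_nhds heq] with w hw using by rw [hw]

theorem IsTodaSolution.hasSimpleResidue_inv (hsol : IsTodaSolution a b)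
    (h : HasDecay (fun n => a n t₀) fun n => b n t₀) (n : ℤ) (t : ℝ) {ζ : ℝ}
    (hζ : ζ ∈ discreteData (fun n => a n 0) (fun n => b n 0)) :
    HasSimpleResidue (rhpVector (fun n => a n t) (fun n => b n t) n) (ζ : ℂ)⁻¹
      ![0, (ζ : ℂ)⁻¹ * (normingConstant (fun n => a n 0) (fun n => b n 0) ζ : ℝ) *
        Complex.exp (timesPhase n t ζ) * jostFun (fun n => a n t) (fun n => b n t) n ζ] := by
  have hz : ‖(ζ : ℂ)‖ < 1 := by simpa using hζ.2.1
  have hz0 : (ζ : ℂ) ≠ 0 := Complex.ofReal_ne_zero.2 hζ.1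
  have hz1 : 1 < ‖(ζ : ℂ)⁻¹‖ := by rw [norm_inv]; exact (one_lt_inv₀ (norm_pos_iff.2 hz0)).2 hz
  have hd := hsol.hasDecay h t
  have heq := hd.rhpVector_eventuallyEq_of_gt (n := n) (fun n => hsol.a_pos n t) hz1
  refine .of_tendsto (fun i => ?_) ?_
  · have hmer : ∀ j, MeromorphicAt
        (fun w : ℂ => rhpDisc (fun n => a n t) (fun n => b n t) n w⁻¹ j) (ζ : ℂ)⁻¹ := fun j =>
      MeromorphicAt.comp_analyticAt
        (f := fun w => rhpDisc (fun n => a n t) (fun n => b n t) n w j) (g := fun w : ℂ => w⁻¹)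
        (by rw [inv_inv]; exact hd.meromorphicAt_rhpDisc hz j) (analyticAt_inv (inv_ne_zero hz0))
    refine MeromorphicAt.congr (f := fun w => ![
      rhpDisc (fun n => a n t) (fun n => b n t) n w⁻¹ 1,
      rhpDisc (fun n => a n t) (fun n => b n t) n w⁻¹ 0] i) ?_ ?_
    · fin_cases i
      · exact hmer 1
      · exact hmer 0
    · filter_upwards [nhdsWithin_le_nhds heq] with w hw using congrFun hw i
  · have hinv : Tendsto (fun w : ℂ => w⁻¹) (𝓝[≠] (ζ : ℂ)⁻¹) (𝓝[≠] (ζ : ℂ)) := by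
      refine tendsto_nhdsWithin_iff.2 ⟨?_, ?_⟩
      · have := (continuousAt_inv₀ (inv_ne_zero hz0)).tendsto
        rw [inv_inv] at this
        exact this.mono_left nhdsWithin_le_nhds
      · filter_upwards [self_mem_nhdsWithin] with w hw hw'
        exact hw (by rw [Set.mem_singleton_iff, ← Set.mem_singleton_iff.1 hw', inv_inv])
    have hfac : Tendsto (fun w : ℂ => -(w * (ζ : ℂ)⁻¹)) (𝓝[≠] (ζ : ℂ)⁻¹)
        (𝓝 (-((ζ : ℂ)⁻¹ * (ζ : ℂ)⁻¹))) :=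
      (by fun_prop : Continuous fun w : ℂ => -(w * (ζ : ℂ)⁻¹)).continuousAt.tendsto.mono_left
        nhdsWithin_le_nhds
    have hlim := hfac.smul ((hsol.tendsto_sub_smul_rhpDisc h n t hζ).comp hinv)
    -- `w - ζ⁻¹ = -w ζ⁻¹ (w⁻¹ - ζ)` transfers the residue from `ζ` to `ζ⁻¹`.
    have hfactor : ∀ w : ℂ, w ≠ 0 → -(w * (ζ : ℂ)⁻¹) * (w⁻¹ - ζ) = w - (ζ : ℂ)⁻¹ := by
      intro w hw
      field_simp
      ring
    have hne : ∀ᶠ w : ℂ in 𝓝[≠] (ζ : ℂ)⁻¹, w ≠ 0 :=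
      nhdsWithin_le_nhds (continuousAt_id.eventually_ne (inv_ne_zero hz0))
    refine tendsto_fin_two ?_ ?_
    · have hlim1 := tendsto_pi_nhds.1 hlim 1
      simp only [Pi.smul_apply, Matrix.cons_val_one, Matrix.cons_val_fin_one, smul_zero] at hlim1
      refine hlim1.congr' ?_
      filter_upwards [nhdsWithin_le_nhds heq, hne] with w hw hw0
      rw [← hw, ← hfactor w hw0]
      simp [mul_assoc]
    · have hlim0 := tendsto_pi_nhds.1 hlim 0
      have hval : (-((ζ : ℂ)⁻¹ * (ζ : ℂ)⁻¹)) • (-(ζ : ℂ) *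
          (normingConstant (fun n => a n 0) (fun n => b n 0) ζ : ℝ) *
          Complex.exp (timesPhase n t ζ) * jostFun (fun n => a n t) (fun n => b n t) n ζ) =
          (ζ : ℂ)⁻¹ * (normingConstant (fun n => a n 0) (fun n => b n 0) ζ : ℝ) *
          Complex.exp (timesPhase n t ζ) * jostFun (fun n => a n t) (fun n => b n t) n ζ := by
        generalize Complex.exp (timesPhase n t ζ) = e
        rw [smul_eq_mul]
        field_simp
      simp only [Pi.smul_apply, Matrix.cons_val_zero, hval] at hlim0
      refine hlim0.congr' ?_
      filter_upwards [nhdsWithin_le_nhds heq, hne] with w hw hw0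
      rw [← hw, ← hfactor w hw0]
      simp [mul_assoc]

/-- Near a zero of the Jost determinant the right component is regular. -/
theorem IsTodaSolution.tendsto_rhpVector_one (hsol : IsTodaSolution a b)
    (h : HasDecay (fun n => a n t₀) fun n => b n t₀) (n : ℤ) (t : ℝ) (hz : ‖z‖ < 1) :
    Tendsto (fun w => rhpVector (fun n => a n t) (fun n => b n t) n w 1) (𝓝[≠] z)
      (𝓝 (jostFun (fun n => a n t) (fun n => b n t) n z)) := by
  have hd := hsol.hasDecay h t
  have h1 : Tendsto (jostFun (fun n => a n t) (fun n => b n t) n) (𝓝[≠] z) (𝓝 _) :=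
    (analyticAt_of_norm_lt_one (hd.differentiableOn_jostFun n) hz).continuousAt.tendsto.mono_left
      nhdsWithin_le_nhds
  refine h1.congr' ?_
  filter_upwards [nhdsWithin_le_nhds
    (hd.rhpVector_eventuallyEq_of_lt (n := n) (fun n => hsol.a_pos n t) hz)] with w hw
  rw [← hw]
  rfl

theorem IsTodaSolution.tendsto_rhpVector_inv_zero (hsol : IsTodaSolution a b)
    (h : HasDecay (fun n => a n t₀) fun n => b n t₀) (n : ℤ) (t : ℝ) (hz0 : z ≠ 0)
    (hz : ‖z‖ < 1) :
    Tendsto (fun w => rhpVector (fun n => a n t) (fun n => b n t) n w 0) (𝓝[≠] z⁻¹)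
      (𝓝 (jostFun (fun n => a n t) (fun n => b n t) n z)) := by
  have hd := hsol.hasDecay h t
  have hz1 : 1 < ‖z⁻¹‖ := by rw [norm_inv]; exact (one_lt_inv₀ (norm_pos_iff.2 hz0)).2 hz
  have hinv : Tendsto (fun w : ℂ => w⁻¹) (𝓝[≠] z⁻¹) (𝓝 z) := by
    have := (continuousAt_inv₀ (inv_ne_zero hz0)).tendsto
    rw [inv_inv] at this
    exact this.mono_left nhdsWithin_le_nhds
  have h1 := (analyticAt_of_norm_lt_one
    (hd.differentiableOn_jostFun n) hz).continuousAt.tendsto.comp hinv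
  refine h1.congr' ?_
  filter_upwards [nhdsWithin_le_nhds
    (hd.rhpVector_eventuallyEq_of_gt (n := n) (fun n => hsol.a_pos n t) hz1)] with w hw
  rw [← hw]
  rfl

end toda

end TodaRHP

theorem theorem2p3 (a b : ℤ → ℝ → ℝ) (hsol : TodaRHP.IsTodaSolution a b)
    (hdecay : ∃ t₀ : ℝ, TodaRHP.HasDecay (fun n => a n t₀) (fun n => b n t₀))
    (Z : Set ℝ) (hZ : Z = TodaRHP.discreteData (fun n => a n 0) (fun n => b n 0))
    (γ : ℝ → ℝ) (hγ : γ = TodaRHP.normingConstant (fun n => a n 0) (fun n => b n 0))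
    (R : ℂ → ℂ) (hR : R = TodaRHP.reflection (fun n => a n 0) (fun n => b n 0))
    (n : ℤ) (t : ℝ) (m : ℂ → Fin 2 → ℂ)
    (hm : m = TodaRHP.rhpVector (fun k => a k t) (fun k => b k t) n) :
    -- the discrete scattering data are finitely many points with positive norming constants
    (Z.Finite ∧ ∀ ζ ∈ Z, 0 < γ ζ) ∧
    -- holomorphic off the unit circle and the points `ζ`, `ζ⁻¹`
    (∀ z : ℂ, ‖z‖ ≠ 1 → (∀ ζ ∈ Z, z ≠ (ζ : ℂ) ∧ z ≠ (ζ : ℂ)⁻¹) → AnalyticAt ℂ m z) ∧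
    -- jump condition, including the existence of continuous boundary values from both sides
    (∃ mp mm : ℂ → Fin 2 → ℂ,
      ContinuousOn mp (Metric.sphere 0 1) ∧ ContinuousOn mm (Metric.sphere 0 1) ∧
      ∀ z : ℂ, ‖z‖ = 1 →
        Filter.Tendsto m (nhdsWithin z {w | ‖w‖ < 1}) (nhds (mp z)) ∧
        Filter.Tendsto m (nhdsWithin z {w | 1 < ‖w‖}) (nhds (mm z)) ∧
        mp z = Matrix.vecMul (mm z) (TodaRHP.jumpMatrix R n t z)) ∧
    -- (at most) simple poles and pole conditions at `ζ` and `ζ⁻¹`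
    (∀ ζ ∈ Z,
      (∃ ρ : Fin 2 → ℂ, TodaRHP.HasSimpleResidue m (ζ : ℂ) ρ ∧
        Filter.Tendsto
          (fun z => Matrix.vecMul (m z)
            !![0, 0; -(ζ : ℂ) * (γ ζ : ℂ) * Complex.exp (TodaRHP.timesPhase n t (ζ : ℂ)), 0])
          (nhdsWithin (ζ : ℂ) {(ζ : ℂ)}ᶜ) (nhds ρ)) ∧
      (∃ ρ : Fin 2 → ℂ, TodaRHP.HasSimpleResidue m (ζ : ℂ)⁻¹ ρ ∧
        Filter.Tendsto
          (fun z => Matrix.vecMul (m z)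
            !![0, (ζ : ℂ)⁻¹ * (γ ζ : ℂ) * Complex.exp (TodaRHP.timesPhase n t (ζ : ℂ)); 0, 0])
          (nhdsWithin (ζ : ℂ)⁻¹ {(ζ : ℂ)⁻¹}ᶜ) (nhds ρ))) ∧
    -- symmetry condition, the second part being the case `z = 0`
    (∀ z : ℂ, z ≠ 0 → ‖z‖ ≠ 1 → m z⁻¹ = Matrix.vecMul (m z) !![0, 1; 1, 0]) ∧
    Filter.Tendsto m (Bornology.cobounded ℂ) (nhds (Matrix.vecMul (m 0) !![0, 1; 1, 0])) ∧
    -- normalization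
    (∃ m₁ m₂ : ℝ, m 0 = ![(m₁ : ℂ), (m₂ : ℂ)] ∧ m₁ * m₂ = 1 ∧ 0 < m₁) := by
  obtain ⟨t₀, h⟩ := hdecay
  have ha := fun t n => hsol.a_pos n t
  have hd := hsol.hasDecay h
  have hpair := hsol.isScatteringPair h ((hd 0).scatteringPair_spec (ha 0)) t
  subst hZ hγ hm
  have hZdisc : ∀ ζ ∈ TodaRHP.discreteData (fun n => a n 0) (fun n => b n 0),
      ‖(ζ : ℂ)‖ < 1 := fun ζ hζ => by simpa using hζ.2.1
  have hvec : ∀ (v : Fin 2 → ℂ) (x : ℂ),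
      Matrix.vecMul v !![0, 0; x, 0] = ![x * v 1, 0] ∧
      Matrix.vecMul v !![0, x; 0, 0] = ![0, x * v 0] := fun v x => by
    constructor <;> ext i <;> fin_cases i <;>
      simp [Matrix.vecMul, dotProduct, Fin.sum_univ_two, mul_comm]
  refine ⟨⟨?_, fun ζ hζ => ?_⟩, fun z hz hne => ?_,
    ⟨TodaRHP.rhpDisc (fun k => a k t) (fun k => b k t) n, fun z =>
      ![TodaRHP.rhpDisc (fun k => a k t) (fun k => b k t) n z⁻¹ 1,
        TodaRHP.rhpDisc (fun k => a k t) (fun k => b k t) n z⁻¹ 0],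
      (hd t).continuousOn_rhpDisc_sphere (ha t), (hd t).continuousOn_rhpDisc_inv_sphere (ha t),
      fun z hz => ⟨(hd t).tendsto_rhpVector_inner (ha t) hz,
        (hd t).tendsto_rhpVector_outer (ha t) hz, ?_⟩⟩,
    fun ζ hζ => ⟨⟨_, hsol.hasSimpleResidue h n t hζ, ?_⟩,
      ⟨_, hsol.hasSimpleResidue_inv h n t hζ, ?_⟩⟩,
    fun z hz0 hz => (hd t).rhpVector_inv (ha t) hz0 hz,
    (hd t).tendsto_rhpVector_cobounded (ha t),
    (TodaRHP.jostNorm (fun k => a k t) n)⁻¹, TodaRHP.jostNorm (fun k => a k t) n, ?_,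
    inv_mul_cancel₀ (TodaRHP.jostNorm_pos _ n).ne', inv_pos.2 (TodaRHP.jostNorm_pos _ n)⟩
  · refine Set.Finite.of_finite_image (f := fun ζ : ℝ => (ζ : ℂ))
      (((hd 0).finite_zeros (ha 0)).subset ?_) Complex.ofReal_injective.injOn
    rintro _ ⟨ζ, hζ, rfl⟩
    exact ⟨(hZdisc ζ hζ).le,
      ((hd 0).jostDet_eq_zero_iff (ha 0) (hZdisc ζ hζ)).2 ⟨ζ, hζ, rfl⟩⟩
  · exact ((hd 0).normingConstant_inv (ha 0) hζ.1 hζ.2.1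
      (((hd 0).jostDet_eq_zero_iff (ha 0) (hZdisc ζ hζ)).2 ⟨ζ, hζ, rfl⟩)).1
  · refine (hd t).analyticAt_rhpVector (ha t) hz (fun hlt hD => ?_) fun hgt hD => ?_
    · obtain ⟨ζ, hζ, rfl⟩ := (hsol.jostDet_eq_zero_iff h t hlt).1 hD
      exact (hne ζ hζ).1 rfl
    · have hlt : ‖z⁻¹‖ < 1 := by rw [norm_inv]; exact inv_lt_one_of_one_lt₀ hgt
      obtain ⟨ζ, hζ, hzζ⟩ := (hsol.jostDet_eq_zero_iff h t hlt).1 hD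
      exact (hne ζ hζ).2 (by rw [← hzζ, inv_inv])
  · rw [hR]
    exact hpair.jump (hd t) (ha t) hz
  · simp only [(hvec _ _).1]
    exact TodaRHP.tendsto_fin_two
      ((hsol.tendsto_rhpVector_one h n t (hZdisc ζ hζ)).const_mul _) tendsto_const_nhds
  · simp only [(hvec _ _).2]
    exact TodaRHP.tendsto_fin_two tendsto_const_nhds
      ((hsol.tendsto_rhpVector_inv_zero h n t (Complex.ofReal_ne_zero.2 hζ.1)
        (hZdisc ζ hζ)).const_mul _)
  · rw [(hd t).rhpVector_of_lt (ha t) (by simp), (hd t).rhpDisc_zero (ha t)]
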